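/- Let $\mathbb T=\mathbb R/2\pi\mathbb Z$ with Lebesgue measure $\mu$; functions on $\mathbb T$ are complex-valued $2\pi$-periodic functions with a finite value at every point (functions equal almost everywhere are not identified). Let $X=X(\mathbb T)$ be a Banach function lattice: a Banach space (modulo a.e. equality) of measurable functions on $\mathbb T$ such that 1. if $f$ is measurable, $g\in X$ and $|f|\le|g|$ a.e., then $f\in X$ and $\|f\|_X\le\|g\|_X$; 2. if $f_j\in X$, $\sup_j\|f_j\|_X<\infty$ and $0\le f_j\uparrow f$ a.e., then $f\in X$ and $\|f_j\|_X\to\|f\|_X$; 3. for every measurable $E\subset\mathbb T$, $\chi_E\in X$ and there is $c_E>0$ with $\int_E|f|\,d\mu\le c_E\|f\|_X$ for all $f\in X$. For $h>0$ put $A_hf(x)=\frac1h\int_{x-h/2}^{x+h/2}f(t)\,dt$ and $\dot A_hf(x)=A_hf(x+\tfrac h2)$. Assume that $A_hf\in X$ for all $f\in X$, $h>0$, and that $\sup_{h>0,\ \|f\|_X\le1}\|A_hf\|_X<\infty$. Let $r,s\in\mathbb N=\{1,2,\dots\}$ with $2r\ge s$. Let $(\Phi_n)_{n\ge0}$ be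 linear subspaces of $X$ with $\Phi_0=\{0\}$ and $\Phi_k\subset\Phi_n$ for $k\le n$, for which there is $B>0$ such that for all $n$, all $\varphi\in\Phi_n$ and all $1\le j\le s$: $\varphi^{(j-1)}$ exists and is absolutely continuous, $\varphi^{(j)}\in X$, and $\|\varphi^{(j)}\|_X\le(Bn)^j\|\varphi\|_X$. Let $\gamma,\gamma'>0$. For every $n\in\mathbb N$ let $x_{1,n}<\dots<x_{m_n,n}$ be points of $\mathbb T$ with $\frac{\gamma}{n}\le x_{k+1,n}-x_{k,n}\le\frac{\gamma'}{n}$, $k=1,\dots,m_n$, where $x_{m_n+1,n}:=x_{1,n}+2\pi$, let $\varphi_{k,n}\in\Phi_n$, and define $$G_nf(x)=\sum_{k=1}^{m_n}f(x_{k,n})\varphi_{k,n}(x),\qquad \|f\|_{X_n}=\Big\|\sum_{k=1}^{m_n}|f(x_{k,n})|\,\chi_{[x_{k,n},x_{k+1,n})}\Big\|_X .$$ Assume that there are constants $K_1,K_2,K_3>0$ such that for all $n\in\mathbb N$ - $(A_1)$ $\|G_nf\|_X\le K_1\|f\|_{X_n}$ for all $f\in X$; - $(A_2)$ $K_2\|f\|_{X_n}\le\|G_nf\|_X$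 for all $f\in X$; - $(A_3)$ $\|T-G_nT\|_X\le K_3n^{-s}\|T^{(s)}\|_X$ for all trigonometric polynomials $T$ of degree at most $n$. Then for every $f\in X$ and every $\alpha\in(0,s)$ the following are equivalent, as $n\to\infty$: - (i) $\|f-G_nf\|_X=\mathcal O(n^{-\alpha})$; - (ii) $\|(I-A_{\gamma/n})^rf\|_{X_n}+\|(I-\dot A_{\gamma/n})^sf\|_X=\mathcal O(n^{-\alpha})$. -/

import Mathlib

open MeasureTheory Set Filter Asymptotics Topology

/-- A Banach function lattice `X = X(𝕋)` on the circle `𝕋 = ℝ / 2πℤ`.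

A function on `𝕋` is a `2π`-periodic function `ℝ → ℂ`, with a value at every point; members of `X`
are not identified when they agree almost everywhere. "Measurable" is Lebesgue measurable, that is,
`AEMeasurable` for `volume`, and inequalities and limits between measurable functions are understood
almost everywhere, so that `nrm` is a norm after identification of a.e. equal functions.
`nrm f` is the norm `‖f‖_X`; its values matter only for `f ∈ carrier`. -/
structure BanachFunctionLattice where
  /-- the functions that belong to `X` -/
  carrier : Submodule ℂ (ℝ → ℂ)
  /-- the norm `‖·‖_X` -/
  nrm : (ℝ → ℂ) → ℝ
  periodic : ∀ f ∈ carrier, Function.Periodic f (2 * Real.pi)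
  measurable : ∀ f ∈ carrier, AEMeasurable f volume
  nrm_add_le : ∀ f ∈ carrier, ∀ g ∈ carrier, nrm (f + g) ≤ nrm f + nrm g
  nrm_smul : ∀ c : ℂ, ∀ f ∈ carrier, nrm (c • f) = ‖c‖ * nrm f
  /-- completeness -/
  complete : ∀ F : ℕ → ℝ → ℂ, (∀ n, F n ∈ carrier) →
    (∀ ε > 0, ∃ N, ∀ p ≥ N, ∀ q ≥ N, nrm (F p - F q) < ε) →
    ∃ f ∈ carrier, Tendsto (fun n => nrm (F n - f)) atTop (𝓝 0)
  /-- the ideal property -/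
  ideal : ∀ f : ℝ → ℂ, ∀ g ∈ carrier, Function.Periodic f (2 * Real.pi) → AEMeasurable f volume →
    (∀ᵐ x, ‖f x‖ ≤ ‖g x‖) → f ∈ carrier ∧ nrm f ≤ nrm g
  /-- the Fatou property: if `0 ≤ F n ↑ f` and the norms are bounded, then `f ∈ X` and
  `‖F n‖_X → ‖f‖_X` -/
  fatou : ∀ (F : ℕ → ℝ → ℝ) (f : ℝ → ℝ), (∀ n, (fun x => (F n x : ℂ)) ∈ carrier) →
    (∃ M, ∀ n, nrm (fun x => (F n x : ℂ)) ≤ M) → Function.Periodic f (2 * Real.pi) →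
    (∀ᵐ x, (∀ n, 0 ≤ F n x) ∧ Monotone (fun n => F n x) ∧
      Tendsto (fun n => F n x) atTop (𝓝 (f x))) →
    (fun x => (f x : ℂ)) ∈ carrier ∧
      Tendsto (fun n => nrm (fun x => (F n x : ℂ))) atTop (𝓝 (nrm (fun x => (f x : ℂ))))
  /-- characteristic functions of measurable sets `E ⊆ 𝕋` (as `2π`-periodic sets) belong to `X` -/
  indicator_mem : ∀ E : Set ℝ, NullMeasurableSet E volume →
    (∀ x, x + 2 * Real.pi ∈ E ↔ x ∈ E) → E.indicator (fun _ => (1 : ℂ)) ∈ carrier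
  /-- `∫_E |f| ≤ c_E ‖f‖_X`; the normalization of the measure of `𝕋` is absorbed in `c_E` -/
  lintegral_le : ∀ E : Set ℝ, NullMeasurableSet E volume →
    (∀ x, x + 2 * Real.pi ∈ E ↔ x ∈ E) → ∃ c > 0, ∀ f ∈ carrier,
      ∫⁻ x in E ∩ Ico (-Real.pi) Real.pi, ‖f x‖ₑ ≤ ENNReal.ofReal (c * nrm f)

/-- The Steklov average `A_h f(x) = h⁻¹ ∫_{x-h/2}^{x+h/2} f(t) dt`. -/
noncomputable def steklov (h : ℝ) (f : ℝ → ℂ) : ℝ → ℂ :=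
  fun x => (h : ℂ)⁻¹ * ∫ t in (x - h / 2)..(x + h / 2), f t

/-- The one-sided Steklov average `Ȧ_h f(x) = A_h f(x + h/2)`. -/
noncomputable def steklovDot (h : ℝ) (f : ℝ → ℂ) : ℝ → ℂ :=
  fun x => steklov h f (x + h / 2)

/-- The operator power `(I - L)^r f`. -/
def oneSubPow (L : (ℝ → ℂ) → (ℝ → ℂ)) (r : ℕ) (f : ℝ → ℂ) : ℝ → ℂ :=
  (fun g => g - L g)^[r] f

/-- Trigonometric polynomials `∑_{|k| ≤ n} c_k e^{ikx}` of degree at most `n`. -/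
def IsTrigPoly (n : ℕ) (T : ℝ → ℂ) : Prop :=
  ∃ c : ℤ → ℂ, ∀ x : ℝ, T x = ∑ k ∈ Finset.Icc (-(n : ℤ)) n, c k * Complex.exp (Complex.I * k * x)

/-- Nodes `x_{0,n} < … < x_{m_n - 1,n}` on `𝕋` (as reals, numbered from `0`), with the convention
`x_{m_n,n} = x_{0,n} + 2π` and all gaps between `γ/n` and `γ'/n`, for every `n ≥ 1`. -/
structure IsNodeSystem (γ γ' : ℝ) (m : ℕ → ℕ) (x : ℕ → ℕ → ℝ) : Prop where
  wrap : ∀ n ≥ 1, x n (m n) = x n 0 + 2 * Real.pi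
  gap_ge : ∀ n ≥ 1, ∀ k < m n, γ / n ≤ x n (k + 1) - x n k
  gap_le : ∀ n ≥ 1, ∀ k < m n, x n (k + 1) - x n k ≤ γ' / n

/-- The arc `[a, b)` of `𝕋`, as a `2π`-periodic subset of `ℝ`. -/
def arc (a b : ℝ) : Set ℝ := {y | ∃ j : ℤ, y + j * (2 * Real.pi) ∈ Ico a b}

/-- The step function `∑_k |f(x_k)| χ_{[x_k, x_{k+1})}`, `0 ≤ k < N`. -/
noncomputable def stepFun (N : ℕ) (x : ℕ → ℝ) (f : ℝ → ℂ) : ℝ → ℂ :=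
  fun y => ∑ k ∈ Finset.range N,
    (arc (x k) (x (k + 1))).indicator (fun _ => ((‖f (x k)‖ : ℝ) : ℂ)) y

/-- The sampling operator `f ↦ ∑_k f(x_k) φ_k`, `0 ≤ k < N`. -/
def samplingOp (N : ℕ) (x : ℕ → ℝ) (φ : ℕ → ℝ → ℂ) (f : ℝ → ℂ) : ℝ → ℂ :=
  fun y => ∑ k ∈ Finset.range N, f (x k) * φ k y

namespace BanachFunctionLattice

variable (X : BanachFunctionLattice)

/-- The Steklov averages act in `X` and are uniformly bounded there. -/
def SteklovBounded : Prop :=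
  (∀ f ∈ X.carrier, ∀ h > 0, steklov h f ∈ X.carrier) ∧
    ∃ C : ℝ, ∀ h > 0, ∀ f ∈ X.carrier, X.nrm f ≤ 1 → X.nrm (steklov h f) ≤ C

/-- The discrete semi-norm `‖∑_k |f(x_k)| χ_{[x_k, x_{k+1})}‖_X`. -/
noncomputable def discreteNrm (N : ℕ) (x : ℕ → ℝ) (f : ℝ → ℂ) : ℝ := X.nrm (stepFun N x f)

/-- The Sobolev-type space `X^r`, `r ≥ 1`: `f^{(r-1)}` exists and is locally absolutely continuous,
and the (a.e. defined) derivative `f^{(r)}` belongs to `X`. -/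
def MemSobolev (r : ℕ) (f : ℝ → ℂ) : Prop :=
  ContDiff ℝ ((r - 1 : ℕ) : ℕ∞) f ∧
    (∀ a b : ℝ, AbsolutelyContinuousOnInterval (iteratedDeriv (r - 1) f) a b) ∧
    iteratedDeriv r f ∈ X.carrier

/-- `(Φ_n)` is a nested family of linear subspaces of `X` with `Φ_0 = {0}` that satisfies the
Bernstein-type inequality `‖φ^{(r)}‖_X ≤ (B n)^r ‖φ‖_X` for `φ ∈ Φ_n` in the orders
`1 ≤ r ≤ s`. -/
structure IsBernsteinFamily (s : ℕ) (Φ : ℕ → Submodule ℂ (ℝ → ℂ)) : Prop where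
  le_carrier : ∀ n, Φ n ≤ X.carrier
  zero : Φ 0 = ⊥
  mono : Monotone Φ
  bernstein : ∃ B > 0, ∀ n, ∀ φ ∈ Φ n, ∀ r, 1 ≤ r → r ≤ s →
    X.MemSobolev r φ ∧ X.nrm (iteratedDeriv r φ) ≤ (B * n) ^ r * X.nrm φ

end BanachFunctionLattice

/-! Both directions compare `f` with smooth functions at scale `1/n`: trigonometric polynomials
`T_n` for (ii) ⇒ (i), the functions `G_n f` for (i) ⇒ (ii). If the approximants have error
`O(n^{-α})`, Bernstein's inequality and telescoping along `n, n/2, n/4, …` bound their `s`-th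
derivatives by `O(n^{s-α})`, because `α < s` (`exists_growth_of_bernstein`). Every error of the form
`n^{-s} ‖s-th derivative‖` is then `O(n^{-α})`.

The obstacle is that `‖g‖_{X_n}` is not bounded by `‖g‖_X`. But `I - (I - A)^r` is a combination of
terms `A(I - A)^k`, and samples of averages are controlled by the norm, so `‖g‖_{X_n}` and `‖(I -
A)^r g‖_{X_n}` differ by `O(‖g‖_X)` (`discreteNrm_sub_pow_le`). For smooth `g` the latter has order
`n^{-s}`, since the symmetric average is accurate of second order and `s ≤ 2r`
(`discreteNrm_pow_le`).

(ii) ⇒ (i): the one-sided differences of `f` produce the `T_n` (`exists_trig_near_best`). In `f -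
G_n f = (f - T_n) + (T_n - G_n T_n) - G_n(f - T_n)` the middle term is small by (A3); by (A1) the
last one reduces to `‖f - T_n‖_{X_n}`, which the comparison above reduces to the discrete term of
(ii).

(i) ⇒ (ii): let `φ = G_n f`. Jackson's theorem (`exists_trig_approx`) with (A1) and (A3) gives `‖φ -
G_n φ‖ = O(n^{-s} ‖φ^{(s)}‖)`. Since `G_n(f - φ) = φ - G_n φ`, (A2) bounds `‖f - φ‖_{X_n}`, and the
comparison above finishes the discrete term; the other term splits into the small `f - φ` and the
smooth `φ`.

`X` need not be translation invariant, so the classical inequalities are all derived from one fact,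
`WindowBound`: the integral of `|v|` over a window of radius `ρ` has norm `O(ρ ‖v‖)`. Convolution
kernels are dominated by dyadic sums of windows. -/

namespace BanachFunctionLattice

/-! ### The members of `X` as a complex seminormed space. -/

variable (X : BanachFunctionLattice)

theorem nrm_zero : X.nrm 0 = 0 := by
  simpa using X.nrm_smul 0 0 X.carrier.zero_mem

theorem nrm_nonneg {f : ℝ → ℂ} (hf : f ∈ X.carrier) : 0 ≤ X.nrm f := by
  have h := (X.ideal 0 f hf (fun _ => rfl) aemeasurable_const
    (Eventually.of_forall fun x => by simp)).2
  rwa [nrm_zero] at h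

/-- The members of `X`, as a seminormed space. -/
def Elem : Type := X.carrier

noncomputable instance : AddCommGroup X.Elem := inferInstanceAs (AddCommGroup X.carrier)

noncomputable instance : Module ℂ X.Elem := inferInstanceAs (Module ℂ X.carrier)

instance : FunLike X.Elem ℝ ℂ where
  coe := fun u => Subtype.val (p := fun f => f ∈ X.carrier) u
  coe_injective := Subtype.val_injective

noncomputable instance : Norm X.Elem := ⟨fun u => X.nrm u⟩

/-- Only a seminorm: functions equal almost everywhere stay distinct, because sampling reads values
at points. -/
theorem seminormCore : SeminormedSpace.Core ℂ X.Elem where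
  norm_nonneg u := X.nrm_nonneg (Subtype.property u)
  norm_smul c u := X.nrm_smul c u (Subtype.property u)
  norm_triangle u v := X.nrm_add_le u (Subtype.property u) v (Subtype.property v)

noncomputable instance : SeminormedAddCommGroup X.Elem :=
  SeminormedAddCommGroup.ofCore X.seminormCore

noncomputable instance : NormedSpace ℂ X.Elem where
  norm_smul_le c u := (X.nrm_smul c u (Subtype.property u)).le

variable {X}

/-- A function that belongs to `X`, as an element of the seminormed space. -/
def toElem (f : ℝ → ℂ) (hf : f ∈ X.carrier) : X.Elem := ⟨f, hf⟩

@[simp] theorem coe_toElem (f : ℝ → ℂ) (hf : f ∈ X.carrier) : (toElem f hf : ℝ → ℂ) = f := rfl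

theorem norm_toElem (f : ℝ → ℂ) (hf : f ∈ X.carrier) : ‖toElem f hf‖ = X.nrm f := rfl

theorem norm_def (u : X.Elem) : ‖u‖ = X.nrm u := rfl

namespace Elem

@[simp] theorem coe_add (u v : X.Elem) : ((u + v : X.Elem) : ℝ → ℂ) = u + v := rfl
@[simp] theorem coe_sub (u v : X.Elem) : ((u - v : X.Elem) : ℝ → ℂ) = u - v := rfl
@[simp] theorem coe_zero : ((0 : X.Elem) : ℝ → ℂ) = 0 := rfl
@[simp] theorem coe_smul (c : ℂ) (u : X.Elem) : ((c • u : X.Elem) : ℝ → ℂ) = c • ⇑u := rfl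

theorem ext {u v : X.Elem} (h : ∀ x, u x = v x) : u = v := DFunLike.ext _ _ h

theorem mem (u : X.Elem) : (u : ℝ → ℂ) ∈ X.carrier := Subtype.property u

theorem periodic (u : X.Elem) : Function.Periodic u (2 * Real.pi) := X.periodic u u.mem

theorem aemeasurable (u : X.Elem) : AEMeasurable u volume := X.measurable u u.mem

@[simp] theorem coe_sum {ι : Type*} (S : Finset ι) (u : ι → X.Elem) (x : ℝ) :
    (∑ i ∈ S, u i : X.Elem) x = ∑ i ∈ S, u i x := by
  classical
  induction S using Finset.induction_on with
  | empty => rfl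
  | insert i S hi ih => rw [Finset.sum_insert hi, Finset.sum_insert hi, coe_add, Pi.add_apply, ih]

/-- Axiom 3 with `E` the whole circle gives integrability over one period; periodicity does the
rest. -/
theorem intervalIntegrable (u : X.Elem) (a b : ℝ) : IntervalIntegrable u volume a b := by
  obtain ⟨c, hc, H⟩ := X.lintegral_le univ MeasurableSet.univ.nullMeasurableSet (by simp)
  have h := H u u.mem
  rw [univ_inter] at h
  have hI : IntegrableOn u (Ico (-Real.pi) Real.pi) volume :=
    ⟨u.aemeasurable.aestronglyMeasurable.restrict, h.trans_lt ENNReal.ofReal_lt_top⟩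
  have hp : IntervalIntegrable u volume (-Real.pi) (-Real.pi + 2 * Real.pi) := by
    rw [intervalIntegrable_iff_integrableOn_Ico_of_le (by linarith [Real.pi_pos])]
    rwa [show -Real.pi + 2 * Real.pi = Real.pi by ring]
  exact Function.Periodic.intervalIntegrable u.periodic Real.two_pi_pos.ne' hp a b

theorem norm_eq_of_ae_eq {u v : X.Elem} (h : ∀ᵐ x, u x = v x) : ‖u‖ = ‖v‖ := by
  refine le_antisymm ?_ ?_
  · exact (X.ideal u v v.mem u.periodic u.aemeasurable (h.mono fun x hx => by rw [hx])).2
  · exact (X.ideal v u u.mem v.periodic v.aemeasurable (h.mono fun x hx => by rw [hx])).2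

end Elem

theorem mem_of_bounded {f : ℝ → ℂ} (hp : Function.Periodic f (2 * Real.pi))
    (hm : AEMeasurable f volume) {M : ℝ} (hM : ∀ x, ‖f x‖ ≤ M) : f ∈ X.carrier := by
  have h1 := X.indicator_mem univ MeasurableSet.univ.nullMeasurableSet (by simp)
  have h2 := X.carrier.smul_mem (M : ℂ) h1
  refine (X.ideal f _ h2 hp hm (Eventually.of_forall fun x => ?_)).1
  simpa using (hM x).trans (le_abs_self M)

theorem mem_of_continuous {f : ℝ → ℂ} (hp : Function.Periodic f (2 * Real.pi))
    (hc : Continuous f) : f ∈ X.carrier := by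
  obtain ⟨M, hM⟩ := (isCompact_Icc (a := (0 : ℝ)) (b := 2 * Real.pi)).exists_bound_of_continuousOn
    hc.continuousOn
  refine mem_of_bounded hp hc.measurable.aemeasurable (M := M) fun x => ?_
  obtain ⟨y, hy, hxy⟩ := hp.exists_mem_Ico₀ Real.two_pi_pos x
  rw [hxy]
  exact hM y ⟨hy.1, hy.2.le⟩

end BanachFunctionLattice

/-! ### Window integrals and the domination principle. -/

/-- The integral of `|v|` over the window of radius `ρ` around a point. -/
noncomputable def windowIntegral (ρ : ℝ) (v : ℝ → ℂ) (x : ℝ) : ℝ := ∫ t in (x - ρ)..(x + ρ), ‖v t‖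

theorem windowIntegral_nonneg {ρ : ℝ} (hρ : 0 ≤ ρ) (v : ℝ → ℂ) (x : ℝ) :
    0 ≤ windowIntegral ρ v x :=
  intervalIntegral.integral_nonneg (by linarith) fun _ _ => norm_nonneg _

namespace BanachFunctionLattice

variable {X : BanachFunctionLattice}

namespace Elem

theorem integral_norm_le_windowIntegral (v : X.Elem) {a b x ρ : ℝ} (hab : a ≤ b) (ha : x - ρ ≤ a)
    (hb : b ≤ x + ρ) : ∫ t in a..b, ‖v t‖ ≤ windowIntegral ρ v x := by
  refine intervalIntegral.integral_mono_interval ha hab hb ?_ (v.intervalIntegrable _ _).norm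
  exact Eventually.of_forall fun t => norm_nonneg _

theorem norm_integral_le_windowIntegral (v : X.Elem) {a b x ρ : ℝ} (ha : a ∈ Icc (x - ρ) (x + ρ))
    (hb : b ∈ Icc (x - ρ) (x + ρ)) : ‖∫ t in a..b, v t‖ ≤ windowIntegral ρ v x := by
  wlog hab : a ≤ b generalizing a b
  · rw [intervalIntegral.integral_symm, norm_neg]
    exact this hb ha (le_of_not_ge hab)
  exact (intervalIntegral.norm_integral_le_integral_norm hab).trans
    (v.integral_norm_le_windowIntegral hab ha.1 hb.2)

theorem windowIntegral_mono (v : X.Elem) {x y ρ σ : ℝ} (hρ : 0 ≤ ρ) (h : |x - y| + ρ ≤ σ) :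
    windowIntegral ρ v x ≤ windowIntegral σ v y := by
  have := abs_le.1 (le_refl |x - y|)
  exact v.integral_norm_le_windowIntegral (by linarith) (by linarith) (by linarith)

theorem windowIntegral_periodic (v : X.Elem) (ρ : ℝ) :
    Function.Periodic (windowIntegral ρ v) (2 * Real.pi) := by
  intro x
  simp only [windowIntegral]
  rw [show x + 2 * Real.pi - ρ = x - ρ + 2 * Real.pi by ring,
    show x + 2 * Real.pi + ρ = x + ρ + 2 * Real.pi by ring,
    ← intervalIntegral.integral_comp_add_right (fun t => ‖v t‖)]
  simp only [v.periodic _]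

end Elem

variable (X) in
/-- The window integrals are bounded in `X`, with norm proportional to the radius. -/
def WindowBound (C : ℝ) : Prop :=
  0 < C ∧ ∀ ρ > 0, ∀ v : X.Elem, (fun x => (windowIntegral ρ v x : ℂ)) ∈ X.carrier ∧
    X.nrm (fun x => (windowIntegral ρ v x : ℂ)) ≤ C * ρ * ‖v‖

/-- Homogeneity turns the bound on the unit ball into a linear one. Scaling by `X.nrm f + δ` instead
of `X.nrm f` covers functions of norm zero, and `max C 1` makes the constant positive. -/
theorem SteklovBounded.exists_bound (hX : X.SteklovBounded) :
    ∃ C > 0, ∀ h > 0, ∀ f ∈ X.carrier, X.nrm (steklov h f) ≤ C * X.nrm f := by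
  obtain ⟨hm, C, hC⟩ := hX
  refine ⟨max C 1, by positivity, fun h hh f hf => ?_⟩
  have hlin : ∀ c : ℝ, steklov h ((c : ℂ) • f) = (c : ℂ) • steklov h f := by
    intro c; ext x; simp [steklov]; ring
  refine le_of_forall_pos_le_add fun ε hε => ?_
  set δ := ε / max C 1 with hδ
  have hC1 : 0 < max C 1 := by positivity
  have hδ0 : 0 < δ := by positivity
  have hn := X.nrm_nonneg hf
  have hp : 0 < X.nrm f + δ := by positivity
  have h1 := hC h hh _ (X.carrier.smul_mem (((X.nrm f + δ)⁻¹ : ℝ) : ℂ) hf)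
  rw [hlin, X.nrm_smul _ _ hf, X.nrm_smul _ _ (hm f hf h hh), Complex.norm_real,
    Real.norm_of_nonneg (by positivity)] at h1
  have h2 := h1 (by rw [inv_mul_le_iff₀ hp]; linarith)
  rw [inv_mul_le_iff₀ hp] at h2
  calc X.nrm (steklov h f) ≤ (X.nrm f + δ) * C := h2
    _ ≤ (X.nrm f + δ) * max C 1 := by gcongr; exact le_max_left _ _
    _ = max C 1 * X.nrm f + ε := by rw [hδ]; field_simp

/-- The window integral of radius `ρ` is `2ρ` times the Steklov average of `|v|` with step `2ρ`. -/
theorem SteklovBounded.exists_windowBound (hX : X.SteklovBounded) : ∃ C, X.WindowBound C := by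
  obtain ⟨C, hC, H⟩ := hX.exists_bound
  refine ⟨2 * C, by positivity, fun ρ hρ v => ?_⟩
  have habs := X.ideal (fun x => ((‖v x‖ : ℝ) : ℂ)) v v.mem
    (fun x => by simp only [v.periodic x]) (by
      have := v.aemeasurable
      fun_prop) (Eventually.of_forall fun x => by simp)
  have e : (fun x => (windowIntegral ρ v x : ℂ)) =
      ((2 * ρ : ℝ) : ℂ) • steklov (2 * ρ) (fun x => ((‖v x‖ : ℝ) : ℂ)) := by
    ext x
    simp only [steklov, Pi.smul_apply, smul_eq_mul, windowIntegral]
    rw [intervalIntegral.integral_ofReal, ← mul_assoc, mul_inv_cancel₀ (by norm_cast; positivity),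
      one_mul]
    congr 3 <;> ring
  have hm := hX.1 _ habs.1 (2 * ρ) (by positivity)
  rw [e]
  refine ⟨X.carrier.smul_mem _ hm, ?_⟩
  rw [X.nrm_smul _ _ hm, Complex.norm_real, Real.norm_of_nonneg (by positivity)]
  calc 2 * ρ * X.nrm (steklov (2 * ρ) fun x => ((‖v x‖ : ℝ) : ℂ))
      ≤ 2 * ρ * (C * ‖v‖) := by
        gcongr
        exact (H _ (by positivity) _ habs.1).trans (by gcongr; exact habs.2)
    _ = _ := by ring

theorem WindowBound.pos {C : ℝ} (hC : X.WindowBound C) : 0 < C := hC.1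

/-- A function dominated by a combination of window integrals of `v ∈ X` belongs to `X`. -/
theorem WindowBound.dominated_sum {C : ℝ} (hC : X.WindowBound C) {ι : Type*} (S : Finset ι)
    (c ρ : ι → ℝ) (hc : ∀ i ∈ S, 0 ≤ c i) (hρ : ∀ i ∈ S, 0 < ρ i) (v : X.Elem) {u : ℝ → ℂ}
    (hp : Function.Periodic u (2 * Real.pi)) (hm : AEMeasurable u volume)
    (h : ∀ x, ‖u x‖ ≤ ∑ i ∈ S, c i * windowIntegral (ρ i) v x) :
    u ∈ X.carrier ∧ X.nrm u ≤ C * (∑ i ∈ S, c i * ρ i) * ‖v‖ := by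
  classical
  let w : ι → X.Elem := fun i => if hi : i ∈ S then
    toElem (fun x => (windowIntegral (ρ i) v x : ℂ)) (hC.2 (ρ i) (hρ i hi) v).1 else 0
  have hw : ∀ i ∈ S, ∀ x, w i x = (windowIntegral (ρ i) v x : ℂ) := by
    intro i hi x; simp [w, hi]
  have hwn : ∀ i ∈ S, ‖w i‖ ≤ C * ρ i * ‖v‖ := by
    intro i hi; simp only [w, hi, dite_true]; exact (hC.2 (ρ i) (hρ i hi) v).2
  have key := X.ideal u (∑ i ∈ S, (c i : ℂ) • w i : X.Elem) (Elem.mem _) hp hm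
    (Eventually.of_forall fun x => by
      refine (h x).trans ?_
      have : (∑ i ∈ S, (c i : ℂ) • w i : X.Elem) x =
          ((∑ i ∈ S, c i * windowIntegral (ρ i) v x : ℝ) : ℂ) := by
        rw [Elem.coe_sum]
        push_cast
        exact Finset.sum_congr rfl fun i hi => by
          rw [Elem.coe_smul, Pi.smul_apply, hw i hi, smul_eq_mul]
      rw [this, Complex.norm_real]
      exact Real.le_norm_self _)
  refine ⟨key.1, key.2.trans ?_⟩
  rw [← norm_def]
  calc ‖∑ i ∈ S, (c i : ℂ) • w i‖ ≤ ∑ i ∈ S, ‖(c i : ℂ) • w i‖ := norm_sum_le _ _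
    _ ≤ ∑ i ∈ S, c i * (C * ρ i * ‖v‖) := Finset.sum_le_sum fun i hi => by
        rw [norm_smul, Complex.norm_real, Real.norm_of_nonneg (hc i hi)]
        exact mul_le_mul_of_nonneg_left (hwn i hi) (hc i hi)
    _ = _ := by
        rw [Finset.mul_sum, Finset.sum_mul]
        exact Finset.sum_congr rfl fun i _ => by ring

theorem WindowBound.dominated {C : ℝ} (hC : X.WindowBound C) {c ρ : ℝ} (hc : 0 ≤ c) (hρ : 0 < ρ)
    (v : X.Elem) {u : ℝ → ℂ} (hp : Function.Periodic u (2 * Real.pi)) (hm : AEMeasurable u volume)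
    (h : ∀ x, ‖u x‖ ≤ c * windowIntegral ρ v x) :
    u ∈ X.carrier ∧ X.nrm u ≤ C * (c * ρ) * ‖v‖ := by
  simpa using hC.dominated_sum (Finset.univ : Finset Unit) (fun _ => c) (fun _ => ρ)
    (fun _ _ => hc) (fun _ _ => hρ) v hp hm (by simpa using h)

end BanachFunctionLattice

/-! ### Indefinite integrals and the smoothing and accuracy of Steklov averages. -/

/-- `u` is an indefinite integral of `v`. -/
def IsPrimitive (u v : ℝ → ℂ) : Prop := ∀ a b : ℝ, u b - u a = ∫ t in a..b, v t

theorem IsPrimitive.of_hasDerivAt {u v : ℝ → ℂ} (h : ∀ x, HasDerivAt u (v x) x)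
    (hv : Continuous v) : IsPrimitive u v := fun a b =>
  (intervalIntegral.integral_eq_sub_of_hasDerivAt (fun x _ => h x)
    (hv.intervalIntegrable a b)).symm

/-- The average of `f` over `[x + c - h/2, x + c + h/2]`. -/
noncomputable def shiftedAverage (h c : ℝ) (f : ℝ → ℂ) : ℝ → ℂ := fun x => steklov h f (x + c)

theorem shiftedAverage_zero (h : ℝ) (f : ℝ → ℂ) : shiftedAverage h 0 f = steklov h f := by
  ext x; simp [shiftedAverage]

theorem shiftedAverage_half (h : ℝ) (f : ℝ → ℂ) :
    shiftedAverage h (h / 2) f = steklovDot h f := rfl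

namespace BanachFunctionLattice

variable {X : BanachFunctionLattice}

namespace Elem

theorem isPrimitive_sub {u v u' v' : X.Elem} (h : IsPrimitive u v) (h' : IsPrimitive u' v') :
    IsPrimitive (u - u' : X.Elem) (v - v' : X.Elem) := by
  intro a b
  simp only [coe_sub, Pi.sub_apply]
  rw [intervalIntegral.integral_sub (v.intervalIntegrable _ _) (v'.intervalIntegrable _ _),
    ← h a b, ← h' a b]
  ring

theorem isPrimitive_add {u v u' v' : X.Elem} (h : IsPrimitive u v) (h' : IsPrimitive u' v') :
    IsPrimitive (u + u' : X.Elem) (v + v' : X.Elem) := by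
  intro a b
  simp only [coe_add, Pi.add_apply]
  rw [intervalIntegral.integral_add (v.intervalIntegrable _ _) (v'.intervalIntegrable _ _),
    ← h a b, ← h' a b]
  ring

theorem isPrimitive_zero : IsPrimitive (0 : X.Elem) (0 : X.Elem) := by
  intro a b; simp

theorem continuous_of_isPrimitive {u : ℝ → ℂ} {v : X.Elem} (h : IsPrimitive u v) :
    Continuous u := by
  have : u = fun x => u 0 + ∫ t in (0 : ℝ)..x, v t := by
    ext x; rw [← h 0 x]; ring
  rw [this]
  exact continuous_const.add (intervalIntegral.continuous_primitive v.intervalIntegrable 0)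

theorem norm_sub_le_windowIntegral {u : ℝ → ℂ} {v : X.Elem} (h : IsPrimitive u v) {a b x ρ : ℝ}
    (ha : a ∈ Icc (x - ρ) (x + ρ)) (hb : b ∈ Icc (x - ρ) (x + ρ)) :
    ‖u b - u a‖ ≤ windowIntegral ρ v x := by
  rw [h a b]; exact v.norm_integral_le_windowIntegral ha hb

end Elem

/-- For these shifts the interval of averaging stays within distance `h` of `x`. The shift `0` is
the symmetric average, `h / 2` the one-sided one, so both are treated together. -/
theorem norm_shiftedAverage_le {h c : ℝ} (hh : 0 < h) (hc : c ∈ Icc 0 (h / 2)) (u : X.Elem)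
    (x : ℝ) : ‖shiftedAverage h c u x‖ ≤ h⁻¹ * windowIntegral h u x := by
  simp only [shiftedAverage, steklov]
  rw [norm_mul, norm_inv, Complex.norm_real, Real.norm_of_nonneg hh.le]
  gcongr
  obtain ⟨h0, h1⟩ := hc
  exact u.norm_integral_le_windowIntegral ⟨by linarith, by linarith⟩ ⟨by linarith, by linarith⟩

theorem shiftedAverage_eq (h c : ℝ) (u : X.Elem) (x : ℝ) : shiftedAverage h c u x =
    (h : ℂ)⁻¹ * ((∫ t in (0 : ℝ)..(x + (c + h / 2)), u t)
      - ∫ t in (0 : ℝ)..(x + (c - h / 2)), u t) := by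
  simp only [shiftedAverage, steklov]
  rw [intervalIntegral.integral_interval_sub_left (u.intervalIntegrable _ _)
    (u.intervalIntegrable _ _)]
  congr 2 <;> ring_nf

theorem continuous_shiftedAverage (h c : ℝ) (u : X.Elem) : Continuous (shiftedAverage h c u) := by
  have e : shiftedAverage h c u = _ := funext (shiftedAverage_eq h c u)
  rw [e]
  have := intervalIntegral.continuous_primitive u.intervalIntegrable 0
  exact continuous_const.mul ((this.comp (continuous_add_const _)).sub
    (this.comp (continuous_add_const _)))

theorem periodic_shiftedAverage (h c : ℝ) (u : X.Elem) :
    Function.Periodic (shiftedAverage h c u) (2 * Real.pi) := by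
  intro x
  simp only [shiftedAverage, steklov]
  rw [show x + 2 * Real.pi + c - h / 2 = x + c - h / 2 + 2 * Real.pi by ring,
    show x + 2 * Real.pi + c + h / 2 = x + c + h / 2 + 2 * Real.pi by ring,
    ← intervalIntegral.integral_comp_add_right (fun t => u t)]
  simp only [u.periodic _]

theorem hasDerivAt_shiftedAverage (h c : ℝ) (u : X.Elem) (hu : Continuous u) (x : ℝ) :
    HasDerivAt (shiftedAverage h c u)
      ((h : ℂ)⁻¹ * (u (x + (c + h / 2)) - u (x + (c - h / 2)))) x := by
  have e : shiftedAverage h c u = _ := funext (shiftedAverage_eq h c u)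
  rw [e]
  have key : ∀ d : ℝ, HasDerivAt (fun x => ∫ t in (0 : ℝ)..(x + d), u t) (u (x + d)) x := by
    intro d
    have := intervalIntegral.integral_hasDerivAt_right (hu.intervalIntegrable 0 (x + d))
      (hu.stronglyMeasurableAtFilter _ _) hu.continuousAt
    exact this.comp_add_const x d
  exact ((key _).sub (key _)).const_mul _

variable {C : ℝ}

/-- The shifted Steklov average as a bounded operator on `X`. -/
noncomputable def WindowBound.average (hC : X.WindowBound C) {h c : ℝ} (hh : 0 < h)
    (hc : c ∈ Icc 0 (h / 2)) : X.Elem →L[ℂ] X.Elem :=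
  LinearMap.mkContinuous
    { toFun := fun u => toElem (shiftedAverage h c u)
        (mem_of_continuous (periodic_shiftedAverage h c u) (continuous_shiftedAverage h c u))
      map_add' := fun u v => by
        refine Elem.ext fun x => ?_
        simp only [shiftedAverage, steklov, coe_toElem, Elem.coe_add, Pi.add_apply]
        rw [intervalIntegral.integral_add (u.intervalIntegrable _ _) (v.intervalIntegrable _ _)]
        ring
      map_smul' := fun a u => by
        refine Elem.ext fun x => ?_
        simp only [shiftedAverage, steklov, coe_toElem, Elem.coe_smul, Pi.smul_apply, smul_eq_mul,
          RingHom.id_apply, intervalIntegral.integral_const_mul]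
        ring } C
    (fun u => by
      have := (hC.dominated (inv_pos.2 hh).le hh u (periodic_shiftedAverage h c u)
        (continuous_shiftedAverage h c u).measurable.aemeasurable
        (norm_shiftedAverage_le hh hc u)).2
      rwa [inv_mul_cancel₀ hh.ne', mul_one] at this)

variable (hC : X.WindowBound C) {h c : ℝ} (hh : 0 < h) (hc : c ∈ Icc 0 (h / 2))

@[simp] theorem WindowBound.coe_average (u : X.Elem) :
    (hC.average hh hc u : ℝ → ℂ) = shiftedAverage h c u := rfl

theorem WindowBound.norm_average_le : ‖hC.average hh hc‖ ≤ C :=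
  LinearMap.mkContinuous_norm_le _ hC.pos.le _

/-- Operators on `X` that commute with taking indefinite integrals. -/
def PreservesPrimitive (T : X.Elem →L[ℂ] X.Elem) : Prop :=
  ∀ u v : X.Elem, IsPrimitive u v → IsPrimitive (T u) (T v)

namespace PreservesPrimitive

variable {S T : X.Elem →L[ℂ] X.Elem}

theorem one : PreservesPrimitive (1 : X.Elem →L[ℂ] X.Elem) := fun _ _ h => h

theorem sub (hS : PreservesPrimitive S) (hT : PreservesPrimitive T) :
    PreservesPrimitive (S - T) := fun _ _ h => Elem.isPrimitive_sub (hS _ _ h) (hT _ _ h)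

theorem mul (hS : PreservesPrimitive S) (hT : PreservesPrimitive T) :
    PreservesPrimitive (S * T) := fun _ _ h => hS _ _ (hT _ _ h)

theorem pow (hT : PreservesPrimitive T) (n : ℕ) : PreservesPrimitive (T ^ n) := by
  induction n with
  | zero => exact one
  | succ n ih => rw [pow_succ]; exact ih.mul hT

end PreservesPrimitive

/-- The derivative of the average of `u` is the difference quotient of `u` across the interval of
averaging, and this is the average of `v`. It exists everywhere because `u` is continuous. -/
theorem WindowBound.preservesPrimitive_average : PreservesPrimitive (hC.average hh hc) := by
  intro u v huv
  have hcont := Elem.continuous_of_isPrimitive huv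
  refine IsPrimitive.of_hasDerivAt (fun x => ?_) (continuous_shiftedAverage h c v)
  have key := hasDerivAt_shiftedAverage h c u hcont x
  rw [huv] at key
  have e : hC.average hh hc v x =
      (h : ℂ)⁻¹ * ∫ t in (x + (c - h / 2))..(x + (c + h / 2)), v t := by
    simp only [hC.coe_average, shiftedAverage, steklov]
    congr 2 <;> ring
  rw [e]
  exact key

/-- Each factor `F` spends one derivative and gains `ε`; as `F` preserves primitives, the remaining
factors act on the rest of the chain. -/
theorem norm_pow_apply_le_of_chain {F : X.Elem →L[ℂ] X.Elem} (hF : PreservesPrimitive F) {ε : ℝ}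
    (hε : 0 ≤ ε) (H : ∀ u v : X.Elem, IsPrimitive u v → ‖F u‖ ≤ ε * ‖v‖) (s : ℕ) (u : ℕ → X.Elem)
    (hu : ∀ i < s, IsPrimitive (u i) (u (i + 1))) : ‖(F ^ s) (u 0)‖ ≤ ε ^ s * ‖u s‖ := by
  induction s generalizing u with
  | zero => simp
  | succ s ih =>
    have h1 := (hF.pow s) _ _ (hu 0 (by omega))
    have h2 := ih (fun i => u (i + 1)) fun i hi => hu (i + 1) (by omega)
    rw [pow_succ']
    calc ‖F ((F ^ s) (u 0))‖ ≤ ε * ‖(F ^ s) (u 1)‖ := H _ _ h1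
      _ ≤ ε * (ε ^ s * ‖u (s + 1)‖) := by gcongr
      _ = _ := by ring

theorem sub_shiftedAverage_eq {u : ℝ → ℂ} (hu : Continuous u) {h : ℝ} (hh : 0 < h) (c x : ℝ) :
    u x - shiftedAverage h c u x =
      (h : ℂ)⁻¹ * ∫ t in (x + c - h / 2)..(x + c + h / 2), (u x - u t) := by
  have h0 : (h : ℂ) ≠ 0 := by exact_mod_cast hh.ne'
  rw [intervalIntegral.integral_sub (by simp) (hu.intervalIntegrable _ _)]
  simp only [shiftedAverage, steklov, intervalIntegral.integral_const]
  rw [mul_sub]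
  congr 1
  rw [show x + c + h / 2 - (x + c - h / 2) = h by ring, Complex.real_smul, ← mul_assoc,
    inv_mul_cancel₀ h0, one_mul]

theorem WindowBound.norm_sub_average_le {u v : X.Elem} (huv : IsPrimitive u v) :
    ‖(1 - hC.average hh hc) u‖ ≤ C * h * ‖v‖ := by
  have hcont := Elem.continuous_of_isPrimitive huv
  have key : ∀ x, ‖((1 - hC.average hh hc) u) x‖ ≤ 1 * windowIntegral h v x := by
    intro x
    change ‖u x - shiftedAverage h c u x‖ ≤ _
    rw [sub_shiftedAverage_eq hcont hh, norm_mul, norm_inv, Complex.norm_real,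
      Real.norm_of_nonneg hh.le, one_mul, inv_mul_le_iff₀ hh]
    have := intervalIntegral.norm_integral_le_of_norm_le_const (a := x + c - h / 2)
      (b := x + c + h / 2) (f := fun t => u x - u t) (C := windowIntegral h v x) (fun t ht => by
        rw [uIoc_of_le (by linarith)] at ht
        obtain ⟨h0, h1⟩ := hc
        obtain ⟨h2, h3⟩ := ht
        exact Elem.norm_sub_le_windowIntegral huv ⟨by linarith, by linarith⟩
          ⟨by linarith, by linarith⟩)
    rw [show x + c + h / 2 - (x + c - h / 2) = h by ring, abs_of_pos hh] at this
    linarith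
  have := (hC.dominated zero_le_one hh v (Elem.periodic _) (Elem.aemeasurable _) key).2
  rwa [one_mul] at this

/-- The symmetric average is accurate of second order. -/
theorem WindowBound.norm_sub_average_le_sq (hc : (0 : ℝ) ∈ Icc 0 (h / 2)) {u v w : X.Elem}
    (huv : IsPrimitive u v) (hvw : IsPrimitive v w) :
    ‖(1 - hC.average hh hc) u‖ ≤ C * h ^ 2 * ‖w‖ := by
  have hu := Elem.continuous_of_isPrimitive huv
  have hv := Elem.continuous_of_isPrimitive hvw
  have key : ∀ x, ‖((1 - hC.average hh hc) u) x‖ ≤ h * windowIntegral h w x := by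
    intro x
    change ‖u x - shiftedAverage h 0 u x‖ ≤ _
    have hW := windowIntegral_nonneg hh.le w x
    -- The linear Taylor term cancels over the symmetric interval; this is the source of the second
    -- order.
    have e1 : ∫ t in (x + 0 - h / 2)..(x + 0 + h / 2), ((x - t : ℝ) : ℂ) * v x = 0 := by
      rw [intervalIntegral.integral_mul_const, intervalIntegral.integral_ofReal]
      have : ∫ t in (x + 0 - h / 2)..(x + 0 + h / 2), (x - t) = 0 := by
        rw [intervalIntegral.integral_sub (by simp) (by simp)]
        simp only [intervalIntegral.integral_const, integral_id, smul_eq_mul]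
        ring
      rw [this]; simp
    have hcontI : Continuous fun t : ℝ => ((x - t : ℝ) : ℂ) * v x := by fun_prop
    have e2 : u x - shiftedAverage h 0 u x = (h : ℂ)⁻¹ *
        ∫ t in (x + 0 - h / 2)..(x + 0 + h / 2), (u x - u t - ((x - t : ℝ) : ℂ) * v x) := by
      have hus : Continuous fun t => u x - u t := continuous_const.sub hu
      rw [intervalIntegral.integral_sub (hus.intervalIntegrable _ _)
        (hcontI.intervalIntegrable _ _), e1, sub_zero, sub_shiftedAverage_eq hu hh]
    rw [e2, norm_mul, norm_inv, Complex.norm_real, Real.norm_of_nonneg hh.le, inv_mul_le_iff₀ hh]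
    have := intervalIntegral.norm_integral_le_of_norm_le_const (a := x + 0 - h / 2)
      (b := x + 0 + h / 2) (f := fun t => u x - u t - ((x - t : ℝ) : ℂ) * v x)
      (C := h * windowIntegral h w x) (fun t ht => by
        rw [uIoc_of_le (by linarith)] at ht
        obtain ⟨h2, h3⟩ := ht
        have e3 : u x - u t - ((x - t : ℝ) : ℂ) * v x = ∫ y in t..x, (v y - v x) := by
          rw [intervalIntegral.integral_sub (v.intervalIntegrable _ _) (by simp), ← huv t x]
          simp [Complex.real_smul]
        rw [e3]
        refine (intervalIntegral.norm_integral_le_of_norm_le_const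
          (C := windowIntegral h w x) fun y hy => ?_).trans ?_
        · have hy' := uIoc_subset_uIcc hy
          rw [uIcc_eq_union] at hy'
          refine Elem.norm_sub_le_windowIntegral hvw ⟨by linarith, by linarith⟩ ?_
          rcases hy' with hy' | hy' <;> exact ⟨by linarith [hy'.1], by linarith [hy'.2]⟩
        · rw [mul_comm]
          gcongr
          rw [abs_le]; constructor <;> linarith)
    rw [show x + 0 + h / 2 - (x + 0 - h / 2) = h by ring, abs_of_pos hh] at this
    linarith
  have := (hC.dominated hh.le hh w (Elem.periodic _) (Elem.aemeasurable _) key).2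
  rwa [← pow_two] at this

theorem norm_one_sub_pow_le {T : X.Elem →L[ℂ] X.Elem} (hT : ‖T‖ ≤ C) (n : ℕ) :
    ‖(1 - T) ^ n‖ ≤ (1 + C) ^ n := by
  have h1 : ‖(1 : X.Elem →L[ℂ] X.Elem)‖ ≤ 1 := ContinuousLinearMap.norm_id_le
  have h2 : ‖1 - T‖ ≤ 1 + C := (norm_sub_le _ _).trans (add_le_add h1 hT)
  induction n with
  | zero => simpa using h1
  | succ n ih =>
    rw [pow_succ, pow_succ]
    exact (norm_mul_le _ _).trans (mul_le_mul ih h2 (norm_nonneg _) ((norm_nonneg _).trans ih))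

/-- For `s ≤ 2 r`, the norm of `(I - A_h)^r u` is `O(h ^ s)` times the norm of the `s`-th
derivative. -/
theorem WindowBound.norm_pow_sub_average_le (hc : (0 : ℝ) ∈ Icc 0 (h / 2)) (r s : ℕ)
    (hrs : s ≤ 2 * r) (u : ℕ → X.Elem) (hu : ∀ i < s, IsPrimitive (u i) (u (i + 1))) :
    ‖((1 - hC.average hh hc) ^ r) (u 0)‖ ≤ (1 + C) ^ r * (1 + C) ^ s * h ^ s * ‖u s‖ := by
  have hC0 := hC.pos
  have hA := hC.norm_average_le hh hc
  have hP : PreservesPrimitive (1 - hC.average hh hc) :=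
    PreservesPrimitive.one.sub (hC.preservesPrimitive_average hh hc)
  induction r generalizing s u with
  | zero =>
    obtain rfl : s = 0 := by omega
    simp
  | succ r ih =>
    have hb : ∀ k (v : X.Elem), ‖((1 - hC.average hh hc) ^ k) v‖ ≤ (1 + C) ^ k * ‖v‖ := fun k v =>
      (ContinuousLinearMap.le_opNorm _ _).trans
        (mul_le_mul_of_nonneg_right (norm_one_sub_pow_le hA k) (norm_nonneg _))
    rcases s with _ | _ | s
    · simpa using hb (r + 1) (u 0)
    · rw [pow_succ (1 - hC.average hh hc)]
      calc ‖((1 - hC.average hh hc) ^ r) ((1 - hC.average hh hc) (u 0))‖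
          ≤ (1 + C) ^ r * (C * h * ‖u 1‖) := (hb _ _).trans (by
            gcongr; exact hC.norm_sub_average_le hh hc (hu 0 (by omega)))
        _ ≤ (1 + C) ^ r * ((1 + C) * (1 + C) * h * ‖u 1‖) := by
            gcongr; nlinarith
        _ = _ := by ring
    · rw [pow_succ (1 - hC.average hh hc)]
      -- One factor is set aside to spend the last two derivatives, from `u s` to `u (s + 2)`; the
      -- other `r` factors handle the first `s`. This is why `s ≤ 2 * r` suffices.
      have h1 := ih s (by omega) (fun i => (1 - hC.average hh hc) (u i))
        fun i hi => hP _ _ (hu i (by omega))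
      have h2 := hC.norm_sub_average_le_sq hh hc (hu s (by omega)) (hu (s + 1) (by omega))
      calc ‖((1 - hC.average hh hc) ^ r) ((1 - hC.average hh hc) (u 0))‖
          ≤ (1 + C) ^ r * (1 + C) ^ s * h ^ s * ‖(1 - hC.average hh hc) (u s)‖ := h1
        _ ≤ (1 + C) ^ r * (1 + C) ^ s * h ^ s * (C * h ^ 2 * ‖u (s + 2)‖) := by
            gcongr
        _ ≤ (1 + C) ^ r * (1 + C) ^ s * h ^ s * ((1 + C) ^ 3 * h ^ 2 * ‖u (s + 2)‖) := by
            gcongr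
            calc C ≤ 1 + C := by linarith
              _ ≤ (1 + C) ^ 3 := le_self_pow₀ (by linarith) (by norm_num)
        _ = _ := by ring

theorem WindowBound.norm_pow_sub_average_le_chain (s : ℕ) (u : ℕ → X.Elem)
    (hu : ∀ i < s, IsPrimitive (u i) (u (i + 1))) :
    ‖((1 - hC.average hh hc) ^ s) (u 0)‖ ≤ (C * h) ^ s * ‖u s‖ :=
  norm_pow_apply_le_of_chain (PreservesPrimitive.one.sub (hC.preservesPrimitive_average hh hc))
    (mul_pos hC.pos hh).le (fun _ _ huv => hC.norm_sub_average_le hh hc huv) s u hu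

theorem oneSubPow_eq (T : X.Elem →L[ℂ] X.Elem) (L : (ℝ → ℂ) → (ℝ → ℂ))
    (hL : ∀ u : X.Elem, (T u : ℝ → ℂ) = L u) (r : ℕ) (u : X.Elem) :
    oneSubPow L r u = ((1 - T) ^ r) u := by
  induction r generalizing u with
  | zero => rfl
  | succ r ih =>
    rw [pow_succ]
    change oneSubPow L r (⇑u - L u) = ((1 - T) ^ r) ((1 - T) u)
    rw [← ih, ← hL]
    rfl

/-- Two Steklov averages gain one derivative. -/
theorem WindowBound.exists_isPrimitive_average_sq (u : X.Elem) :
    ∃ v : X.Elem, IsPrimitive (hC.average hh hc (hC.average hh hc u)) v ∧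
      ‖v‖ ≤ 4 * C / h * ‖u‖ := by
  set w := hC.average hh hc u with hw
  have hcont : Continuous w := continuous_shiftedAverage h c u
  obtain ⟨h0, h1⟩ := hc
  -- The derivative of the second average is a difference of translates of `w`. These are dominated
  -- by a window integral since `w` is itself an average; after a single average they would be
  -- translates of `u`, which need not be bounded in `X`.
  have hW : ∀ x y, |y| ≤ h → ‖w (x + y)‖ ≤ h⁻¹ * windowIntegral (2 * h) u x := by
    intro x y hy
    refine (norm_shiftedAverage_le hh ⟨h0, h1⟩ u _).trans ?_
    gcongr
    exact u.windowIntegral_mono hh.le (by rw [add_sub_cancel_left]; linarith)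
  let g : ℝ → ℂ := fun x => (h : ℂ)⁻¹ * (w (x + (c + h / 2)) - w (x + (c - h / 2)))
  have hg : ∀ x, ‖g x‖ ≤ (2 * h⁻¹ * h⁻¹) * windowIntegral (2 * h) u x := by
    intro x
    simp only [g]
    rw [norm_mul, norm_inv, Complex.norm_real, Real.norm_of_nonneg hh.le]
    have a := hW x (c + h / 2) (by rw [abs_le]; constructor <;> linarith)
    have b := hW x (c - h / 2) (by rw [abs_le]; constructor <;> linarith)
    calc h⁻¹ * ‖w (x + (c + h / 2)) - w (x + (c - h / 2))‖
        ≤ h⁻¹ * (h⁻¹ * windowIntegral (2 * h) u x + h⁻¹ * windowIntegral (2 * h) u x) := by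
          gcongr; exact (norm_sub_le _ _).trans (add_le_add a b)
      _ = _ := by ring
  have hgc : Continuous g := by
    have a := hcont.comp (continuous_add_const (c + h / 2))
    have b := hcont.comp (continuous_add_const (c - h / 2))
    exact continuous_const.mul (a.sub b)
  have hgp : Function.Periodic g (2 * Real.pi) := by
    intro x
    simp only [g]
    rw [add_right_comm, w.periodic, add_right_comm x, w.periodic]
  have hd := hC.dominated (by positivity) (by positivity) u hgp hgc.measurable.aemeasurable hg
  refine ⟨toElem g hd.1, ?_, ?_⟩
  · exact IsPrimitive.of_hasDerivAt (fun x => hasDerivAt_shiftedAverage h c w hcont x) hgc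
  · rw [norm_toElem]
    refine hd.2.trans (le_of_eq ?_)
    field_simp
    ring

end BanachFunctionLattice

/-! ### Algebra and calculus of trigonometric polynomials. -/

namespace IsTrigPoly

variable {n : ℕ} {S T : ℝ → ℂ}

theorem zero (n : ℕ) : IsTrigPoly n (0 : ℝ → ℂ) := ⟨0, fun x => by simp⟩

theorem add (hS : IsTrigPoly n S) (hT : IsTrigPoly n T) : IsTrigPoly n (S + T) := by
  obtain ⟨c, hc⟩ := hS
  obtain ⟨d, hd⟩ := hT
  exact ⟨c + d, fun x => by simp [hc, hd, add_mul, Finset.sum_add_distrib]⟩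

theorem const_mul (a : ℂ) (hT : IsTrigPoly n T) : IsTrigPoly n fun x => a * T x := by
  obtain ⟨d, hd⟩ := hT
  exact ⟨fun k => a * d k, fun x => by simp [hd, Finset.mul_sum, mul_assoc]⟩

theorem sub (hS : IsTrigPoly n S) (hT : IsTrigPoly n T) : IsTrigPoly n (S - T) := by
  convert hS.add (hT.const_mul (-1)) using 1
  ext x
  simp [sub_eq_add_neg]

theorem exp {k : ℤ} (hk : k ∈ Finset.Icc (-(n : ℤ)) n) :
    IsTrigPoly n fun x => Complex.exp (Complex.I * k * x) := by
  refine ⟨Pi.single k 1, fun x => ?_⟩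
  rw [Finset.sum_eq_single k]
  · simp
  · intro j _ hj; simp [hj]
  · intro h; exact absurd hk h

theorem sum {ι : Type*} {I : Finset ι} {F : ι → ℝ → ℂ} (h : ∀ i ∈ I, IsTrigPoly n (F i)) :
    IsTrigPoly n fun x => ∑ i ∈ I, F i x := by
  classical
  induction I using Finset.induction_on with
  | empty => exact zero n
  | insert i I hi ih =>
    simp only [Finset.sum_insert hi]
    exact (h i (by simp)).add (ih fun j hj => h j (by simp [hj]))

theorem mono {m : ℕ} (hT : IsTrigPoly n T) (h : n ≤ m) : IsTrigPoly m T := by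
  obtain ⟨c, hc⟩ := hT
  rw [funext hc]
  refine sum fun k hk => const_mul _ (exp ?_)
  rw [Finset.mem_Icc] at hk ⊢
  omega

theorem mul {m : ℕ} (hS : IsTrigPoly m S) (hT : IsTrigPoly n T) :
    IsTrigPoly (m + n) fun x => S x * T x := by
  obtain ⟨c, hc⟩ := hS
  obtain ⟨d, hd⟩ := hT
  have e : (fun x => S x * T x) = fun x : ℝ => ∑ k ∈ Finset.Icc (-(m : ℤ)) m,
      ∑ l ∈ Finset.Icc (-(n : ℤ)) n,
        (c k * d l) * Complex.exp (Complex.I * ((k + l : ℤ) : ℂ) * x) := by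
    ext x
    rw [hc, hd, Finset.sum_mul_sum]
    refine Finset.sum_congr rfl fun k _ => Finset.sum_congr rfl fun l _ => ?_
    push_cast
    rw [mul_add, add_mul, Complex.exp_add]
    ring
  rw [e]
  refine sum fun k hk => sum fun l hl => const_mul _ (exp ?_)
  rw [Finset.mem_Icc] at hk hl ⊢
  push_cast
  omega

theorem hasDerivAt_exp (a : ℂ) (x : ℝ) : HasDerivAt (fun x : ℝ => Complex.exp (a * x))
    (a * Complex.exp (a * x)) x := by
  have h1 : HasDerivAt (fun x : ℝ => a * (x : ℂ)) a x := by
    simpa using (Complex.ofRealCLM.hasDerivAt (x := x)).const_mul a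
  convert h1.cexp using 1
  ring

theorem contDiff (hT : IsTrigPoly n T) : ContDiff ℝ ⊤ T := by
  obtain ⟨c, hc⟩ := hT
  rw [funext hc]
  refine ContDiff.sum fun k _ => contDiff_const.mul ?_
  exact (contDiff_const.mul Complex.ofRealCLM.contDiff).cexp

theorem continuous (hT : IsTrigPoly n T) : Continuous T := hT.contDiff.continuous

theorem periodic (hT : IsTrigPoly n T) : Function.Periodic T (2 * Real.pi) := by
  obtain ⟨c, hc⟩ := hT
  intro x
  rw [hc, hc]
  refine Finset.sum_congr rfl fun k _ => ?_
  congr 1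
  rw [Complex.exp_eq_exp_iff_exists_int]
  exact ⟨k, by push_cast; ring⟩

theorem deriv (hT : IsTrigPoly n T) : IsTrigPoly n (deriv T) := by
  obtain ⟨c, hc⟩ := hT
  refine ⟨fun k => c k * (Complex.I * k), fun x => ?_⟩
  have h : HasDerivAt (fun x : ℝ => ∑ k ∈ Finset.Icc (-(n : ℤ)) n,
      c k * Complex.exp (Complex.I * k * x)) (∑ k ∈ Finset.Icc (-(n : ℤ)) n,
      c k * (Complex.I * k * Complex.exp (Complex.I * k * x))) x :=
    HasDerivAt.fun_sum fun k _ => (hasDerivAt_exp _ x).const_mul _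
  rw [funext hc, h.deriv]
  exact Finset.sum_congr rfl fun k _ => by ring

theorem iteratedDeriv (hT : IsTrigPoly n T) (j : ℕ) : IsTrigPoly n (iteratedDeriv j T) := by
  induction j with
  | zero => simpa using hT
  | succ j ih => rw [iteratedDeriv_succ]; exact ih.deriv

theorem isPrimitive_deriv (hT : IsTrigPoly n T) : IsPrimitive T (_root_.deriv T) :=
  IsPrimitive.of_hasDerivAt
    (fun x => ((hT.contDiff.differentiable (by simp)) x).hasDerivAt) hT.deriv.continuous

/-- The exponentials are eigenfunctions of the averages. -/
theorem shiftedAverage (hT : IsTrigPoly n T) (h c : ℝ) :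
    IsTrigPoly n (shiftedAverage h c T) := by
  obtain ⟨a, ha⟩ := hT
  refine ⟨fun k => a k * ((h : ℂ)⁻¹ * ∫ t in (c - h / 2)..(c + h / 2),
    Complex.exp (Complex.I * k * t)), fun x => ?_⟩
  simp only [_root_.shiftedAverage, steklov, ha]
  rw [intervalIntegral.integral_finsetSum, Finset.mul_sum]
  · refine Finset.sum_congr rfl fun k _ => ?_
    rw [intervalIntegral.integral_const_mul]
    have : ∫ t in (x + c - h / 2)..(x + c + h / 2), Complex.exp (Complex.I * k * t) =
        Complex.exp (Complex.I * k * x) *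
          ∫ t in (c - h / 2)..(c + h / 2), Complex.exp (Complex.I * k * t) := by
      rw [show x + c - h / 2 = x + (c - h / 2) by ring,
        show x + c + h / 2 = x + (c + h / 2) by ring,
        ← intervalIntegral.integral_comp_add_left
          (fun t : ℝ => Complex.exp (Complex.I * k * t)) x, ← intervalIntegral.integral_const_mul]
      congr 1
      ext t
      rw [← Complex.exp_add]
      push_cast
      ring_nf
    rw [this]
    ring
  · intro k _
    apply Continuous.intervalIntegrable
    fun_prop

end IsTrigPoly

/-! ### The Jackson kernel and dyadic domination of kernels. -/

/-- Convolution over a period. -/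
noncomputable def circleConv (K f : ℝ → ℂ) (x : ℝ) : ℂ :=
  ∫ t in (-Real.pi)..Real.pi, K t * f (x - t)

/-- The exponential sum `∑_{k < m} e^{ikt}`. -/
noncomputable def expSum (m : ℕ) (t : ℝ) : ℂ :=
  ∑ k ∈ Finset.range m, Complex.exp (Complex.I * t) ^ k

theorem continuous_expSum (m : ℕ) : Continuous (expSum m) := by
  unfold expSum; fun_prop

theorem norm_expSum_le (m : ℕ) (t : ℝ) : ‖expSum m t‖ ≤ m := by
  refine (norm_sum_le _ _).trans ?_
  simp [norm_pow, mul_comm Complex.I, Complex.norm_exp_ofReal_mul_I]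

/-- The geometric sum times `e^{it} - 1` has modulus at most `2`, while `|e^{it} - 1| = 2 |sin(t/2)|
≥ (2/π)|t|`. -/
theorem norm_expSum_mul_le (m : ℕ) {t : ℝ} (ht : |t| ≤ Real.pi) :
    ‖expSum m t‖ * |t| ≤ Real.pi := by
  have h1 : ‖expSum m t‖ * ‖Complex.exp (Complex.I * t) - 1‖ ≤ 2 := by
    rw [expSum, ← norm_mul, geom_sum_mul]
    refine (norm_sub_le _ _).trans ?_
    rw [norm_pow, mul_comm, Complex.norm_exp_ofReal_mul_I]
    norm_num
  have h2 : 2 / Real.pi * |t| ≤ ‖Complex.exp (Complex.I * t) - 1‖ := by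
    rw [Complex.norm_exp_I_mul_ofReal_sub_one, norm_mul, Real.norm_eq_abs, Real.norm_eq_abs]
    have := Real.mul_abs_le_abs_sin (x := t / 2) (by
      rw [abs_div, abs_two]; linarith)
    rw [abs_div, abs_two] at this
    rw [abs_two]
    linarith
  have h3 := (mul_le_mul_of_nonneg_left h2 (norm_nonneg (expSum m t))).trans h1
  have hp := Real.pi_pos
  have e : ‖expSum m t‖ * (2 / Real.pi * |t|) = 2 / Real.pi * (‖expSum m t‖ * |t|) := by ring
  rw [e, div_mul_eq_mul_div, div_le_iff₀ hp] at h3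
  linarith

/-- Every summand has real part `cos(kt) ≥ 1/2`, because `|kt| ≤ 1`. -/
theorem half_le_norm_expSum (m : ℕ) {t : ℝ} (ht : m * |t| ≤ 1) : (m : ℝ) / 2 ≤ ‖expSum m t‖ := by
  refine le_trans ?_ (Complex.re_le_norm _)
  rw [expSum, Complex.re_sum]
  calc (m : ℝ) / 2 = ∑ k ∈ Finset.range m, (1 / 2 : ℝ) := by
        rw [Finset.sum_const, Finset.card_range, nsmul_eq_mul]; ring
    _ ≤ _ := Finset.sum_le_sum fun k hk => by
      rw [← Complex.exp_nat_mul, show (k : ℂ) * (Complex.I * t) = ((k * t : ℝ) : ℂ) * Complex.I by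
        push_cast; ring, Complex.exp_ofReal_mul_I_re]
      have h1 : |(k : ℝ) * t| ≤ 1 := by
        rw [abs_mul, Nat.abs_cast]
        refine le_trans ?_ ht
        gcongr
        exact (Finset.mem_range.1 hk).le
      have h2 := Real.one_sub_sq_div_two_le_cos (x := (k : ℝ) * t)
      have h3 : ((k : ℝ) * t) ^ 2 ≤ 1 := by rw [← sq_abs]; exact pow_le_one₀ (abs_nonneg _) h1
      linarith

theorem isTrigPoly_expSum (m : ℕ) : IsTrigPoly (m - 1) (expSum m) := by
  have e : expSum m = fun x : ℝ => ∑ k ∈ Finset.range m,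
      Complex.exp (Complex.I * ((k : ℤ) : ℂ) * x) := by
    ext x
    refine Finset.sum_congr rfl fun k _ => ?_
    rw [← Complex.exp_nat_mul]
    push_cast
    ring_nf
  rw [e]
  refine IsTrigPoly.sum fun k hk => IsTrigPoly.exp ?_
  rw [Finset.mem_range] at hk
  rw [Finset.mem_Icc]
  omega

theorem conj_expSum (m : ℕ) (x : ℝ) : (starRingEnd ℂ) (expSum m x) =
    ∑ k ∈ Finset.range m, Complex.exp (Complex.I * ((-k : ℤ) : ℂ) * x) := by
  rw [expSum, map_sum]
  refine Finset.sum_congr rfl fun k _ => ?_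
  rw [map_pow, ← Complex.exp_conj, ← Complex.exp_nat_mul]
  simp
  ring_nf

theorem isTrigPoly_conj_expSum (m : ℕ) :
    IsTrigPoly (m - 1) fun x => (starRingEnd ℂ) (expSum m x) := by
  rw [funext (conj_expSum m)]
  refine IsTrigPoly.sum fun k hk => IsTrigPoly.exp ?_
  rw [Finset.mem_range] at hk
  rw [Finset.mem_Icc]
  omega

/-- The normalizing constant of the Jackson kernel. -/
noncomputable def jacksonMass (m : ℕ) : ℝ := ∫ t in (-Real.pi)..Real.pi, ‖expSum m t‖ ^ 4

/-- The Jackson kernel. -/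
noncomputable def jacksonKernel (m : ℕ) (t : ℝ) : ℝ := ‖expSum m t‖ ^ 4 / jacksonMass m

theorem continuous_norm_expSum_pow (m k : ℕ) : Continuous fun t => ‖expSum m t‖ ^ k :=
  (continuous_expSum m).norm.pow k

/-- On `|t| ≤ 1/m`, an interval of length `2/m`, the integrand is at least `(m/2)^4`. -/
theorem jacksonMass_ge {m : ℕ} (hm : 1 ≤ m) : (m : ℝ) ^ 3 / 8 ≤ jacksonMass m := by
  have hm0 : (1 : ℝ) ≤ m := by exact_mod_cast hm
  have hinv : (m : ℝ)⁻¹ ≤ 1 := inv_le_one_of_one_le₀ hm0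
  have hpi := Real.pi_gt_three
  have hpos : 0 < (m : ℝ)⁻¹ := by positivity
  have h1 : ∫ t in (-(m : ℝ)⁻¹)..(m : ℝ)⁻¹, ‖expSum m t‖ ^ 4 ≤ jacksonMass m :=
    intervalIntegral.integral_mono_interval (by linarith) (by linarith) (by linarith)
      (Eventually.of_forall fun t => by positivity)
      ((continuous_norm_expSum_pow m 4).intervalIntegrable _ _)
  refine le_trans ?_ h1
  have h2 : ∫ t in (-(m : ℝ)⁻¹)..(m : ℝ)⁻¹, ((m : ℝ) / 2) ^ 4 ≤
      ∫ t in (-(m : ℝ)⁻¹)..(m : ℝ)⁻¹, ‖expSum m t‖ ^ 4 := by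
    refine intervalIntegral.integral_mono_on (by linarith) (by simp)
      ((continuous_norm_expSum_pow m 4).intervalIntegrable _ _) fun t ht => ?_
    gcongr
    refine half_le_norm_expSum m ?_
    calc (m : ℝ) * |t| ≤ m * (m : ℝ)⁻¹ := by gcongr; exact abs_le.2 ht
      _ = 1 := by field_simp
  refine le_trans (le_of_eq ?_) h2
  rw [intervalIntegral.integral_const, smul_eq_mul]
  field_simp
  norm_num

theorem jacksonMass_pos {m : ℕ} (hm : 1 ≤ m) : 0 < jacksonMass m :=
  lt_of_lt_of_le (by positivity) (jacksonMass_ge hm)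

theorem continuous_jacksonKernel (m : ℕ) : Continuous (jacksonKernel m) :=
  (continuous_norm_expSum_pow m 4).div_const _

theorem jacksonKernel_nonneg {m : ℕ} (hm : 1 ≤ m) (t : ℝ) : 0 ≤ jacksonKernel m t :=
  div_nonneg (by positivity) (jacksonMass_pos hm).le

theorem integral_jacksonKernel {m : ℕ} (hm : 1 ≤ m) :
    ∫ t in (-Real.pi)..Real.pi, jacksonKernel m t = 1 := by
  simp only [jacksonKernel, intervalIntegral.integral_div]
  exact div_self (jacksonMass_pos hm).ne'

theorem isTrigPoly_jacksonKernel (m : ℕ) :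
    IsTrigPoly (4 * (m - 1)) fun t => (jacksonKernel m t : ℂ) := by
  have h1 := (isTrigPoly_expSum m).mul (isTrigPoly_conj_expSum m)
  have h2 := ((h1.mul h1).const_mul ((jacksonMass m : ℂ)⁻¹))
  convert h2 using 1
  · ring
  · ext t
    rw [jacksonKernel, Complex.mul_conj, Complex.normSq_eq_norm_sq]
    push_cast
    ring

/-- Of the four factors `‖expSum m t‖`, `q` absorb the powers of `|t|` and the others are at most
`m`; the mass removes `m ^ 3 / 8`. So the kernel has size `8π⁴m` at scale `1/m`. The case `q = 2`
serves for boundedness, `q = 3` for the rate. -/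
theorem jacksonKernel_mul_pow_le {m : ℕ} (hm : 1 ≤ m) {q : ℕ} (hq : q ≤ 4) {t : ℝ}
    (ht : |t| ≤ Real.pi) :
    jacksonKernel m t * |t| ^ q ≤ 8 * Real.pi ^ 4 * m * ((m : ℝ)⁻¹) ^ q := by
  have hm0 : (0 : ℝ) < m := by exact_mod_cast hm
  have h1 : ‖expSum m t‖ ^ 4 * |t| ^ q ≤ Real.pi ^ 4 * m ^ (4 - q) := by
    have e : ‖expSum m t‖ ^ 4 * |t| ^ q =
        (‖expSum m t‖ * |t|) ^ q * ‖expSum m t‖ ^ (4 - q) := by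
      rw [mul_pow, mul_right_comm, ← pow_add, Nat.add_sub_cancel' hq]
    rw [e]
    gcongr
    · calc (‖expSum m t‖ * |t|) ^ q ≤ Real.pi ^ q := by
            gcongr; exact norm_expSum_mul_le m ht
        _ ≤ Real.pi ^ 4 := pow_le_pow_right₀ (by linarith [Real.pi_gt_three]) hq
    · exact norm_expSum_le m t
  rw [jacksonKernel, div_mul_eq_mul_div, div_le_iff₀ (jacksonMass_pos hm)]
  refine h1.trans ?_
  have h2 := jacksonMass_ge hm
  have e2 : (m : ℝ) ^ (4 - q) = m * ((m : ℝ)⁻¹) ^ q * m ^ 3 := by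
    have : (m : ℝ) ^ 4 = m ^ (4 - q) * m ^ q := by rw [← pow_add, Nat.sub_add_cancel hq]
    rw [inv_pow]
    field_simp
    linarith
  calc Real.pi ^ 4 * (m : ℝ) ^ (4 - q)
      = 8 * Real.pi ^ 4 * m * ((m : ℝ)⁻¹) ^ q * (m ^ 3 / 8) := by rw [e2]; ring
    _ ≤ _ := by gcongr

/-- A kernel that decays like `|t| ^ (-p)` beyond `δ` is dominated by dyadic windows. -/
theorem integral_mul_le_sum_dyadic {K F : ℝ → ℝ} {B δ : ℝ} {p J : ℕ} (hB : 0 ≤ B) (hδ : 0 < δ)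
    (hK : Continuous K) (h0 : ∀ t, |t| ≤ Real.pi → K t ≤ B)
    (hp : ∀ t, |t| ≤ Real.pi → K t * |t| ^ p ≤ B * δ ^ p) (hJ : Real.pi ≤ 2 ^ J * δ)
    (hF : ∀ t, 0 ≤ F t) (hFi : ∀ a b, IntervalIntegrable F volume a b) :
    ∫ t in (-Real.pi)..Real.pi, K t * F t ≤
      ∑ j ∈ Finset.range (J + 1), B * 2 ^ p / (2 ^ j) ^ p *
        ∫ t in (-(2 ^ j * δ))..(2 ^ j * δ), F t := by
  have hpi := Real.pi_pos
  set I : ℕ → Set ℝ := fun j => Ioc (-(2 ^ j * δ)) (2 ^ j * δ)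
  have hFI : ∀ j, IntegrableOn F (I j) := fun j =>
    (intervalIntegrable_iff_integrableOn_Ioc_of_le
      (by have : 0 < 2 ^ j * δ := by positivity
          linarith)).1 (hFi _ _)
  have hFπ : IntegrableOn F (Ioc (-Real.pi) Real.pi) :=
    (intervalIntegrable_iff_integrableOn_Ioc_of_le (by linarith)).1 (hFi _ _)
  have hpt : ∀ t ∈ Ioo (-Real.pi) Real.pi, K t * F t ≤
      ∑ j ∈ Finset.range (J + 1), B * 2 ^ p / (2 ^ j) ^ p *
        (Icc (-(2 ^ j * δ)) (2 ^ j * δ)).indicator F t := by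
    intro t ht
    have htπ : |t| ≤ Real.pi := abs_le.2 ⟨ht.1.le, ht.2.le⟩
    have hex : ∃ j : ℕ, |t| ≤ 2 ^ j * δ := ⟨J, htπ.trans hJ⟩
    classical
    -- The least `j` with `|t| ≤ 2 ^ j * δ`. If `j > 0`, minimality gives `|t| > 2 ^ (j - 1) * δ`,
    -- and the decay of `K` yields the weight; if `j = 0`, the bound on the size of `K` does.
    set j := Nat.find hex with hj
    have hjt : |t| ≤ 2 ^ j * δ := Nat.find_spec hex
    have hjJ : j ∈ Finset.range (J + 1) :=
      Finset.mem_range.2 (Nat.lt_succ_of_le (Nat.find_min' hex (htπ.trans hJ)))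
    have hKj : K t ≤ B * 2 ^ p / (2 ^ j) ^ p := by
      rcases Nat.eq_zero_or_pos j with h | h
      · rw [h, pow_zero, one_pow, div_one]
        exact (h0 t htπ).trans (le_mul_of_one_le_right hB (one_le_pow₀ one_le_two))
      · have hlt : 2 ^ (j - 1) * δ < |t| := not_le.1 (Nat.find_min hex (by omega))
        have hd : 0 < 2 ^ (j - 1) * δ := by positivity
        have ht0 : 0 < |t| := hd.trans hlt
        have e : (2 : ℝ) ^ j = 2 * 2 ^ (j - 1) := by rw [← pow_succ']; congr 1; omega
        calc K t ≤ B * δ ^ p / |t| ^ p := by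
              rw [le_div_iff₀ (by positivity)]; exact hp t htπ
          _ ≤ B * δ ^ p / (2 ^ (j - 1) * δ) ^ p := by gcongr
          _ = B * 2 ^ p / (2 ^ j) ^ p := by rw [e, mul_pow, mul_pow]; field_simp
    calc K t * F t ≤ B * 2 ^ p / (2 ^ j) ^ p * F t := mul_le_mul_of_nonneg_right hKj (hF t)
      _ = B * 2 ^ p / (2 ^ j) ^ p *
        (Icc (-(2 ^ j * δ)) (2 ^ j * δ)).indicator F t := by
        rw [indicator_of_mem (show t ∈ Icc (-(2 ^ j * δ)) (2 ^ j * δ) from abs_le.1 hjt)]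
      _ ≤ _ := Finset.single_le_sum (f := fun j => B * 2 ^ p / (2 ^ j) ^ p *
          (Icc (-(2 ^ j * δ)) (2 ^ j * δ)).indicator F t)
          (fun i _ => mul_nonneg (by positivity) (indicator_nonneg (fun x _ => hF x) t)) hjJ
  have hind : ∀ j, IntegrableOn ((Icc (-(2 ^ j * δ)) (2 ^ j * δ)).indicator F)
      (Ioc (-Real.pi) Real.pi) := fun j => hFπ.indicator measurableSet_Icc
  rw [intervalIntegral.integral_of_le (by linarith)]
  calc ∫ t in Ioc (-Real.pi) Real.pi, K t * F t
      ≤ ∫ t in Ioc (-Real.pi) Real.pi, ∑ j ∈ Finset.range (J + 1), B * 2 ^ p / (2 ^ j) ^ p *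
          (Icc (-(2 ^ j * δ)) (2 ^ j * δ)).indicator F t := by
        rw [integral_Ioc_eq_integral_Ioo, integral_Ioc_eq_integral_Ioo]
        refine setIntegral_mono_on ?_ ?_ measurableSet_Ioo hpt
        · have := (hFi (-Real.pi) Real.pi).continuousOn_mul hK.continuousOn
          exact ((intervalIntegrable_iff_integrableOn_Ioc_of_le (by linarith)).1 this).mono_set
            Ioo_subset_Ioc_self
        · exact (integrable_finsetSum _ fun j _ => (hind j).const_mul _).mono_measure
            (Measure.restrict_mono Ioo_subset_Ioc_self le_rfl)
    _ = ∑ j ∈ Finset.range (J + 1), B * 2 ^ p / (2 ^ j) ^ p *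
          ∫ t in Ioc (-Real.pi) Real.pi, (Icc (-(2 ^ j * δ)) (2 ^ j * δ)).indicator F t := by
        rw [integral_finsetSum _ fun j _ => (hind j).const_mul _]
        simp only [integral_const_mul]
    _ ≤ _ := by
        refine Finset.sum_le_sum fun j _ => ?_
        gcongr
        have hj : 0 < 2 ^ j * δ := by positivity
        rw [intervalIntegral.integral_of_le (by linarith),
          ← integral_Icc_eq_integral_Ioc (x := -(2 ^ j * δ)),
          setIntegral_indicator measurableSet_Icc]
        refine setIntegral_mono_set ?_ (Eventually.of_forall fun t => hF t)
          (Eventually.of_forall inter_subset_right)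
        rw [integrableOn_Icc_iff_integrableOn_Ioc]
        exact hFI j

/-! ### Convolution operators on `X`. -/

namespace BanachFunctionLattice

variable {X : BanachFunctionLattice}

theorem intervalIntegrable_comp_sub (u : X.Elem) (x a b : ℝ) :
    IntervalIntegrable (fun t => u (x - t)) volume a b := by
  have := (u.intervalIntegrable (x - a) (x - b)).comp_sub_left x
  simpa using this

theorem circleConv_eq {K : ℝ → ℂ} (hK : Function.Periodic K (2 * Real.pi)) (u : X.Elem) (x : ℝ) :
    circleConv K u x = ∫ t in (-Real.pi)..Real.pi, K (x - t) * u t := by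
  have hp : Function.Periodic (fun t => K (x - t) * u t) (2 * Real.pi) := by
    intro t
    simp only [u.periodic t]
    rw [show x - (t + 2 * Real.pi) = x - t - 2 * Real.pi by ring, hK.sub_eq]
  have h1 := intervalIntegral.integral_comp_sub_left (fun t => K (x - t) * u t) x
    (a := -Real.pi) (b := Real.pi)
  have h2 := hp.intervalIntegral_add_eq (x - Real.pi) (-Real.pi)
  rw [show x - Real.pi + 2 * Real.pi = x - -Real.pi by ring,
    show -Real.pi + 2 * Real.pi = Real.pi by ring] at h2
  rw [← h2, ← h1]
  simp [circleConv]

theorem isTrigPoly_circleConv {n : ℕ} {K : ℝ → ℂ} (hK : IsTrigPoly n K) (u : X.Elem) :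
    IsTrigPoly n (circleConv K u) := by
  have hper := hK.periodic
  obtain ⟨c, hc⟩ := hK
  refine ⟨fun k => c k * ∫ t in (-Real.pi)..Real.pi, Complex.exp (-(Complex.I * k * t)) * u t,
    fun x => ?_⟩
  rw [circleConv_eq hper]
  have hint : ∀ k : ℤ, IntervalIntegrable
      (fun t : ℝ => Complex.exp (-(Complex.I * k * t)) * u t) volume (-Real.pi) Real.pi := fun k =>
    (u.intervalIntegrable _ _).continuousOn_mul (by fun_prop)
  have e : ∀ t : ℝ, K (x - t) * u t = ∑ k ∈ Finset.Icc (-(n : ℤ)) n,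
      (c k * Complex.exp (Complex.I * k * x)) *
        (Complex.exp (-(Complex.I * k * t)) * u t) := by
    intro t
    rw [hc, Finset.sum_mul]
    refine Finset.sum_congr rfl fun k _ => ?_
    push_cast
    rw [mul_sub, sub_eq_add_neg, Complex.exp_add]
    ring
  simp only [e]
  rw [intervalIntegral.integral_finsetSum fun k _ => (hint k).const_mul _]
  refine Finset.sum_congr rfl fun k _ => ?_
  rw [intervalIntegral.integral_const_mul]
  ring

/-- Fubini: the increment of `u` under the convolution is written as an integral of `v`, and the two
integrals are exchanged. -/
theorem isPrimitive_circleConv {K : ℝ → ℂ} (hK : Continuous K) {u v : X.Elem}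
    (huv : IsPrimitive u v) : IsPrimitive (circleConv K u) (circleConv K v) := by
  intro a b
  have hu := Elem.continuous_of_isPrimitive huv
  have hi : ∀ x, IntervalIntegrable (fun t => K t * u (x - t)) volume (-Real.pi) Real.pi :=
    fun x => (hK.mul (hu.comp (continuous_const.sub continuous_id))).intervalIntegrable _ _
  have e : ∀ t, K t * u (b - t) - K t * u (a - t) = ∫ y in a..b, K t * v (y - t) := by
    intro t
    rw [intervalIntegral.integral_const_mul, intervalIntegral.integral_comp_sub_right v t,
      ← huv (a - t) (b - t), mul_sub]
  simp only [circleConv]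
  rw [← intervalIntegral.integral_sub (hi b) (hi a)]
  simp only [e]
  refine (intervalIntegral_intervalIntegral_swap
    (F := fun y t => K t * v (y - t)) ?_).symm
  -- Joint integrability comes from the convolution integrand on the whole line of truncations of
  -- `K` and `v`. The truncation of `v` is wide enough to contain every `y - t` from the rectangle.
  set R := |a| + |b| + Real.pi
  have hk : Integrable ((uIoc (-Real.pi) Real.pi).indicator K) :=
    (integrable_indicator_iff measurableSet_uIoc).2
      (intervalIntegrable_iff.1 (hK.intervalIntegrable _ _))
  have hv : Integrable ((uIoc (-R - 1) R).indicator v) :=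
    (integrable_indicator_iff measurableSet_uIoc).2
      (intervalIntegrable_iff.1 (v.intervalIntegrable _ _))
  have hI := (hk.convolution_integrand (ContinuousLinearMap.mul ℝ ℂ) hv).integrableOn
    (s := uIoc a b ×ˢ uIoc (-Real.pi) Real.pi)
  refine hI.congr_fun ?_ (measurableSet_uIoc.prod measurableSet_uIoc)
  rintro ⟨y, t⟩ ⟨hy, ht⟩
  have hpi := Real.pi_pos
  have hy' : |y| ≤ |a| + |b| := by
    rcases (uIcc_eq_union (a := a) (b := b)) ▸ uIoc_subset_uIcc hy with h | h <;>
    · rw [abs_le]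
      constructor <;>
      linarith [neg_abs_le a, neg_abs_le b, le_abs_self a, le_abs_self b, h.1, h.2,
        abs_nonneg a, abs_nonneg b]
  have ht' : t ∈ Ioc (-Real.pi) Real.pi := by rwa [uIoc_of_le (by linarith)] at ht
  have hmem : y - t ∈ uIoc (-R - 1) R := by
    have hR : 0 ≤ R := by positivity
    rw [uIoc_of_le (by linarith)]
    have := abs_le.1 hy'
    constructor <;> simp only [R] <;> linarith [ht'.1, ht'.2]
  simp [Function.uncurry, indicator_of_mem ht, indicator_of_mem hmem]

variable {C : ℝ}

theorem sum_two_inv_pow_le (J : ℕ) : ∑ j ∈ Finset.range J, ((2 : ℝ) ^ j)⁻¹ ≤ 2 := by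
  simpa using sum_geometric_two_le J

theorem exists_dyadic {δ : ℝ} (hδ : 0 < δ) : ∃ J : ℕ, Real.pi ≤ 2 ^ J * δ := by
  obtain ⟨J, hJ⟩ := pow_unbounded_of_one_lt (Real.pi / δ) one_lt_two
  exact ⟨J, ((div_lt_iff₀ hδ).1 hJ).le⟩

/-- Convolution with a kernel of size `B` on `[-δ, δ]` that decays quadratically. -/
theorem WindowBound.dominated_conv (hC : X.WindowBound C) {K : ℝ → ℝ} {B δ : ℝ} (hB : 0 ≤ B)
    (hδ : 0 < δ) (hK : Continuous K) (h0 : ∀ t, |t| ≤ Real.pi → K t ≤ B)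
    (h2 : ∀ t, |t| ≤ Real.pi → K t * |t| ^ 2 ≤ B * δ ^ 2) (v : X.Elem) {u : ℝ → ℂ}
    (hp : Function.Periodic u (2 * Real.pi)) (hm : AEMeasurable u volume)
    (h : ∀ x, ‖u x‖ ≤ ∫ t in (-Real.pi)..Real.pi, K t * ‖v (x - t)‖) :
    u ∈ X.carrier ∧ X.nrm u ≤ C * (8 * B * δ) * ‖v‖ := by
  obtain ⟨J, hJ⟩ := exists_dyadic hδ
  have key := hC.dominated_sum (Finset.range (J + 1)) (fun j => B * 2 ^ 2 / (2 ^ j) ^ 2)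
    (fun j => 2 ^ j * δ) (fun j _ => by positivity) (fun j _ => by positivity) v hp hm
    (fun x => (h x).trans <| (integral_mul_le_sum_dyadic hB hδ hK h0 h2 hJ
      (fun t => norm_nonneg _) fun a b => (intervalIntegrable_comp_sub v x a b).norm).trans_eq <|
      Finset.sum_congr rfl fun j _ => by
        rw [intervalIntegral.integral_comp_sub_left (fun t => ‖v t‖) x, windowIntegral,
          sub_neg_eq_add])
  refine ⟨key.1, key.2.trans ?_⟩
  have hC0 := hC.pos
  gcongr
  -- Quadratic decay against windows of radius `2 ^ j * δ` leaves a geometric series, so the bound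
  -- does not depend on `J`.
  calc ∑ j ∈ Finset.range (J + 1), B * 2 ^ 2 / (2 ^ j) ^ 2 * (2 ^ j * δ)
      = (4 * B * δ) * ∑ j ∈ Finset.range (J + 1), ((2 : ℝ) ^ j)⁻¹ := by
        rw [Finset.mul_sum]
        exact Finset.sum_congr rfl fun j _ => by field_simp; ring
    _ ≤ (4 * B * δ) * 2 := by gcongr; exact sum_two_inv_pow_le _
    _ = _ := by ring

/-- Differences averaged against a kernel of size `B` on `[-δ, δ]` that decays cubically. -/
theorem WindowBound.dominated_conv_sub (hC : X.WindowBound C) {K : ℝ → ℝ} {B δ : ℝ} (hB : 0 ≤ B)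
    (hδ : 0 < δ) (hK : Continuous K) (h0 : ∀ t, |t| ≤ Real.pi → K t ≤ B)
    (h3 : ∀ t, |t| ≤ Real.pi → K t * |t| ^ 3 ≤ B * δ ^ 3) {v w : X.Elem} (hvw : IsPrimitive v w)
    {u : ℝ → ℂ} (hp : Function.Periodic u (2 * Real.pi)) (hm : AEMeasurable u volume)
    (h : ∀ x, ‖u x‖ ≤ ∫ t in (-Real.pi)..Real.pi, K t * ‖v x - v (x - t)‖) :
    u ∈ X.carrier ∧ X.nrm u ≤ C * (32 * B * δ ^ 2) * ‖w‖ := by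
  obtain ⟨J, hJ⟩ := exists_dyadic hδ
  have hv := Elem.continuous_of_isPrimitive hvw
  have hcont : ∀ x, Continuous fun t => ‖v x - v (x - t)‖ := fun x =>
    (continuous_const.sub (hv.comp (continuous_const.sub continuous_id))).norm
  have key := hC.dominated_sum (Finset.range (J + 1))
    (fun j => B * 2 ^ 3 / (2 ^ j) ^ 3 * (2 * (2 ^ j * δ)))
    (fun j => 2 ^ j * δ) (fun j _ => by positivity) (fun j _ => by positivity) w hp hm
    (fun x => (h x).trans <| (integral_mul_le_sum_dyadic hB hδ hK h0 h3 hJ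
      (fun t => norm_nonneg _) fun a b => (hcont x).intervalIntegrable a b).trans <|
      Finset.sum_le_sum fun j _ => by
        have hj : 0 < 2 ^ j * δ := by positivity
        rw [mul_assoc (B * 2 ^ 3 / (2 ^ j) ^ 3)]
        gcongr
        -- Each difference is at most a window integral of `w`. Integrating over `t` costs another
        -- factor `2 ^ j * δ`, hence the need for cubic decay.
        calc ∫ t in (-(2 ^ j * δ))..(2 ^ j * δ), ‖v x - v (x - t)‖
            ≤ ∫ t in (-(2 ^ j * δ))..(2 ^ j * δ), windowIntegral (2 ^ j * δ) w x := by
              refine intervalIntegral.integral_mono_on (by linarith)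
                ((hcont x).intervalIntegrable _ _) (by simp) fun t ht => ?_
              exact Elem.norm_sub_le_windowIntegral hvw ⟨by linarith [ht.2], by linarith [ht.1]⟩
                ⟨by linarith, by linarith⟩
          _ = _ := by
              rw [intervalIntegral.integral_const, smul_eq_mul]; ring)
  refine ⟨key.1, key.2.trans ?_⟩
  have hC0 := hC.pos
  gcongr
  calc ∑ j ∈ Finset.range (J + 1), B * 2 ^ 3 / (2 ^ j) ^ 3 * (2 * (2 ^ j * δ)) * (2 ^ j * δ)
      = (16 * B * δ ^ 2) * ∑ j ∈ Finset.range (J + 1), ((2 : ℝ) ^ j)⁻¹ := by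
        rw [Finset.mul_sum]
        exact Finset.sum_congr rfl fun j _ => by field_simp; ring
    _ ≤ (16 * B * δ ^ 2) * 2 := by gcongr; exact sum_two_inv_pow_le _
    _ = _ := by ring

theorem norm_circleConv_le {K : ℝ → ℝ} (hK0 : ∀ t, 0 ≤ K t) (u : ℝ → ℂ) (x : ℝ) :
    ‖circleConv (fun t => (K t : ℂ)) u x‖ ≤ ∫ t in (-Real.pi)..Real.pi, K t * ‖u (x - t)‖ := by
  refine (intervalIntegral.norm_integral_le_integral_norm (by linarith [Real.pi_pos])).trans_eq ?_
  simp only [norm_mul, Complex.norm_real, Real.norm_of_nonneg (hK0 _)]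

/-- Convolution with the Jackson kernel, as a bounded operator on `X`. -/
noncomputable def WindowBound.jackson (hC : X.WindowBound C) {m : ℕ} (hm : 1 ≤ m) :
    X.Elem →L[ℂ] X.Elem :=
  LinearMap.mkContinuous
    { toFun := fun u => toElem (circleConv (fun t => (jacksonKernel m t : ℂ)) u)
        (mem_of_continuous (isTrigPoly_circleConv (isTrigPoly_jacksonKernel m) u).periodic
          (isTrigPoly_circleConv (isTrigPoly_jacksonKernel m) u).continuous)
      map_add' := fun u v => by
        refine Elem.ext fun x => ?_
        have hK := Complex.continuous_ofReal.comp (continuous_jacksonKernel m)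
        simp only [circleConv, coe_toElem, Elem.coe_add, Pi.add_apply, mul_add]
        exact intervalIntegral.integral_add
          ((intervalIntegrable_comp_sub u x _ _).continuousOn_mul hK.continuousOn)
          ((intervalIntegrable_comp_sub v x _ _).continuousOn_mul hK.continuousOn)
      map_smul' := fun a u => by
        refine Elem.ext fun x => ?_
        simp only [circleConv, coe_toElem, Elem.coe_smul, Pi.smul_apply, smul_eq_mul,
          RingHom.id_apply, mul_left_comm _ a, intervalIntegral.integral_const_mul] }
    (C * (64 * Real.pi ^ 4))
    (fun u => by
      have hm0 : (0 : ℝ) < m := by exact_mod_cast hm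
      have hT := isTrigPoly_circleConv (isTrigPoly_jacksonKernel m) u
      have := (hC.dominated_conv (B := 8 * Real.pi ^ 4 * m) (by positivity) (inv_pos.2 hm0)
        (continuous_jacksonKernel m)
        (fun t ht => by simpa using jacksonKernel_mul_pow_le hm (Nat.zero_le 4) ht)
        (fun t ht => jacksonKernel_mul_pow_le hm (by norm_num) ht) u hT.periodic
        hT.continuous.measurable.aemeasurable
        (norm_circleConv_le (jacksonKernel_nonneg hm) u)).2
      refine this.trans_eq ?_
      field_simp
      ring)

section

variable (hC : X.WindowBound C) {m : ℕ} (hm : 1 ≤ m)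

theorem WindowBound.norm_jackson_le : ‖hC.jackson hm‖ ≤ C * (64 * Real.pi ^ 4) :=
  LinearMap.mkContinuous_norm_le _ (by have := hC.pos; positivity) _

theorem WindowBound.preservesPrimitive_jackson : PreservesPrimitive (hC.jackson hm) :=
  fun _ _ huv => isPrimitive_circleConv
    (Complex.continuous_ofReal.comp (continuous_jacksonKernel m)) huv

theorem WindowBound.isTrigPoly_jackson (u : X.Elem) :
    IsTrigPoly (4 * (m - 1)) (hC.jackson hm u) :=
  isTrigPoly_circleConv (isTrigPoly_jacksonKernel m) u

/-- The kernel has integral one, so the error is the kernel average of the differences `u x - u (x -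
t)`. -/
theorem WindowBound.norm_sub_jackson_le {u v : X.Elem} (huv : IsPrimitive u v) :
    ‖(1 - hC.jackson hm) u‖ ≤ C * (256 * Real.pi ^ 4) / m * ‖v‖ := by
  have hm0 : (0 : ℝ) < m := by exact_mod_cast hm
  have hu := Elem.continuous_of_isPrimitive huv
  have hK := Complex.continuous_ofReal.comp (continuous_jacksonKernel m)
  have key : ∀ x, ‖((1 - hC.jackson hm) u) x‖ ≤
      ∫ t in (-Real.pi)..Real.pi, jacksonKernel m t * ‖u x - u (x - t)‖ := by
    intro x
    have e : ((1 - hC.jackson hm) u) x =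
        ∫ t in (-Real.pi)..Real.pi, (jacksonKernel m t : ℂ) * (u x - u (x - t)) := by
      have h1 : Continuous fun t => (jacksonKernel m t : ℂ) * u x := hK.mul continuous_const
      have h2 : Continuous fun t => (jacksonKernel m t : ℂ) * u (x - t) :=
        hK.mul (hu.comp (continuous_const.sub continuous_id))
      simp only [mul_sub]
      rw [intervalIntegral.integral_sub (h1.intervalIntegrable _ _) (h2.intervalIntegrable _ _),
        intervalIntegral.integral_mul_const, intervalIntegral.integral_ofReal,
        integral_jacksonKernel hm, Complex.ofReal_one, one_mul]
      rfl
    rw [e]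
    refine (intervalIntegral.norm_integral_le_integral_norm
      (by linarith [Real.pi_pos])).trans_eq ?_
    simp only [norm_mul, Complex.norm_real, Real.norm_of_nonneg (jacksonKernel_nonneg hm _)]
  have := (hC.dominated_conv_sub (B := 8 * Real.pi ^ 4 * m) (by positivity) (inv_pos.2 hm0)
    (continuous_jacksonKernel m)
    (fun t ht => by simpa using jacksonKernel_mul_pow_le hm (Nat.zero_le 4) ht)
    (fun t ht => jacksonKernel_mul_pow_le hm (by norm_num) ht) huv (Elem.periodic _)
    (Elem.aemeasurable _) key).2
  refine this.trans_eq ?_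
  field_simp
  ring

end

end BanachFunctionLattice

/-! ### Bernstein's inequality for trigonometric polynomials in `X`. -/

theorem integral_exp_int (j : ℤ) :
    ∫ t in (-Real.pi)..Real.pi, Complex.exp (Complex.I * j * t) =
      if j = 0 then 2 * (Real.pi : ℂ) else 0 := by
  split_ifs with h
  · subst h
    simp
    ring
  · have hj : Complex.I * j ≠ 0 := mul_ne_zero Complex.I_ne_zero (by exact_mod_cast h)
    rw [integral_exp_mul_complex hj]
    have : Complex.exp (Complex.I * j * (Real.pi : ℝ)) =
        Complex.exp (Complex.I * j * (-Real.pi : ℝ)) := by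
      rw [Complex.exp_eq_exp_iff_exists_int]
      exact ⟨j, by push_cast; ring⟩
    rw [this, sub_self, zero_div]

/-- Counts the pairs with `b = a + n - l`. Such a `b` is nonnegative because `l ≤ n`, and it is
below `n` exactly when `a < l`. -/
theorem sum_ite_sub_add_eq (n : ℕ) {l : ℤ} (hl : l ≤ n) :
    ∑ a ∈ Finset.range n, ∑ b ∈ Finset.range n,
      (if (a : ℤ) - b + n - l = 0 then (1 : ℂ) else 0) = (l.toNat : ℂ) := by
  have h : ∀ a ∈ Finset.range n, ∑ b ∈ Finset.range n,
      (if (a : ℤ) - b + n - l = 0 then (1 : ℂ) else 0) = if a < l.toNat then 1 else 0 := by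
    intro a ha
    rw [Finset.mem_range] at ha
    have : ∀ b ∈ Finset.range n, (if (a : ℤ) - b + n - l = 0 then (1 : ℂ) else 0) =
        if b = ((a : ℤ) + n - l).toNat then 1 else 0 := by
      intro b _
      congr 1
      simp only [eq_iff_iff]
      omega
    rw [Finset.sum_congr rfl this, Finset.sum_ite_eq']
    congr 1
    simp only [Finset.mem_range, eq_iff_iff]
    omega
  rw [Finset.sum_congr rfl h, ← Finset.sum_filter, Finset.sum_const, nsmul_eq_mul, mul_one]
  congr 1
  have : (Finset.range n).filter (fun a => a < l.toNat) = Finset.range l.toNat := by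
    ext a
    simp only [Finset.mem_filter, Finset.mem_range]
    omega
  rw [this, Finset.card_range]

/-- The kernel that reproduces derivatives of trigonometric polynomials of degree `n`. -/
noncomputable def derivKernel (n : ℕ) (t : ℝ) : ℂ :=
  Complex.I / (2 * Real.pi) * ((Complex.exp (Complex.I * (n : ℤ) * t) -
    Complex.exp (Complex.I * (-n : ℤ) * t)) * (expSum n t * (starRingEnd ℂ) (expSum n t)))

theorem continuous_derivKernel (n : ℕ) : Continuous (derivKernel n) := by
  have h1 := continuous_expSum n
  have h2 : Continuous fun t => (starRingEnd ℂ) (expSum n t) := Complex.continuous_conj.comp h1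
  unfold derivKernel
  fun_prop

theorem expSum_mul_conj (n : ℕ) (t : ℝ) : expSum n t * (starRingEnd ℂ) (expSum n t) =
    ∑ a ∈ Finset.range n, ∑ b ∈ Finset.range n,
      Complex.exp (Complex.I * ((a - b : ℤ) : ℂ) * t) := by
  rw [conj_expSum, expSum, Finset.sum_mul_sum]
  refine Finset.sum_congr rfl fun a _ => Finset.sum_congr rfl fun b _ => ?_
  rw [← Complex.exp_nat_mul, ← Complex.exp_add]
  congr 1
  push_cast
  ring

/-- `|expSum n|²` is `n` times a Fejér kernel, with triangular Fourier coefficients. The difference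
of its translates in frequency by `n` and `-n` has coefficient `l⁺ - (-l)⁺ = l` for `|l| ≤ n`: the
multiplier of differentiation. -/
theorem integral_derivKernel_mul_exp (n : ℕ) {l : ℤ} (hl : l ∈ Finset.Icc (-(n : ℤ)) n) :
    ∫ t in (-Real.pi)..Real.pi, derivKernel n t * Complex.exp (Complex.I * (-l : ℤ) * t) =
      Complex.I * l := by
  rw [Finset.mem_Icc] at hl
  have e : ∀ t : ℝ, derivKernel n t * Complex.exp (Complex.I * (-l : ℤ) * t) =
      Complex.I / (2 * Real.pi) * ∑ a ∈ Finset.range n, ∑ b ∈ Finset.range n,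
        (Complex.exp (Complex.I * (a - b + n - l : ℤ) * t) -
          Complex.exp (Complex.I * (a - b - n - l : ℤ) * t)) := by
    intro t
    rw [derivKernel, expSum_mul_conj, mul_assoc, mul_assoc, Finset.sum_mul, Finset.mul_sum]
    congr 1
    refine Finset.sum_congr rfl fun a _ => ?_
    rw [Finset.sum_mul, Finset.mul_sum]
    refine Finset.sum_congr rfl fun b _ => ?_
    rw [sub_mul, ← Complex.exp_add, ← Complex.exp_add, ← Complex.exp_add]
    congr 2 <;> push_cast <;> ring
  simp only [e]
  have hc : ∀ j : ℤ, IntervalIntegrable (fun t : ℝ => Complex.exp (Complex.I * j * t)) volume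
      (-Real.pi) Real.pi := fun j => by
    apply Continuous.intervalIntegrable; fun_prop
  have hs : ∀ a ∈ Finset.range n, IntervalIntegrable (fun t : ℝ => ∑ b ∈ Finset.range n,
      (Complex.exp (Complex.I * (a - b + n - l : ℤ) * t) -
        Complex.exp (Complex.I * (a - b - n - l : ℤ) * t))) volume (-Real.pi) Real.pi :=
    fun a _ => by
    apply Continuous.intervalIntegrable
    fun_prop
  rw [intervalIntegral.integral_const_mul, intervalIntegral.integral_finsetSum hs]
  have e2 : ∀ a ∈ Finset.range n, ∫ t in (-Real.pi)..Real.pi, ∑ b ∈ Finset.range n,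
        (Complex.exp (Complex.I * (a - b + n - l : ℤ) * t) -
          Complex.exp (Complex.I * (a - b - n - l : ℤ) * t)) =
      2 * Real.pi * (∑ b ∈ Finset.range n, (if (a : ℤ) - b + n - l = 0 then (1 : ℂ) else 0) -
        ∑ b ∈ Finset.range n, (if (b : ℤ) - a + n - (-l) = 0 then (1 : ℂ) else 0)) := by
    intro a _
    rw [intervalIntegral.integral_finsetSum fun b _ => (hc _).sub (hc _),
      ← Finset.sum_sub_distrib, Finset.mul_sum]
    refine Finset.sum_congr rfl fun b _ => ?_
    rw [intervalIntegral.integral_sub (hc _) (hc _), integral_exp_int, integral_exp_int,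
      mul_sub, mul_ite, mul_ite, mul_one, mul_zero]
    congr 2
    simp only [eq_iff_iff]
    omega
  rw [Finset.sum_congr rfl e2, ← Finset.mul_sum, Finset.sum_sub_distrib,
    Finset.sum_comm (f := fun a b : ℕ => if (b : ℤ) - a + n - (-l) = 0 then (1 : ℂ) else 0),
    sum_ite_sub_add_eq n hl.2, sum_ite_sub_add_eq n (l := -l) (by omega)]
  have h3 : ((l.toNat : ℂ) - ((-l).toNat : ℂ)) = l := by
    have : (l.toNat : ℤ) - ((-l).toNat : ℤ) = l := by omega
    exact_mod_cast this
  rw [h3]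
  have hpi : (Real.pi : ℂ) ≠ 0 := by exact_mod_cast Real.pi_ne_zero
  field_simp

theorem norm_derivKernel_le (n : ℕ) (t : ℝ) : ‖derivKernel n t‖ ≤ Real.pi⁻¹ * ‖expSum n t‖ ^ 2 := by
  have hpi := Real.pi_pos
  have h1 : ∀ j : ℤ, ‖Complex.exp (Complex.I * j * t)‖ = 1 := fun j => by
    rw [show Complex.I * j * t = ((j * t : ℝ) : ℂ) * Complex.I by push_cast; ring,
      Complex.norm_exp_ofReal_mul_I]
  have h2 : ‖Complex.exp (Complex.I * (n : ℤ) * t) - Complex.exp (Complex.I * (-n : ℤ) * t)‖ ≤ 2 :=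
    (norm_sub_le _ _).trans (by rw [h1, h1]; norm_num)
  have h3 : ‖Complex.I / (2 * (Real.pi : ℂ))‖ = (2 * Real.pi)⁻¹ := by
    rw [norm_div, Complex.norm_I, norm_mul, Complex.norm_real, Real.norm_of_nonneg hpi.le]
    simp
  rw [derivKernel, norm_mul, norm_mul, norm_mul, Complex.norm_conj, h3]
  calc (2 * Real.pi)⁻¹ * (‖Complex.exp (Complex.I * (n : ℤ) * t) -
        Complex.exp (Complex.I * (-n : ℤ) * t)‖ * (‖expSum n t‖ * ‖expSum n t‖))
      ≤ (2 * Real.pi)⁻¹ * (2 * (‖expSum n t‖ * ‖expSum n t‖)) := by gcongr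
    _ = _ := by field_simp

theorem IsTrigPoly.deriv_eq {n : ℕ} {T : ℝ → ℂ} (hT : IsTrigPoly n T) (x : ℝ) :
    _root_.deriv T x = circleConv (derivKernel n) T x := by
  obtain ⟨c, hc⟩ := hT
  have h : HasDerivAt (fun x : ℝ => ∑ k ∈ Finset.Icc (-(n : ℤ)) n,
      c k * Complex.exp (Complex.I * k * x)) (∑ k ∈ Finset.Icc (-(n : ℤ)) n,
      c k * (Complex.I * k * Complex.exp (Complex.I * k * x))) x :=
    HasDerivAt.fun_sum fun k _ => (hasDerivAt_exp _ x).const_mul _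
  rw [funext hc, h.deriv]
  have hK := continuous_derivKernel n
  have e : ∀ t : ℝ, derivKernel n t * ∑ k ∈ Finset.Icc (-(n : ℤ)) n,
      c k * Complex.exp (Complex.I * k * ((x - t : ℝ) : ℂ)) = ∑ k ∈ Finset.Icc (-(n : ℤ)) n,
        c k * Complex.exp (Complex.I * k * x) *
          (derivKernel n t * Complex.exp (Complex.I * (-k : ℤ) * t)) := by
    intro t
    rw [Finset.mul_sum]
    refine Finset.sum_congr rfl fun k _ => ?_
    rw [show Complex.I * k * ((x - t : ℝ) : ℂ) = Complex.I * k * x + Complex.I * (-k : ℤ) * t by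
      push_cast; ring, Complex.exp_add]
    ring
  simp only [circleConv, e]
  rw [intervalIntegral.integral_finsetSum]
  · refine Finset.sum_congr rfl fun k hk => ?_
    rw [intervalIntegral.integral_const_mul, integral_derivKernel_mul_exp n hk]
    ring
  · intro k _
    apply Continuous.intervalIntegrable
    fun_prop

namespace BanachFunctionLattice

variable {X : BanachFunctionLattice} {C : ℝ}

theorem mem_of_isTrigPoly {n : ℕ} {T : ℝ → ℂ} (hT : IsTrigPoly n T) : T ∈ X.carrier :=
  mem_of_continuous hT.periodic hT.continuous

/-- Bernstein's inequality in `X`. -/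
theorem WindowBound.nrm_deriv_le (hC : X.WindowBound C) {n : ℕ} (hn : 1 ≤ n) {T : ℝ → ℂ}
    (hT : IsTrigPoly n T) : X.nrm (deriv T) ≤ 8 * Real.pi * C * n * X.nrm T := by
  have hpi := Real.pi_pos
  have hpi1 : Real.pi⁻¹ ≤ Real.pi :=
    (inv_le_one_of_one_le₀ (by linarith [Real.pi_gt_three])).trans (by linarith [Real.pi_gt_three])
  have hn0 : (0 : ℝ) < n := by exact_mod_cast hn
  have hKc : Continuous fun t => Real.pi⁻¹ * ‖expSum n t‖ ^ 2 :=
    continuous_const.mul (continuous_norm_expSum_pow n 2)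
  -- The majorant `π⁻¹ ‖expSum n t‖²` of the kernel has size at most `π n²` and decays quadratically
  -- beyond `1/n`, whence a norm of order `n² · n⁻¹ = n`.
  have key := (hC.dominated_conv (B := Real.pi * n ^ 2) (by positivity) (inv_pos.2 hn0) hKc
    (fun t _ => by
      gcongr
      exact norm_expSum_le n t)
    (fun t ht => by
      calc Real.pi⁻¹ * ‖expSum n t‖ ^ 2 * |t| ^ 2 = Real.pi⁻¹ * (‖expSum n t‖ * |t|) ^ 2 := by ring
        _ ≤ Real.pi⁻¹ * Real.pi ^ 2 := by gcongr; exact norm_expSum_mul_le n ht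
        _ = Real.pi * n ^ 2 * (n : ℝ)⁻¹ ^ 2 := by field_simp)
    (toElem T (mem_of_isTrigPoly hT)) hT.deriv.periodic
    hT.deriv.continuous.measurable.aemeasurable
    (fun x => by
      rw [hT.deriv_eq]
      refine (intervalIntegral.norm_integral_le_integral_norm (by linarith)).trans ?_
      have hTc : Continuous fun t => T (x - t) :=
        hT.continuous.comp (continuous_const.sub continuous_id)
      refine intervalIntegral.integral_mono_on (by linarith)
        (((continuous_derivKernel n).mul hTc).norm.intervalIntegrable _ _)
        ((hKc.mul hTc.norm).intervalIntegrable _ _) fun t _ => ?_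
      rw [norm_mul]
      gcongr
      · exact norm_derivKernel_le n t
      · exact le_rfl)).2
  refine key.trans_eq ?_
  rw [norm_toElem]
  field_simp

theorem WindowBound.nrm_iteratedDeriv_le (hC : X.WindowBound C) {n : ℕ} (hn : 1 ≤ n) {T : ℝ → ℂ}
    (hT : IsTrigPoly n T) (s : ℕ) :
    X.nrm (iteratedDeriv s T) ≤ (8 * Real.pi * C * n) ^ s * X.nrm T := by
  have hC0 := hC.pos
  induction s with
  | zero => simp
  | succ s ih =>
    rw [iteratedDeriv_succ]
    calc X.nrm (deriv (iteratedDeriv s T))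
        ≤ 8 * Real.pi * C * n * X.nrm (iteratedDeriv s T) :=
          hC.nrm_deriv_le hn (hT.iteratedDeriv s)
      _ ≤ 8 * Real.pi * C * n * ((8 * Real.pi * C * n) ^ s * X.nrm T) := by gcongr
      _ = _ := by ring

end BanachFunctionLattice

/-! ### The discrete seminorm: arcs, step functions and sampling of averages. -/

namespace BanachFunctionLattice

variable {X : BanachFunctionLattice} {C : ℝ}

theorem arc_add_two_pi_mem (a b y : ℝ) : y + 2 * Real.pi ∈ arc a b ↔ y ∈ arc a b := by
  constructor
  · rintro ⟨j, hj⟩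
    refine ⟨j + 1, ?_⟩
    convert hj using 1
    push_cast
    ring
  · rintro ⟨j, hj⟩
    refine ⟨j - 1, ?_⟩
    convert hj using 1
    push_cast
    ring

theorem measurableSet_arc (a b : ℝ) : MeasurableSet (arc a b) := by
  have : arc a b = ⋃ j : ℤ, (fun y : ℝ => y + j * (2 * Real.pi)) ⁻¹' Ico a b := by
    ext y; simp only [arc, mem_ofPred_eq, mem_iUnion, mem_preimage]
  rw [this]
  exact MeasurableSet.iUnion fun j => (measurable_add_const _) measurableSet_Ico

theorem stepFun_mem (N : ℕ) (x : ℕ → ℝ) (f : ℝ → ℂ) : stepFun N x f ∈ X.carrier := by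
  have e : stepFun N x f = ∑ k ∈ Finset.range N, ((‖f (x k)‖ : ℝ) : ℂ) •
      (arc (x k) (x (k + 1))).indicator (fun _ => (1 : ℂ)) := by
    ext y
    rw [Finset.sum_apply]
    refine Finset.sum_congr rfl fun k _ => ?_
    by_cases h : y ∈ arc (x k) (x (k + 1)) <;> simp [h]
  rw [e]
  exact X.carrier.sum_mem fun k _ => X.carrier.smul_mem _
    (X.indicator_mem _ (measurableSet_arc _ _).nullMeasurableSet fun y => arc_add_two_pi_mem _ _ y)

theorem stepFun_eq_ofReal (N : ℕ) (x : ℕ → ℝ) (f : ℝ → ℂ) (y : ℝ) : stepFun N x f y =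
    ((∑ k ∈ Finset.range N, (arc (x k) (x (k + 1))).indicator (fun _ => ‖f (x k)‖) y : ℝ) : ℂ) := by
  rw [stepFun, Complex.ofReal_sum]
  refine Finset.sum_congr rfl fun k _ => ?_
  by_cases h : y ∈ arc (x k) (x (k + 1)) <;> simp [h]

theorem norm_stepFun (N : ℕ) (x : ℕ → ℝ) (f : ℝ → ℂ) (y : ℝ) : ‖stepFun N x f y‖ =
    ∑ k ∈ Finset.range N, (arc (x k) (x (k + 1))).indicator (fun _ => ‖f (x k)‖) y := by
  rw [stepFun_eq_ofReal, Complex.norm_real, Real.norm_of_nonneg]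
  exact Finset.sum_nonneg fun k _ => indicator_nonneg (fun _ _ => norm_nonneg _) _

theorem discreteNrm_nonneg (N : ℕ) (x : ℕ → ℝ) (f : ℝ → ℂ) : 0 ≤ X.discreteNrm N x f :=
  X.nrm_nonneg (stepFun_mem N x f)

theorem discreteNrm_le_add {N : ℕ} {x : ℕ → ℝ} {f g h : ℝ → ℂ}
    (H : ∀ y, ‖f y‖ ≤ ‖g y‖ + ‖h y‖) :
    X.discreteNrm N x f ≤ X.discreteNrm N x g + X.discreteNrm N x h := by
  have hm := X.carrier.add_mem (stepFun_mem N x g) (stepFun_mem N x h)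
  refine ((X.ideal (stepFun N x f) _ hm (X.periodic _ (stepFun_mem N x f))
    (X.measurable _ (stepFun_mem N x f)) (Eventually.of_forall fun y => ?_)).2).trans
    (X.nrm_add_le _ (stepFun_mem N x g) _ (stepFun_mem N x h))
  have e : ‖(stepFun N x g + stepFun N x h) y‖ = ‖stepFun N x g y‖ + ‖stepFun N x h y‖ := by
    rw [norm_stepFun, norm_stepFun, Pi.add_apply, stepFun_eq_ofReal, stepFun_eq_ofReal,
      ← Complex.ofReal_add, Complex.norm_real, Real.norm_of_nonneg]
    exact add_nonneg (Finset.sum_nonneg fun k _ => indicator_nonneg (fun _ _ => norm_nonneg _) _)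
      (Finset.sum_nonneg fun k _ => indicator_nonneg (fun _ _ => norm_nonneg _) _)
  rw [e, norm_stepFun, norm_stepFun, norm_stepFun, ← Finset.sum_add_distrib]
  refine Finset.sum_le_sum fun k _ => ?_
  by_cases h : y ∈ arc (x k) (x (k + 1)) <;> simp [h, H]

theorem discreteNrm_le_sub_add (N : ℕ) (x : ℕ → ℝ) (f g : ℝ → ℂ) :
    X.discreteNrm N x f ≤ X.discreteNrm N x (f - g) + X.discreteNrm N x g :=
  discreteNrm_le_add fun y => by
    calc ‖f y‖ = ‖(f y - g y) + g y‖ := by rw [sub_add_cancel]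
      _ ≤ _ := norm_add_le _ _

theorem discreteNrm_sub_le (N : ℕ) (x : ℕ → ℝ) (f g : ℝ → ℂ) :
    X.discreteNrm N x (f - g) ≤ X.discreteNrm N x f + X.discreteNrm N x g :=
  discreteNrm_le_add fun _ => norm_sub_le _ _

/-- A partition of the circle by `N` arcs of length at most `δ`. -/
structure IsPartition (N : ℕ) (x : ℕ → ℝ) (δ : ℝ) : Prop where
  wrap : x N = x 0 + 2 * Real.pi
  lt : ∀ k < N, x k < x (k + 1)
  le : ∀ k < N, x (k + 1) ≤ x k + δ

theorem IsPartition.mono {N : ℕ} {x : ℕ → ℝ} {δ : ℝ} (hx : IsPartition N x δ) {k l : ℕ}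
    (hkl : k ≤ l) (hl : l ≤ N) : x k ≤ x l := by
  induction l, hkl using Nat.le_induction with
  | base => rfl
  | succ l _ ih => exact (ih (by omega)).trans (hx.lt l (by omega)).le

theorem IsPartition.delta_pos {N : ℕ} {x : ℕ → ℝ} {δ : ℝ} (hx : IsPartition N x δ) : 0 < δ := by
  have hN : 0 < N := by
    rcases Nat.eq_zero_or_pos N with h | h
    · have := hx.wrap
      rw [h] at this
      linarith [Real.pi_pos]
    · exact h
  linarith [hx.lt 0 hN, hx.le 0 hN]

/-- All the intervals lie in `[x 0, x 0 + 2π)`, so `y` enters both with the same multiple of `2π`;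
monotonicity of the nodes separates the indices. -/
theorem IsPartition.eq_of_mem_arc {N : ℕ} {x : ℕ → ℝ} {δ : ℝ} (hx : IsPartition N x δ) {k l : ℕ}
    (hk : k < N) (hl : l < N) {y : ℝ} (hyk : y ∈ arc (x k) (x (k + 1)))
    (hyl : y ∈ arc (x l) (x (l + 1))) : k = l := by
  obtain ⟨i, hi⟩ := hyk
  obtain ⟨j, hj⟩ := hyl
  have hw := hx.wrap
  have h1 := hx.mono (Nat.zero_le k) hk.le
  have h2 := hx.mono (Nat.succ_le_of_lt hk) le_rfl
  have h3 := hx.mono (Nat.zero_le l) hl.le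
  have h4 := hx.mono (Nat.succ_le_of_lt hl) le_rfl
  have hpi := Real.two_pi_pos
  have hij : i = j := by
    obtain ⟨hi1, hi2⟩ := hi
    obtain ⟨hj1, hj2⟩ := hj
    have a : (i : ℝ) < j + 1 := by
      by_contra hc
      push Not at hc
      nlinarith
    have b : (j : ℝ) < i + 1 := by
      by_contra hc
      push Not at hc
      nlinarith
    have a' : i < j + 1 := by exact_mod_cast a
    have b' : j < i + 1 := by exact_mod_cast b
    omega
  subst hij
  by_contra hne
  rcases Nat.lt_or_gt_of_ne hne with h | h
  · linarith [hx.mono (Nat.succ_le_of_lt h) hl.le, hi.2, hj.1]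
  · linarith [hx.mono (Nat.succ_le_of_lt h) hk.le, hj.2, hi.1]

/-- The step function at `y` is controlled by values of `f` at distance at most `δ` from `y`. -/
theorem IsPartition.norm_stepFun_le {N : ℕ} {x : ℕ → ℝ} {δ : ℝ} (hx : IsPartition N x δ)
    {f : ℝ → ℂ} {W : ℝ → ℝ} (hW : Function.Periodic W (2 * Real.pi)) (h0 : ∀ y, 0 ≤ W y)
    (H : ∀ a z, a ≤ z → z ≤ a + δ → ‖f a‖ ≤ W z) (y : ℝ) : ‖stepFun N x f y‖ ≤ W y := by
  rw [norm_stepFun]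
  by_cases hex : ∃ k < N, y ∈ arc (x k) (x (k + 1))
  · obtain ⟨k, hk, hy⟩ := hex
    rw [Finset.sum_eq_single k]
    · rw [indicator_of_mem hy]
      obtain ⟨j, hj⟩ := hy
      have := H (x k) _ hj.1 (hj.2.le.trans (hx.le k hk))
      rwa [show y + j * (2 * Real.pi) = y + j • (2 * Real.pi) by simp, hW.zsmul j y] at this
    · intro l hl hlk
      exact indicator_of_notMem (fun hyl =>
        hlk (hx.eq_of_mem_arc (Finset.mem_range.1 hl) hk hyl hy)) _
    · intro h; exact absurd (Finset.mem_range.2 hk) h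
  · push Not at hex
    rw [Finset.sum_eq_zero fun k hk => indicator_of_notMem (hex k (Finset.mem_range.1 hk)) _]
    exact h0 y

theorem WindowBound.nrm_le_add (hC : X.WindowBound C) {c ρ : ℝ} (hc : 0 ≤ c) (hρ : 0 < ρ)
    {f : ℝ → ℂ} (hf : f ∈ X.carrier) (u v : X.Elem)
    (h : ∀ x, ‖f x‖ ≤ ‖u x‖ + c * windowIntegral ρ v x) :
    X.nrm f ≤ ‖u‖ + C * (c * ρ) * ‖v‖ := by
  have hw := hC.2 ρ hρ v
  have ha := X.ideal (fun x => ((‖u x‖ : ℝ) : ℂ)) u u.mem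
    (fun x => by simp only [u.periodic x]) (by
      have := u.aemeasurable
      fun_prop) (Eventually.of_forall fun x => by simp)
  have hcw := X.carrier.smul_mem (c : ℂ) hw.1
  have key := (X.ideal f _ (X.carrier.add_mem ha.1 hcw) (X.periodic f hf) (X.measurable f hf)
    (Eventually.of_forall fun x => (h x).trans (by
      have e : ((fun x => ((‖u x‖ : ℝ) : ℂ)) + (c : ℂ) • fun x => (windowIntegral ρ v x : ℂ)) x =
          ((‖u x‖ + c * windowIntegral ρ v x : ℝ) : ℂ) := by
        simp only [Pi.add_apply, Pi.smul_apply, smul_eq_mul]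
        push_cast
        rfl
      rw [e, Complex.norm_real]
      exact Real.le_norm_self _))).2
  refine key.trans ((X.nrm_add_le _ ha.1 _ hcw).trans (add_le_add ha.2 ?_))
  rw [X.nrm_smul _ _ hw.1, Complex.norm_real, Real.norm_of_nonneg hc]
  calc c * X.nrm (fun x => (windowIntegral ρ v x : ℂ)) ≤ c * (C * ρ * ‖v‖) := by
        gcongr; exact hw.2
    _ = _ := by ring

/-- Sampling costs one derivative: the value at a node differs from the value at a point of its arc
by at most a window integral of `v` of radius `δ`. -/
theorem WindowBound.discreteNrm_le (hC : X.WindowBound C) {N : ℕ} {x : ℕ → ℝ} {δ : ℝ}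
    (hx : IsPartition N x δ) {u v : X.Elem} (huv : IsPrimitive u v) :
    X.discreteNrm N x u ≤ ‖u‖ + C * δ * ‖v‖ := by
  have hδ := hx.delta_pos
  have := hC.nrm_le_add zero_le_one hδ (stepFun_mem N x u) u v fun y =>
    hx.norm_stepFun_le (W := fun y => ‖u y‖ + 1 * windowIntegral δ v y)
      (fun y => by simp only [u.periodic y, v.windowIntegral_periodic δ y])
      (fun y => add_nonneg (norm_nonneg _)
        (mul_nonneg zero_le_one (windowIntegral_nonneg hδ.le _ _)))
      (fun a z haz hza => by
        have h1 := Elem.norm_sub_le_windowIntegral huv (a := z) (b := a) (x := z) (ρ := δ)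
          ⟨by linarith, by linarith⟩ ⟨by linarith, by linarith⟩
        have h2 := norm_le_norm_add_norm_sub' (u a) (u z)
        simp only [one_mul]
        linarith) y
  rwa [one_mul] at this

/-- Samples of an average need no smoothness of `u`: the average at a node is dominated by the
window of radius `h + δ` around each point of the arc. -/
theorem WindowBound.discreteNrm_average_le (hC : X.WindowBound C) {N : ℕ} {x : ℕ → ℝ} {δ : ℝ}
    (hx : IsPartition N x δ) {h c : ℝ} (hh : 0 < h) (hc : c ∈ Icc 0 (h / 2)) (u : X.Elem) :
    X.discreteNrm N x (hC.average hh hc u) ≤ C * (1 + δ / h) * ‖u‖ := by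
  have hδ := hx.delta_pos
  have := (hC.dominated (c := h⁻¹) (ρ := h + δ) (by positivity) (by positivity) u
    (X.periodic _ (stepFun_mem N x _)) (X.measurable _ (stepFun_mem N x (hC.average hh hc u)))
    fun y => hx.norm_stepFun_le (W := fun y => h⁻¹ * windowIntegral (h + δ) u y)
      (fun y => by simp only [u.windowIntegral_periodic _ y])
      (fun y => mul_nonneg (by positivity) (windowIntegral_nonneg (by positivity) _ _))
      (fun a z haz hza => by
        refine (norm_shiftedAverage_le hh hc u a).trans ?_
        gcongr
        refine u.windowIntegral_mono hh.le ?_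
        rw [abs_of_nonpos (by linarith)]
        linarith) y).2
  refine this.trans_eq ?_
  field_simp

/-- `I - (I - A)^r` is the sum of `A(I - A)^k` over `k < r`, so only averages are sampled. This lets
samples of an arbitrary `u` be replaced by samples of `(I - A)^r u`. -/
theorem WindowBound.discreteNrm_sub_pow_le (hC : X.WindowBound C) {N : ℕ} {x : ℕ → ℝ} {δ : ℝ}
    (hx : IsPartition N x δ) {h c : ℝ} (hh : 0 < h) (hc : c ∈ Icc 0 (h / 2)) (r : ℕ)
    (u : X.Elem) :
    X.discreteNrm N x (u - ((1 - hC.average hh hc) ^ r) u) ≤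
      r * (C * (1 + δ / h) * (1 + C) ^ r) * ‖u‖ := by
  have hC0 := hC.pos
  have hδ := hx.delta_pos
  set F : X.Elem →L[ℂ] X.Elem := 1 - hC.average hh hc with hF
  induction r with
  | zero =>
    have e : (u - (F ^ 0) u : ℝ → ℂ) = (0 : X.Elem) := by
      rw [pow_zero]; exact sub_self _
    rw [e]
    refine (hC.discreteNrm_le hx Elem.isPrimitive_zero).trans ?_
    simp
  | succ r ih =>
    have h1 : X.discreteNrm N x (u - (F ^ (r + 1)) u) ≤
        X.discreteNrm N x (u - (F ^ r) u) +
          X.discreteNrm N x (hC.average hh hc ((F ^ r) u)) := by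
      refine discreteNrm_le_add fun y => ?_
      have e : (u - (F ^ (r + 1)) u : ℝ → ℂ) y =
          (u - (F ^ r) u : ℝ → ℂ) y + (hC.average hh hc ((F ^ r) u)) y := by
        rw [pow_succ']
        change u y - ((F ^ r) u y - hC.average hh hc ((F ^ r) u) y) = u y - (F ^ r) u y + _
        ring
      rw [e]
      exact norm_add_le _ _
    have h2 := hC.discreteNrm_average_le hx hh hc ((F ^ r) u)
    have h3 : ‖(F ^ r) u‖ ≤ (1 + C) ^ r * ‖u‖ :=
      (ContinuousLinearMap.le_opNorm _ _).trans (mul_le_mul_of_nonneg_right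
        (norm_one_sub_pow_le (hC.norm_average_le hh hc) r) (norm_nonneg _))
    have h4 : (1 + C) ^ r ≤ (1 + C) ^ (r + 1) := pow_le_pow_right₀ (by linarith) (by omega)
    calc X.discreteNrm N x (u - (F ^ (r + 1)) u)
        ≤ r * (C * (1 + δ / h) * (1 + C) ^ r) * ‖u‖ +
            C * (1 + δ / h) * ((1 + C) ^ r * ‖u‖) :=
          h1.trans (add_le_add ih (h2.trans (by gcongr)))
      _ = (r + 1) * (C * (1 + δ / h) * (1 + C) ^ r) * ‖u‖ := by ring
      _ ≤ (r + 1) * (C * (1 + δ / h) * (1 + C) ^ (r + 1)) * ‖u‖ := by gcongr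
      _ = _ := by push_cast; ring

end BanachFunctionLattice

/-! ### From absolute continuity to indefinite integrals. -/

namespace IsPrimitive

theorem deriv_eq {u v : ℝ → ℂ} (h : IsPrimitive u v) (hv : Continuous v) : deriv u = v := by
  ext x
  have e : u = fun x => u 0 + ∫ t in (0 : ℝ)..x, v t := by
    ext x; rw [← h 0 x]; ring
  rw [e, deriv_const_add]
  exact (intervalIntegral.integral_hasDerivAt_right (hv.intervalIntegrable 0 x)
    (hv.stronglyMeasurableAtFilter _ _) hv.continuousAt).deriv

end IsPrimitive

namespace AbsolutelyContinuousOnInterval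

theorem comp_lipschitz {f : ℝ → ℂ} {g : ℂ → ℝ} (hg : LipschitzWith 1 g) {a b : ℝ}
    (hf : AbsolutelyContinuousOnInterval f a b) :
    AbsolutelyContinuousOnInterval (fun x => g (f x)) a b := by
  rw [absolutelyContinuousOnInterval_iff] at hf ⊢
  intro ε hε
  obtain ⟨δ, hδ, H⟩ := hf ε hε
  refine ⟨δ, hδ, fun E hE hE' => lt_of_le_of_lt (Finset.sum_le_sum fun i _ => ?_) (H E hE hE')⟩
  simpa using hg.dist_le_mul (f (E.2 i).1) (f (E.2 i).2)

theorem re {f : ℝ → ℂ} {a b : ℝ} (hf : AbsolutelyContinuousOnInterval f a b) :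
    AbsolutelyContinuousOnInterval (fun x => (f x).re) a b :=
  hf.comp_lipschitz (LipschitzWith.of_dist_le_mul fun z w => by
    simpa [dist_eq_norm] using Complex.abs_re_le_norm (z - w))

theorem im {f : ℝ → ℂ} {a b : ℝ} (hf : AbsolutelyContinuousOnInterval f a b) :
    AbsolutelyContinuousOnInterval (fun x => (f x).im) a b :=
  hf.comp_lipschitz (LipschitzWith.of_dist_le_mul fun z w => by
    simpa [dist_eq_norm] using Complex.abs_im_le_norm (z - w))

theorem ae_hasDerivAt_complex {f : ℝ → ℂ} {a b : ℝ} (hf : AbsolutelyContinuousOnInterval f a b) :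
    ∀ᵐ x, x ∈ uIcc a b → HasDerivAt f
      (((deriv (fun x => (f x).re) x : ℝ) : ℂ) +
        ((deriv (fun x => (f x).im) x : ℝ) : ℂ) * Complex.I) x := by
  filter_upwards [hf.re.ae_differentiableAt, hf.im.ae_differentiableAt] with x h1 h2 hx
  have h := ((h1 hx).hasDerivAt.ofReal_comp).add
    ((h2 hx).hasDerivAt.ofReal_comp.mul_const Complex.I)
  refine h.congr_of_eventuallyEq (Eventually.of_forall fun y => ?_)
  exact (Complex.re_add_im (f y)).symm

/-- The fundamental theorem for absolutely continuous functions is applied to the real and imaginary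
parts, whose derivatives recombine almost everywhere. -/
theorem isPrimitive_deriv {f : ℝ → ℂ} (hf : ∀ a b, AbsolutelyContinuousOnInterval f a b) :
    IsPrimitive f (deriv f) := by
  intro a b
  have e : ∫ t in a..b, deriv f t = ∫ t in a..b,
      (((deriv (fun x => (f x).re) t : ℝ) : ℂ) +
        ((deriv (fun x => (f x).im) t : ℝ) : ℂ) * Complex.I) := by
    refine intervalIntegral.integral_congr_ae ?_
    filter_upwards [(hf a b).ae_hasDerivAt_complex] with x hx hxab
    exact (hx (uIoc_subset_uIcc hxab)).deriv
  have i1 := (hf a b).re.intervalIntegrable_deriv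
  have i2 := (hf a b).im.intervalIntegrable_deriv
  have j1 : IntervalIntegrable (fun t => ((deriv (fun x => (f x).re) t : ℝ) : ℂ)) volume a b :=
    ⟨i1.1.ofReal, i1.2.ofReal⟩
  have j2 : IntervalIntegrable (fun t => ((deriv (fun x => (f x).im) t : ℝ) : ℂ)) volume a b :=
    ⟨i2.1.ofReal, i2.2.ofReal⟩
  rw [e, intervalIntegral.integral_add j1 (j2.mul_const _),
    intervalIntegral.integral_mul_const, intervalIntegral.integral_ofReal,
    intervalIntegral.integral_ofReal, (hf a b).re.integral_deriv_eq_sub,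
    (hf a b).im.integral_deriv_eq_sub]
  apply Complex.ext <;> simp

theorem ae_differentiableAt_complex {f : ℝ → ℂ}
    (hf : ∀ a b, AbsolutelyContinuousOnInterval f a b) : ∀ᵐ x, DifferentiableAt ℝ f x := by
  have h : ∀ n : ℕ, ∀ᵐ x, x ∈ uIcc (-(n : ℝ)) n → DifferentiableAt ℝ f x := fun n => by
    filter_upwards [(hf (-(n : ℝ)) n).ae_hasDerivAt_complex] with x hx hxn
    exact (hx hxn).differentiableAt
  filter_upwards [ae_all_iff.2 h] with x hx
  obtain ⟨n, hn⟩ := exists_nat_ge |x|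
  refine hx n ?_
  rw [uIcc_of_le (by linarith [abs_nonneg x])]
  exact abs_le.1 hn

end AbsolutelyContinuousOnInterval

namespace BanachFunctionLattice

variable {X : BanachFunctionLattice} {C : ℝ}

theorem MemSobolev.isPrimitive {i : ℕ} {φ : ℝ → ℂ} (h : X.MemSobolev (i + 1) φ) :
    IsPrimitive (iteratedDeriv i φ) (iteratedDeriv (i + 1) φ) := by
  rw [iteratedDeriv_succ]
  exact AbsolutelyContinuousOnInterval.isPrimitive_deriv h.2.1

/-- The top derivatives exist only almost everywhere, so they are additive only almost everywhere;
the norm does not see the difference. -/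
theorem MemSobolev.nrm_iteratedDeriv_le {s : ℕ} (hs : 1 ≤ s) {φ ψ : ℝ → ℂ}
    (hφ : X.MemSobolev s φ) (hψ : X.MemSobolev s ψ) (hd : X.MemSobolev s (φ - ψ)) :
    X.nrm (iteratedDeriv s φ) ≤
      X.nrm (iteratedDeriv s ψ) + X.nrm (iteratedDeriv s (φ - ψ)) := by
  obtain ⟨s, rfl⟩ := Nat.exists_eq_add_of_le' hs
  have e : iteratedDeriv s (φ - ψ) = iteratedDeriv s φ - iteratedDeriv s ψ := by
    ext x
    exact iteratedDeriv_sub hφ.1.contDiffAt hψ.1.contDiffAt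
  have hae : ∀ᵐ x, iteratedDeriv (s + 1) φ x =
      iteratedDeriv (s + 1) ψ x + iteratedDeriv (s + 1) (φ - ψ) x := by
    filter_upwards [AbsolutelyContinuousOnInterval.ae_differentiableAt_complex hφ.2.1,
      AbsolutelyContinuousOnInterval.ae_differentiableAt_complex hψ.2.1] with x h1 h2
    rw [iteratedDeriv_succ, iteratedDeriv_succ, iteratedDeriv_succ, e]
    have := (h1.hasDerivAt.sub h2.hasDerivAt).deriv
    simp only [Nat.add_sub_cancel] at this
    rw [this]
    ring
  let u := toElem _ hφ.2.2
  let v := toElem _ hψ.2.2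
  let w := toElem _ hd.2.2
  have h1 : ‖u‖ = ‖v + w‖ := Elem.norm_eq_of_ae_eq hae
  exact h1.trans_le (norm_add_le v w)

/-! ### Jackson's theorem and approximation controlled by Steklov differences. -/

theorem isTrigPoly_sub_pow {n : ℕ} {S : X.Elem →L[ℂ] X.Elem} (hS : ∀ u, IsTrigPoly n (S u))
    (k : ℕ) (u : X.Elem) : IsTrigPoly n (u - ((1 - S) ^ k) u : X.Elem) := by
  induction k with
  | zero =>
    rw [pow_zero]
    convert IsTrigPoly.zero n using 1
    exact sub_self _
  | succ k ih =>
    have e : (u - ((1 - S) ^ (k + 1)) u : X.Elem) =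
        (u - ((1 - S) ^ k) u) + S (((1 - S) ^ k) u) := by
      rw [pow_succ']
      change u - (((1 - S) ^ k) u - S (((1 - S) ^ k) u)) = _
      abel
    rw [e]
    exact ih.add (hS _)

theorem isTrigPoly_pow {n : ℕ} {S : X.Elem →L[ℂ] X.Elem}
    (hS : ∀ u : X.Elem, IsTrigPoly n u → IsTrigPoly n (S u)) (k : ℕ) {u : X.Elem}
    (hu : IsTrigPoly n u) : IsTrigPoly n ((S ^ k) u) := by
  induction k with
  | zero => exact hu
  | succ k ih => rw [pow_succ']; exact hS _ ih

/-- The Jackson parameter `n / 4 + 1` keeps the degree `4 * (n / 4)` at most `n` while remaining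
comparable to `n`. -/
theorem quarter_le (n : ℕ) : (n : ℝ) / 4 ≤ ((n / 4 + 1 : ℕ) : ℝ) := by
  have : n ≤ 4 * (n / 4 + 1) := by omega
  have : (n : ℝ) ≤ 4 * ((n / 4 + 1 : ℕ) : ℝ) := by exact_mod_cast this
  linarith

theorem WindowBound.isTrigPoly_jackson_quarter (hC : X.WindowBound C) (n : ℕ) (u : X.Elem) :
    IsTrigPoly n (hC.jackson (Nat.le_add_left 1 (n / 4)) u) :=
  (hC.isTrigPoly_jackson _ u).mono (by omega)

theorem WindowBound.norm_sub_jackson_quarter_le (hC : X.WindowBound C) {n : ℕ} (hn : 1 ≤ n)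
    {u v : X.Elem} (huv : IsPrimitive u v) :
    ‖(1 - hC.jackson (Nat.le_add_left 1 (n / 4))) u‖ ≤ C * (1024 * Real.pi ^ 4) / n * ‖v‖ := by
  have hC0 := hC.pos
  have hn0 : (0 : ℝ) < n := by exact_mod_cast hn
  refine (hC.norm_sub_jackson_le _ huv).trans (mul_le_mul_of_nonneg_right ?_ (norm_nonneg _))
  calc C * (256 * Real.pi ^ 4) / ((n / 4 + 1 : ℕ) : ℝ) ≤ C * (256 * Real.pi ^ 4) / (n / 4) := by
        gcongr; exact quarter_le n
    _ = _ := by field_simp; ring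

/-- Jackson's theorem with simultaneous approximation of the first derivative. -/
theorem WindowBound.exists_trig_approx (hC : X.WindowBound C) {s : ℕ} (hs : 1 ≤ s) :
    ∃ D > 0, ∀ n ≥ 1, ∀ u : ℕ → X.Elem, (∀ i < s, IsPrimitive (u i) (u (i + 1))) →
      ∃ T : ℕ → X.Elem, IsTrigPoly n (T 0) ∧ (∀ i < s, IsPrimitive (T i) (T (i + 1))) ∧
        iteratedDeriv s (T 0) = T s ∧
        ‖u 0 - T 0‖ ≤ D * ((n : ℝ)⁻¹) ^ s * ‖u s‖ ∧
        ‖u 1 - T 1‖ ≤ D * ((n : ℝ)⁻¹) ^ (s - 1) * ‖u s‖ ∧ ‖T s‖ ≤ D * ‖u s‖ := by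
  have hC0 := hC.pos
  set E := C * (1024 * Real.pi ^ 4) with hE
  set E' := 1 + C * (64 * Real.pi ^ 4) with hE'
  have hE0 : 0 < E := by positivity
  have hE1 : 0 < E' := by positivity
  refine ⟨E ^ s + E' * E ^ (s - 1) + (1 + E' ^ s), by positivity, fun n hn u hu => ?_⟩
  have hn0 : (0 : ℝ) < n := by exact_mod_cast hn
  set J := hC.jackson (Nat.le_add_left 1 (n / 4)) with hJ
  have hP : PreservesPrimitive (1 - J) :=
    PreservesPrimitive.one.sub (hC.preservesPrimitive_jackson _)
  have hJn : ‖J‖ ≤ C * (64 * Real.pi ^ 4) := hC.norm_jackson_le _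
  have hS : ∀ u v : X.Elem, IsPrimitive u v → ‖(1 - J) u‖ ≤ E / n * ‖v‖ := fun u v huv =>
    hC.norm_sub_jackson_quarter_le hn huv
  have hTp : ∀ i, IsTrigPoly n (u i - ((1 - J) ^ s) (u i) : X.Elem) := fun i =>
    isTrigPoly_sub_pow (hC.isTrigPoly_jackson_quarter n) s (u i)
  have hTc : ∀ i < s, IsPrimitive (u i - ((1 - J) ^ s) (u i) : X.Elem)
      (u (i + 1) - ((1 - J) ^ s) (u (i + 1)) : X.Elem) := fun i hi =>
    Elem.isPrimitive_sub (hu i hi) ((hP.pow s) _ _ (hu i hi))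
  -- The same operator acts on the whole chain, so the `i`-th derivative of the approximant
  -- approximates `u i`, with error `(1 - J)^s (u i)`.
  refine ⟨fun i => u i - ((1 - J) ^ s) (u i), hTp 0, hTc, ?_, ?_, ?_, ?_⟩
  · have : ∀ i ≤ s, iteratedDeriv i (u 0 - ((1 - J) ^ s) (u 0) : X.Elem) =
        (u i - ((1 - J) ^ s) (u i) : X.Elem) := by
      intro i
      induction i with
      | zero => intro _; exact iteratedDeriv_zero
      | succ i ih =>
        intro hi
        rw [iteratedDeriv_succ, ih (by omega)]
        exact (hTc i (by omega)).deriv_eq (hTp (i + 1)).continuous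
    exact this s le_rfl
  · rw [sub_sub_cancel]
    refine (norm_pow_apply_le_of_chain hP (by positivity) hS s u hu).trans ?_
    gcongr
    rw [div_eq_mul_inv, mul_pow]
    gcongr
    have : 0 ≤ E' * E ^ (s - 1) + (1 + E' ^ s) := by positivity
    linarith
  · rw [sub_sub_cancel]
    -- Only `s - 1` derivatives remain above `u 1`: one factor `1 - J` is merely bounded, the others
    -- each gain `1/n`.
    obtain ⟨k, rfl⟩ := Nat.exists_eq_add_of_le' hs
    have h1 := norm_pow_apply_le_of_chain hP (by positivity) hS k (fun i => u (i + 1))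
      fun i hi => hu (i + 1) (by omega)
    have h2 : ‖1 - J‖ ≤ E' := by simpa using norm_one_sub_pow_le hJn 1
    rw [pow_succ']
    calc ‖(1 - J) (((1 - J) ^ k) (u 1))‖ ≤ E' * ((E / n) ^ k * ‖u (k + 1)‖) :=
          (ContinuousLinearMap.le_opNorm _ _).trans
            (mul_le_mul h2 h1 (norm_nonneg _) hE1.le)
      _ = E' * E ^ k * ((n : ℝ)⁻¹) ^ k * ‖u (k + 1)‖ := by rw [div_eq_mul_inv, mul_pow]; ring
      _ ≤ _ := by
        rw [Nat.add_sub_cancel]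
        gcongr
        have : 0 ≤ E ^ (k + 1) + (1 + E' ^ (k + 1)) := by positivity
        linarith
  · calc ‖u s - ((1 - J) ^ s) (u s)‖ ≤ ‖u s‖ + E' ^ s * ‖u s‖ :=
          (norm_sub_le _ _).trans (by
            gcongr
            exact (ContinuousLinearMap.le_opNorm _ _).trans
              (mul_le_mul_of_nonneg_right (norm_one_sub_pow_le hJn s) (norm_nonneg _)))
      _ = (1 + E' ^ s) * ‖u s‖ := by ring
      _ ≤ _ := by
        have : 0 ≤ E ^ s + E' * E ^ (s - 1) := by positivity
        exact mul_le_mul_of_nonneg_right (by linarith) (norm_nonneg _)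

/-- `I - (I - L²)^s` is a sum of terms `L²(I - L²)^k`, and every `L²` gains one derivative at the
cost of `1/h`. -/
theorem WindowBound.exists_isPrimitive_sub_pow (hC : X.WindowBound C) {h c : ℝ} (hh : 0 < h)
    (hc : c ∈ Icc 0 (h / 2)) (s : ℕ) (u : X.Elem) :
    ∃ v : X.Elem, IsPrimitive
        (u - ((1 - hC.average hh hc * hC.average hh hc) ^ s) u : X.Elem) v ∧
      ‖v‖ ≤ s * (4 * C * (1 + C * C) ^ s) / h * ‖u‖ := by
  have hC0 := hC.pos
  set L := hC.average hh hc with hL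
  have hLn : ‖L * L‖ ≤ C * C := (norm_mul_le _ _).trans
    (mul_le_mul (hC.norm_average_le hh hc) (hC.norm_average_le hh hc) (norm_nonneg _) hC0.le)
  set P : X.Elem →L[ℂ] X.Elem := 1 - L * L with hP
  induction s with
  | zero =>
    refine ⟨0, ?_, by simp⟩
    have e : (u - (P ^ 0) u : X.Elem) = 0 := by rw [pow_zero]; exact sub_self u
    rw [e]
    exact Elem.isPrimitive_zero
  | succ s ih =>
    obtain ⟨v, hv, hvn⟩ := ih
    obtain ⟨w, hw, hwn⟩ := hC.exists_isPrimitive_average_sq hh hc ((P ^ s) u)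
    refine ⟨v + w, ?_, ?_⟩
    · have e : (u - (P ^ (s + 1)) u : X.Elem) =
          (u - (P ^ s) u) + L (L ((P ^ s) u)) := by
        rw [pow_succ']
        change u - ((P ^ s) u - L (L ((P ^ s) u))) = _
        abel
      rw [e]
      exact Elem.isPrimitive_add hv hw
    · have h1 : ‖(P ^ s) u‖ ≤ (1 + C * C) ^ s * ‖u‖ :=
        (ContinuousLinearMap.le_opNorm _ _).trans
          (mul_le_mul_of_nonneg_right (norm_one_sub_pow_le hLn s) (norm_nonneg _))
      have h2 : (1 + C * C) ^ s ≤ (1 + C * C) ^ (s + 1) :=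
        pow_le_pow_right₀ (by nlinarith) (by omega)
      calc ‖v + w‖ ≤ s * (4 * C * (1 + C * C) ^ s) / h * ‖u‖ +
            4 * C / h * ((1 + C * C) ^ s * ‖u‖) :=
          (norm_add_le _ _).trans (add_le_add hvn (hwn.trans (by gcongr)))
        _ = (s + 1) * (4 * C * (1 + C * C) ^ s) / h * ‖u‖ := by ring
        _ ≤ (s + 1) * (4 * C * (1 + C * C) ^ (s + 1)) / h * ‖u‖ := by gcongr
        _ = _ := by push_cast; ring

/-- One step of improving a trigonometric approximation. -/
theorem WindowBound.exists_trig_improve (hC : X.WindowBound C) (s : ℕ) :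
    ∃ C₁ > 0, ∃ C₂ > 0, ∀ n : ℕ, n ≥ 1 → ∀ (h c : ℝ) (hh : 0 < h) (hc : c ∈ Icc 0 (h / 2))
      (f T : X.Elem),
      IsTrigPoly n T → ∃ T' : X.Elem, IsTrigPoly n T' ∧
        ‖f - T'‖ ≤ C₁ * ‖((1 - hC.average hh hc) ^ s) f‖ + C₂ / (n * h) * ‖f - T‖ := by
  have hC0 := hC.pos
  refine ⟨(1 + C) ^ s, by positivity,
    C * (1024 * Real.pi ^ 4) * ((s + 1) * (4 * C * (1 + C * C) ^ s)), by positivity,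
    fun n hn h c hh hc f T hT => ?_⟩
  have hn0 : (0 : ℝ) < n := by exact_mod_cast hn
  set L := hC.average hh hc with hL
  set J := hC.jackson (Nat.le_add_left 1 (n / 4)) with hJ
  set P : X.Elem →L[ℂ] X.Elem := 1 - L * L with hP
  have hLT : ∀ u : X.Elem, IsTrigPoly n u → IsTrigPoly n (L u) := fun u hu =>
    hu.shiftedAverage h c
  have hPT : ∀ u : X.Elem, IsTrigPoly n u → IsTrigPoly n (P u) := fun u hu =>
    hu.sub (hLT _ (hLT _ hu))
  set u := f - T with hu
  obtain ⟨v, hv, hvn⟩ := hC.exists_isPrimitive_sub_pow hh hc s u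
  -- `(I - P^s) f` approximates `f`. Its part from `T` is already a trigonometric polynomial; its
  -- part from `u` is smooth, and `J` makes it one.
  refine ⟨T - (P ^ s) T + J (u - (P ^ s) u),
    (hT.sub (isTrigPoly_pow hPT s hT)).add (hC.isTrigPoly_jackson_quarter n _), ?_⟩
  have e : f - (T - (P ^ s) T + J (u - (P ^ s) u)) =
      (P ^ s) f + (1 - J) (u - (P ^ s) u) := by
    have e1 : (P ^ s) f = (P ^ s) T + (P ^ s) u := by
      rw [← map_add, hu, add_sub_cancel]
    have e2 : (1 - J) (u - (P ^ s) u) = (u - (P ^ s) u) - J (u - (P ^ s) u) := rfl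
    rw [e1, e2, hu]
    abel
  have h1 : ‖(P ^ s) f‖ ≤ (1 + C) ^ s * ‖((1 - L) ^ s) f‖ := by
    -- Squaring `L` for smoothness is harmless: `I - L² = (I + L)(I - L)` brings back the given
    -- difference.
    have e1 : P ^ s = (1 + L) ^ s * (1 - L) ^ s := by
      have hcomm : Commute (1 + L) (1 - L) :=
        ((Commute.one_left _).add_left ((Commute.one_right L).sub_right (Commute.refl L)))
      rw [← hcomm.mul_pow, hP]
      congr 1
      noncomm_ring
    have h2 : ‖(1 + L) ^ s‖ ≤ (1 + C) ^ s := by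
      have := norm_one_sub_pow_le (T := -L) (C := C)
        (by rw [norm_neg]; exact hC.norm_average_le hh hc) s
      rwa [sub_neg_eq_add] at this
    rw [e1]
    change ‖((1 + L) ^ s) (((1 - L) ^ s) f)‖ ≤ _
    exact (ContinuousLinearMap.le_opNorm _ _).trans
      (mul_le_mul_of_nonneg_right h2 (norm_nonneg _))
  rw [e]
  refine (norm_add_le _ _).trans (add_le_add h1 ?_)
  refine (hC.norm_sub_jackson_quarter_le hn hv).trans ?_
  calc C * (1024 * Real.pi ^ 4) / n * ‖v‖
      ≤ C * (1024 * Real.pi ^ 4) / n * ((s + 1) * (4 * C * (1 + C * C) ^ s) / h * ‖u‖) := by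
        gcongr
        refine hvn.trans ?_
        gcongr
        linarith
    _ = _ := by field_simp

/-- The error of best approximation by trigonometric polynomials of degree `n` is bounded by the
Steklov differences of `f` of step at least a multiple of `1 / n`. -/
theorem WindowBound.exists_trig_near_best (hC : X.WindowBound C) (s : ℕ) :
    ∃ C₁ > 0, ∃ C₂ > 0, ∀ n : ℕ, n ≥ 1 → ∀ (h c : ℝ) (hh : 0 < h) (hc : c ∈ Icc 0 (h / 2)),
      C₂ ≤ n * h → ∀ f : X.Elem, ∀ ε > 0, ∃ T : X.Elem, IsTrigPoly n T ∧
        ‖f - T‖ ≤ C₁ * ‖((1 - hC.average hh hc) ^ s) f‖ + ε := by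
  obtain ⟨C₁, hC₁, C₂, hC₂, H⟩ := hC.exists_trig_improve s
  refine ⟨2 * C₁, by positivity, 2 * C₂, by positivity, fun n hn h c hh hc hnh f ε hε => ?_⟩
  set Ω := ‖((1 - hC.average hh hc) ^ s) f‖ with hΩ
  have hΩ0 : 0 ≤ Ω := norm_nonneg _
  have hn0 : (0 : ℝ) < n := by exact_mod_cast hn
  have hq : C₂ / (n * h) ≤ 1 / 2 := by
    rw [div_le_div_iff₀ (by positivity) two_pos]
    linarith
  -- With `2 * C₂ ≤ n * h` every improvement halves the excess error; the iteration starts from the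
  -- zero polynomial.
  have key : ∀ j : ℕ, ∃ T : X.Elem, IsTrigPoly n T ∧
      ‖f - T‖ ≤ 2 * C₁ * Ω + (1 / 2) ^ j * ‖f‖ := by
    intro j
    induction j with
    | zero =>
      refine ⟨0, IsTrigPoly.zero n, ?_⟩
      rw [sub_zero, pow_zero, one_mul]
      have : 0 ≤ 2 * C₁ * Ω := by positivity
      linarith
    | succ j ih =>
      obtain ⟨T, hT, hTn⟩ := ih
      obtain ⟨T', hT', hTn'⟩ := H n hn h c hh hc f T hT
      refine ⟨T', hT', hTn'.trans ?_⟩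
      calc C₁ * Ω + C₂ / (n * h) * ‖f - T‖
          ≤ C₁ * Ω + 1 / 2 * (2 * C₁ * Ω + (1 / 2) ^ j * ‖f‖) := by gcongr
        _ = _ := by ring
  have hlim : Tendsto (fun j : ℕ => (1 / 2 : ℝ) ^ j * ‖f‖) atTop (𝓝 (0 * ‖f‖)) :=
    (tendsto_pow_atTop_nhds_zero_of_lt_one (by norm_num) (by norm_num)).mul_const _
  rw [zero_mul] at hlim
  obtain ⟨j, hj⟩ := (hlim.eventually (gt_mem_nhds hε)).exists
  obtain ⟨T, hT, hTn⟩ := key j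
  exact ⟨T, hT, by linarith⟩

theorem rpow_neg_le_of_div_le {a b K α : ℝ} (hα : 0 < α) (hb : 0 < b) (hK : 0 < K)
    (h : b ≤ K * a) : a ^ (-α) ≤ K ^ α * b ^ (-α) := by
  have h1 : b / K ≤ a := by rw [div_le_iff₀ hK]; linarith
  calc a ^ (-α) ≤ (b / K) ^ (-α) :=
        Real.rpow_le_rpow_of_nonpos (by positivity) h1 (by linarith)
    _ = K ^ α * b ^ (-α) := by
        rw [Real.div_rpow hb.le hK.le, Real.rpow_neg hK.le, div_inv_eq_mul, mul_comm]

/-- Near-best approximation needs degree times step to be large, but their product is `γ` for step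
`γ / n` and degree `n`. So step `γ / p` is paired with degree `K * p` for a fixed `K`, with `p = n /
K`; passing from `p` to `n` costs a constant. -/
theorem WindowBound.exists_trig_rate (hC : X.WindowBound C) (s : ℕ) {γ α M : ℝ} (hγ : 0 < γ)
    (hα : 0 < α) {n₀ : ℕ} {f : X.Elem}
    (H : ∀ n : ℕ, n₀ ≤ n → 1 ≤ n → ∃ (hh : 0 < γ / n) (hc : γ / n / 2 ∈ Icc 0 (γ / n / 2)),
      ‖((1 - hC.average hh hc) ^ s) f‖ ≤ M * (n : ℝ) ^ (-α)) :
    ∃ M', ∃ n₁ : ℕ, ∀ n ≥ n₁, ∃ T : X.Elem, IsTrigPoly n T ∧ ‖f - T‖ ≤ M' * (n : ℝ) ^ (-α) := by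
  obtain ⟨C₁, hC₁, C₂, hC₂, H'⟩ := hC.exists_trig_near_best (X := X) s
  obtain ⟨k, hk⟩ := exists_nat_ge (C₂ / γ)
  set K := k + 1 with hKdef
  have hK : C₂ ≤ K * γ := by
    rw [div_le_iff₀ hγ] at hk
    rw [hKdef]
    push_cast
    linarith
  have hK0 : (0 : ℝ) < K := by rw [hKdef]; positivity
  refine ⟨(C₁ * |M| + 1) * (2 * K) ^ α, K * (n₀ + 1), fun n hn => ?_⟩
  set p := n / K with hp
  have hp1 : n₀ + 1 ≤ p := by
    rw [hp, Nat.le_div_iff_mul_le (by omega)]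
    linarith
  have hp0 : (0 : ℝ) < p := by exact_mod_cast (by omega : 0 < p)
  have hKp : K * p ≤ n := Nat.mul_div_le n K
  have hn2 : n ≤ 2 * K * p := by
    have h1 : n < K * (p + 1) := by
      have := Nat.lt_mul_div_succ n (show 0 < K by omega)
      simpa [hp] using this
    have h2 : K * 1 ≤ K * p := Nat.mul_le_mul_left K (by omega)
    nlinarith
  have hn0 : (0 : ℝ) < n := by
    have : 0 < K * p := Nat.mul_pos (by omega) (by omega)
    exact_mod_cast lt_of_lt_of_le this hKp
  obtain ⟨hh, hc, hM⟩ := H p (by omega) (by omega)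
  have hp' : 0 < (p : ℝ) ^ (-α) := Real.rpow_pos_of_pos hp0 _
  obtain ⟨T, hT, hTn⟩ := H' (K * p) (Nat.mul_pos (by omega) (by omega)) (γ / p) _ hh hc
    (by push_cast; field_simp; linarith) f _ hp'
  refine ⟨T, hT.mono hKp, hTn.trans ?_⟩
  have hr : (p : ℝ) ^ (-α) ≤ (2 * K) ^ α * (n : ℝ) ^ (-α) :=
    rpow_neg_le_of_div_le hα hn0 (by positivity) (by exact_mod_cast hn2)
  calc C₁ * ‖((1 - hC.average hh hc) ^ s) f‖ + (p : ℝ) ^ (-α)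
      ≤ C₁ * (|M| * (p : ℝ) ^ (-α)) + (p : ℝ) ^ (-α) := by
        gcongr
        exact hM.trans (by gcongr; exact le_abs_self M)
    _ = (C₁ * |M| + 1) * (p : ℝ) ^ (-α) := by ring
    _ ≤ (C₁ * |M| + 1) * ((2 * K) ^ α * (n : ℝ) ^ (-α)) := by gcongr
    _ = _ := by ring

end BanachFunctionLattice

/-! ### Growth of derivatives by telescoping, and rates as explicit bounds. -/

/-- A telescoping argument: if elements `φ n` approximate to order `n ^ (-α)` (with errors `e n`)
and a functional `a` of order `s` obeys a Bernstein inequality, then `a n = O(n ^ (s - α))`. -/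
theorem exists_growth_of_bernstein {a e : ℕ → ℝ} {B α M : ℝ} {s n₀ : ℕ} (hB : 0 ≤ B) (hα : 0 < α)
    (hαs : α < s) (hn₀ : 1 ≤ n₀) (he : ∀ n ≥ n₀, e n ≤ M * (n : ℝ) ^ (-α))
    (H : ∀ p n, n₀ ≤ p → p ≤ n → a n ≤ a p + (B * n) ^ s * (e n + e p)) :
    ∃ M' ≥ 0, ∀ n ≥ n₀, a n ≤ M' * (n : ℝ) ^ ((s : ℝ) - α) := by
  set c := B ^ s * (|M| * (1 + 3 ^ α)) with hc
  have hc0 : 0 ≤ c := by positivity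
  have hβ : 0 < (s : ℝ) - α := by linarith
  -- Halving `n` shrinks `n ^ (s - α)` by `q < 1`, as `α < s`. Adding `c / (1 - q)` makes `M' * q +
  -- c ≤ M'`, which closes the induction; the sum in `M'` covers `n < 2 * n₀`.
  set q : ℝ := (1 / 2) ^ ((s : ℝ) - α) with hq
  have hq1 : q < 1 := Real.rpow_lt_one (by norm_num) (by norm_num) hβ
  have hq0 : 0 ≤ 1 - q := by linarith
  set M' := (∑ i ∈ Finset.range (2 * n₀), |a i|) + c / (1 - q) with hM'
  have hS : 0 ≤ ∑ i ∈ Finset.range (2 * n₀), |a i| := Finset.sum_nonneg fun _ _ => abs_nonneg _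
  have hM'0 : 0 ≤ M' := by positivity
  have hMq : M' * q + c ≤ M' := by
    have : c ≤ M' * (1 - q) := by
      rw [← div_le_iff₀ (by linarith)]
      linarith
    linarith
  refine ⟨M', hM'0, fun n => ?_⟩
  induction n using Nat.strong_induction_on with
  | _ n ih =>
    intro hn
    have hn1 : (1 : ℝ) ≤ n := by exact_mod_cast hn₀.trans hn
    have hn0 : (0 : ℝ) < n := by linarith
    rcases lt_or_ge n (2 * n₀) with hlt | hge
    · have h1 : |a n| ≤ ∑ i ∈ Finset.range (2 * n₀), |a i| :=
        Finset.single_le_sum (f := fun i => |a i|) (fun _ _ => abs_nonneg _)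
          (Finset.mem_range.2 hlt)
      have h2 : 0 ≤ c / (1 - q) := by positivity
      have h3 : (1 : ℝ) ≤ (n : ℝ) ^ ((s : ℝ) - α) := Real.one_le_rpow hn1 hβ.le
      calc a n ≤ M' := (le_abs_self _).trans (by linarith)
        _ ≤ M' * (n : ℝ) ^ ((s : ℝ) - α) := le_mul_of_one_le_right hM'0 h3
    -- Rounded down, yet `n ≤ 3 * p` since `n ≥ 2`; hence the factor `3 ^ α`.
    · set p := n / 2 with hp
      have hpn : n₀ ≤ p := by omega
      have hp0 : (0 : ℝ) < p := by exact_mod_cast (by omega : 0 < p)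
      have hp2 : (p : ℝ) ≤ 1 / 2 * n := by
        have : 2 * p ≤ n := by omega
        have : 2 * (p : ℝ) ≤ n := by exact_mod_cast this
        linarith
      have hp3 : (n : ℝ) ≤ 3 * p := by
        have : n ≤ 3 * p := by omega
        exact_mod_cast this
      have h1 : (p : ℝ) ^ (-α) ≤ 3 ^ α * (n : ℝ) ^ (-α) := by
        calc (p : ℝ) ^ (-α) ≤ (n / 3 : ℝ) ^ (-α) :=
              Real.rpow_le_rpow_of_nonpos (by positivity) (by linarith) (by linarith)
          _ = 3 ^ α * (n : ℝ) ^ (-α) := by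
              rw [Real.div_rpow hn0.le (by norm_num), Real.rpow_neg (by norm_num : (0 : ℝ) ≤ 3),
                div_inv_eq_mul, mul_comm]
      have h2 : (p : ℝ) ^ ((s : ℝ) - α) ≤ q * (n : ℝ) ^ ((s : ℝ) - α) := by
        rw [hq, ← Real.mul_rpow (by norm_num) hn0.le]
        exact Real.rpow_le_rpow hp0.le hp2 hβ.le
      have h3 : (n : ℝ) ^ s * (n : ℝ) ^ (-α) = (n : ℝ) ^ ((s : ℝ) - α) := by
        rw [← Real.rpow_natCast, ← Real.rpow_add hn0, sub_eq_add_neg]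
      have hnα : 0 < (n : ℝ) ^ (-α) := Real.rpow_pos_of_pos hn0 _
      have hpα : 0 < (p : ℝ) ^ (-α) := Real.rpow_pos_of_pos hp0 _
      have h4 : e n + e p ≤ |M| * (1 + 3 ^ α) * (n : ℝ) ^ (-α) := by
        have e1 : e n ≤ |M| * (n : ℝ) ^ (-α) := (he n hn).trans (by gcongr; exact le_abs_self M)
        have e2 : e p ≤ |M| * (3 ^ α * (n : ℝ) ^ (-α)) :=
          (he p hpn).trans (mul_le_mul (le_abs_self M) h1 hpα.le (abs_nonneg M))
        linarith
      calc a n ≤ a p + (B * n) ^ s * (e n + e p) := H p n hpn (by omega)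
        _ ≤ M' * (q * (n : ℝ) ^ ((s : ℝ) - α)) +
            (B * n) ^ s * (|M| * (1 + 3 ^ α) * (n : ℝ) ^ (-α)) := by
          refine add_le_add ((ih p (by omega) hpn).trans ?_) ?_ <;> gcongr
        _ = (M' * q + c) * (n : ℝ) ^ ((s : ℝ) - α) := by rw [← h3, hc, mul_pow]; ring
        _ ≤ M' * (n : ℝ) ^ ((s : ℝ) - α) := by gcongr

theorem isBigO_rpow_iff {g : ℕ → ℝ} (hg : ∀ n ≥ 1, 0 ≤ g n) (α : ℝ) :
    g =O[atTop] (fun n : ℕ => (n : ℝ) ^ (-α)) ↔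
      ∃ M, ∃ n₀ ≥ 1, ∀ n ≥ n₀, g n ≤ M * (n : ℝ) ^ (-α) := by
  have hpos : ∀ n : ℕ, 0 ≤ (n : ℝ) ^ (-α) := fun n => Real.rpow_nonneg (Nat.cast_nonneg n) _
  constructor
  · intro h
    obtain ⟨M, hM⟩ := h.bound
    obtain ⟨n₀, hn₀⟩ := eventually_atTop.1 hM
    refine ⟨M, max n₀ 1, le_max_right _ _, fun n hn => ?_⟩
    have := hn₀ n (le_of_max_le_left hn)
    rw [Real.norm_of_nonneg (hpos n)] at this
    exact (Real.le_norm_self _).trans this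
  · rintro ⟨M, n₀, h1, h⟩
    refine IsBigO.of_bound M (eventually_atTop.2 ⟨n₀, fun n hn => ?_⟩)
    rw [Real.norm_of_nonneg (hpos n), Real.norm_of_nonneg (hg n (h1.trans hn))]
    exact h n hn

theorem rpow_neg_natCast_eq (n s : ℕ) : (n : ℝ) ^ (-(s : ℝ)) = ((n : ℝ)⁻¹) ^ s := by
  rw [Real.rpow_neg (Nat.cast_nonneg n), Real.rpow_natCast, inv_pow]

theorem inv_pow_mul_rpow {n : ℕ} (hn : 1 ≤ n) (s : ℕ) (α : ℝ) :
    ((n : ℝ)⁻¹) ^ s * (n : ℝ) ^ ((s : ℝ) - α) = (n : ℝ) ^ (-α) := by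
  have hn0 : (0 : ℝ) < n := by exact_mod_cast hn
  rw [← rpow_neg_natCast_eq, ← Real.rpow_add hn0]
  congr 1
  ring

/-! ### The two implications for an abstract sampling operator. -/

namespace BanachFunctionLattice

variable {X : BanachFunctionLattice} {C : ℝ}

/-- Packages the derivatives as elements of `X`; entries beyond `s` are set to zero and carry no
information. -/
theorem exists_chain {s : ℕ} {φ : ℝ → ℂ} (h : ∀ i ≤ s, iteratedDeriv i φ ∈ X.carrier)
    (hp : ∀ i < s, IsPrimitive (iteratedDeriv i φ) (iteratedDeriv (i + 1) φ)) :
    ∃ u : ℕ → X.Elem, (u 0 : ℝ → ℂ) = φ ∧ (∀ i < s, IsPrimitive (u i) (u (i + 1))) ∧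
      ‖u s‖ = X.nrm (iteratedDeriv s φ) := by
  classical
  let u : ℕ → X.Elem := fun i => if hi : i ≤ s then toElem _ (h i hi) else 0
  have hu : ∀ i ≤ s, (u i : ℝ → ℂ) = iteratedDeriv i φ := fun i hi => by simp [u, hi]
  refine ⟨u, by rw [hu 0 (Nat.zero_le s), iteratedDeriv_zero], fun i hi => ?_, ?_⟩
  · rw [hu i hi.le, hu (i + 1) hi]
    exact hp i hi
  · rw [norm_def, hu s le_rfl]

theorem exists_chain_of_isTrigPoly {n : ℕ} {T : ℝ → ℂ} (hT : IsTrigPoly n T) (s : ℕ) :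
    ∃ u : ℕ → X.Elem, (u 0 : ℝ → ℂ) = T ∧ (∀ i < s, IsPrimitive (u i) (u (i + 1))) ∧
      ‖u s‖ = X.nrm (iteratedDeriv s T) :=
  exists_chain (fun i _ => mem_of_isTrigPoly (hT.iteratedDeriv i)) fun i _ => by
    rw [iteratedDeriv_succ]
    exact (hT.iteratedDeriv i).isPrimitive_deriv

theorem IsBernsteinFamily.exists_chain {s : ℕ} {Φ : ℕ → Submodule ℂ (ℝ → ℂ)}
    (hΦ : X.IsBernsteinFamily s Φ) {n : ℕ} {φ : ℝ → ℂ} (hφ : φ ∈ Φ n) :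
    ∃ u : ℕ → X.Elem, (u 0 : ℝ → ℂ) = φ ∧ (∀ i < s, IsPrimitive (u i) (u (i + 1))) ∧
      ‖u s‖ = X.nrm (iteratedDeriv s φ) := by
  obtain ⟨B, _, H⟩ := hΦ.bernstein
  refine BanachFunctionLattice.exists_chain (fun i hi => ?_)
    fun i hi => MemSobolev.isPrimitive (H n φ hφ (i + 1) (by omega) hi).1
  rcases Nat.eq_zero_or_pos i with rfl | h
  · rw [iteratedDeriv_zero]; exact hΦ.le_carrier n hφ
  · exact (H n φ hφ i h hi).1.2.2

theorem WindowBound.oneSubPow_steklov (hC : X.WindowBound C) {h : ℝ} (hh : 0 < h)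
    (hc : (0 : ℝ) ∈ Icc 0 (h / 2)) (r : ℕ) (u : X.Elem) :
    oneSubPow (steklov h) r u = ((1 - hC.average hh hc) ^ r) u :=
  oneSubPow_eq _ _ (fun v => by rw [hC.coe_average, shiftedAverage_zero]) r u

theorem WindowBound.oneSubPow_steklovDot (hC : X.WindowBound C) {h : ℝ} (hh : 0 < h)
    (hc : h / 2 ∈ Icc 0 (h / 2)) (r : ℕ) (u : X.Elem) :
    oneSubPow (steklovDot h) r u = ((1 - hC.average hh hc) ^ r) u :=
  oneSubPow_eq _ _ (fun v => by rw [hC.coe_average, shiftedAverage_half]) r u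

/-- Sampling costs one derivative, so the bound of order `s` for `u 0` is joined by `δ` times the
bound of order `s - 1` for `u 1`. With `h` and `δ` of order `1/n` both terms are of order `n^{-s}`.
-/
theorem WindowBound.discreteNrm_pow_le (hC : X.WindowBound C) {N : ℕ} {x : ℕ → ℝ} {δ : ℝ}
    (hx : IsPartition N x δ) {h : ℝ} (hh : 0 < h) (hc : (0 : ℝ) ∈ Icc 0 (h / 2)) {r s : ℕ}
    (hs : 1 ≤ s) (hrs : s ≤ 2 * r) (u : ℕ → X.Elem)
    (hu : ∀ i < s, IsPrimitive (u i) (u (i + 1))) :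
    X.discreteNrm N x (((1 - hC.average hh hc) ^ r) (u 0)) ≤
      (1 + C) ^ r * (1 + C) ^ s * (h ^ s + C * δ * h ^ (s - 1)) * ‖u s‖ := by
  have hC0 := hC.pos
  have hδ := hx.delta_pos
  obtain ⟨k, rfl⟩ := Nat.exists_eq_add_of_le' hs
  have hP : PreservesPrimitive (1 - hC.average hh hc) :=
    PreservesPrimitive.one.sub (hC.preservesPrimitive_average hh hc)
  have h1 := hC.norm_pow_sub_average_le hh hc r (k + 1) hrs u hu
  have h2 := hC.norm_pow_sub_average_le hh hc r k (by omega) (fun i => u (i + 1))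
    fun i hi => hu (i + 1) (by omega)
  have h3 : (1 + C) ^ k ≤ (1 + C) ^ (k + 1) := pow_le_pow_right₀ (by linarith) (by omega)
  rw [Nat.add_sub_cancel]
  calc X.discreteNrm N x (((1 - hC.average hh hc) ^ r) (u 0))
      ≤ (1 + C) ^ r * (1 + C) ^ (k + 1) * h ^ (k + 1) * ‖u (k + 1)‖ +
          C * δ * ((1 + C) ^ r * (1 + C) ^ k * h ^ k * ‖u (k + 1)‖) :=
        (hC.discreteNrm_le hx ((hP.pow r) _ _ (hu 0 (by omega)))).trans
          (add_le_add h1 (by gcongr))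
    _ ≤ (1 + C) ^ r * (1 + C) ^ (k + 1) * h ^ (k + 1) * ‖u (k + 1)‖ +
          C * δ * ((1 + C) ^ r * (1 + C) ^ (k + 1) * h ^ k * ‖u (k + 1)‖) := by gcongr
    _ = _ := by ring

theorem half_step_mem {h : ℝ} (hh : 0 < h) : h / 2 ∈ Icc 0 (h / 2) := ⟨by positivity, le_rfl⟩

theorem zero_step_mem {h : ℝ} (hh : 0 < h) : (0 : ℝ) ∈ Icc 0 (h / 2) := ⟨le_rfl, by positivity⟩

theorem nrm_le_of_eq_add_sub {f a b c : ℝ → ℂ} (ha : a ∈ X.carrier) (hb : b ∈ X.carrier)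
    (hc : c ∈ X.carrier) (h : f = a + b - c) : X.nrm f ≤ X.nrm a + X.nrm b + X.nrm c := by
  subst h
  exact (norm_sub_le (toElem a ha + toElem b hb) (toElem c hc)).trans
    (add_le_add (norm_add_le _ _) le_rfl)

section

variable (hC : X.WindowBound C) {r s : ℕ} (hs : 1 ≤ s) (hrs : s ≤ 2 * r) {γ γ' : ℝ} (hγ : 0 < γ)
  (hγ' : 0 < γ') {m : ℕ → ℕ} {x : ℕ → ℕ → ℝ}
  (hx : ∀ n ≥ 1, IsPartition (m n) (x n) (γ' / n)) {G : ℕ → (ℝ → ℂ) → ℝ → ℂ}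
  (hGsub : ∀ n f g, G n (f - g) = G n f - G n g)
  (hGmem : ∀ n ≥ 1, ∀ f, G n f ∈ X.carrier) {K₁ K₂ K₃ : ℝ} (hK₁ : 0 < K₁) (hK₂ : 0 < K₂)
  (hK₃ : 0 < K₃)
  (hA1 : ∀ f ∈ X.carrier, ∀ n ≥ 1, X.nrm (G n f) ≤ K₁ * X.discreteNrm (m n) (x n) f)
  (hA2 : ∀ f ∈ X.carrier, ∀ n ≥ 1, K₂ * X.discreteNrm (m n) (x n) f ≤ X.nrm (G n f))
  (hA3 : ∀ n : ℕ, n ≥ 1 → ∀ T : ℝ → ℂ, IsTrigPoly n T →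
    X.nrm (T - G n T) ≤ K₃ * (n : ℝ) ^ (-(s : ℝ)) * X.nrm (iteratedDeriv s T))
  {α : ℝ} (hα : 0 < α) (hαs : α < s)

include hC hs hrs hγ hγ' hx hGsub hGmem hK₁ hK₃ hA1 hA3 hα hαs

/-- Smoothness of `f`, measured by averages, implies a rate of approximation by sampling. -/
theorem sampling_rate_of_smoothness (f : X.Elem) {M : ℝ} {n₀ : ℕ} (hn₀ : 1 ≤ n₀)
    (H : ∀ n ≥ n₀, X.discreteNrm (m n) (x n) (oneSubPow (steklov (γ / n)) r f) +
      X.nrm (oneSubPow (steklovDot (γ / n)) s f) ≤ M * (n : ℝ) ^ (-α)) :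
    ∃ M', ∃ n₁ ≥ 1, ∀ n ≥ n₁, X.nrm (f - G n f) ≤ M' * (n : ℝ) ^ (-α) := by
  have hC0 := hC.pos
  have hhn : ∀ n : ℕ, 1 ≤ n → 0 < γ / n := fun n hn => by
    have : (0 : ℝ) < n := by exact_mod_cast hn
    positivity
  have hLdot : ∀ n : ℕ, n₀ ≤ n → 1 ≤ n → ∃ (hh : 0 < γ / n) (hc : γ / n / 2 ∈ Icc 0 (γ / n / 2)),
      ‖((1 - hC.average hh hc) ^ s) f‖ ≤ M * (n : ℝ) ^ (-α) := fun n hn hn1 => by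
    refine ⟨hhn n hn1, half_step_mem (hhn n hn1), ?_⟩
    rw [norm_def, ← hC.oneSubPow_steklovDot]
    have h0 : 0 ≤ X.discreteNrm (m n) (x n) (oneSubPow (steklov (γ / n)) r f) :=
      discreteNrm_nonneg _ _ _
    linarith [H n hn]
  obtain ⟨M₁, n₁, hn₁⟩ := hC.exists_trig_rate s hγ hα hLdot
  choose! T hT hTn using hn₁
  set p₀ := max n₀ n₁ with hp₀
  have hp1 : 1 ≤ p₀ := hn₀.trans (le_max_left _ _)
  -- `T n - T p` has degree at most `n`, and through `f` its norm is at most the sum of the two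
  -- errors; Bernstein's inequality supplies the increment.
  obtain ⟨M₂, hM₂, hD⟩ := exists_growth_of_bernstein (a := fun n => X.nrm (iteratedDeriv s (T n)))
    (e := fun n => ‖f - T n‖) (B := 8 * Real.pi * C) (α := α) (M := M₁) (s := s) (n₀ := p₀)
    (by positivity) hα hαs hp1 (fun n hn => hTn n (le_of_max_le_right hn)) (fun p n hp hpn => by
      have hTp := (hT p (le_of_max_le_right hp)).mono hpn
      have hTn' := hT n ((le_of_max_le_right hp).trans hpn)
      have hd := hTn'.sub hTp
      have e : iteratedDeriv s (T n) =
          iteratedDeriv s (T p) + iteratedDeriv s (⇑(T n) - ⇑(T p)) := by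
        ext y
        rw [Pi.add_apply, iteratedDeriv_sub (hTn'.contDiff.contDiffAt.of_le le_top)
          (hTp.contDiff.contDiffAt.of_le le_top)]
        ring
      have h1 : X.nrm (iteratedDeriv s (T n)) ≤
          X.nrm (iteratedDeriv s (T p)) + X.nrm (iteratedDeriv s (⇑(T n) - ⇑(T p))) := by
        conv_lhs => rw [e]
        exact X.nrm_add_le _ (mem_of_isTrigPoly (hTp.iteratedDeriv s)) _
          (mem_of_isTrigPoly (hd.iteratedDeriv s))
      have h2 := hC.nrm_iteratedDeriv_le (hp1.trans (hp.trans hpn)) hd s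
      have h3 : X.nrm (⇑(T n) - ⇑(T p)) ≤ ‖f - T n‖ + ‖f - T p‖ := by
        change ‖T n - T p‖ ≤ _
        rw [← sub_sub_sub_cancel_left (T p) (T n) f, add_comm]
        exact norm_sub_le _ _
      calc X.nrm (iteratedDeriv s (T n))
          ≤ X.nrm (iteratedDeriv s (T p)) +
              (8 * Real.pi * C * n) ^ s * X.nrm (⇑(T n) - ⇑(T p)) := by linarith
        _ ≤ _ := by gcongr)
  set Q := (1 + C) ^ r * (1 + C) ^ s * (γ ^ s + C * γ' * γ ^ (s - 1)) with hQ
  set R := r * (C * (1 + γ' / γ) * (1 + C) ^ r) with hR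
  refine ⟨M₁ + K₃ * M₂ + K₁ * (M + Q * M₂ + R * M₁), p₀, hp1, fun n hn => ?_⟩
  have hn1 : 1 ≤ n := hp1.trans hn
  have hn0 : (0 : ℝ) < n := by exact_mod_cast hn1
  have hh := hhn n hn1
  have hTn' := hT n (le_of_max_le_right hn)
  have hfT := hTn n (le_of_max_le_right hn)
  have hTs := hD n hn
  set F : X.Elem →L[ℂ] X.Elem := 1 - hC.average hh (zero_step_mem hh) with hF
  obtain ⟨u, hu0, hup, hus⟩ := exists_chain_of_isTrigPoly (X := X) hTn' s
  have hsmall : ((n : ℝ)⁻¹) ^ s * X.nrm (iteratedDeriv s (T n)) ≤ M₂ * (n : ℝ) ^ (-α) := by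
    calc ((n : ℝ)⁻¹) ^ s * X.nrm (iteratedDeriv s (T n))
        ≤ ((n : ℝ)⁻¹) ^ s * (M₂ * (n : ℝ) ^ ((s : ℝ) - α)) := by gcongr
      _ = M₂ * (((n : ℝ)⁻¹) ^ s * (n : ℝ) ^ ((s : ℝ) - α)) := by ring
      _ = _ := by rw [inv_pow_mul_rpow hn1]
  have d1 : X.discreteNrm (m n) (x n) ((F ^ r) (T n)) ≤ Q * (M₂ * (n : ℝ) ^ (-α)) := by
    have h1 := hC.discreteNrm_pow_le (hx n hn1) hh (zero_step_mem hh) hs hrs u hup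
    have e : u 0 = T n := DFunLike.coe_injective hu0
    rw [e, hus] at h1
    refine h1.trans (le_trans (le_of_eq ?_)
      (mul_le_mul_of_nonneg_left hsmall (show 0 ≤ Q by positivity)))
    obtain ⟨k, rfl⟩ := Nat.exists_eq_add_of_le' hs
    rw [hQ, Nat.add_sub_cancel]
    simp only [div_eq_mul_inv, mul_pow]
    ring
  have d2 : X.discreteNrm (m n) (x n) (⇑(f - T n) - (F ^ r) (f - T n)) ≤ R * ‖f - T n‖ := by
    have h1 := hC.discreteNrm_sub_pow_le (hx n hn1) hh (zero_step_mem hh) r (f - T n)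
    rwa [div_div_div_cancel_right₀ hn0.ne'] at h1
  have d3 : X.discreteNrm (m n) (x n) ((F ^ r) (f - T n)) ≤
      M * (n : ℝ) ^ (-α) + Q * (M₂ * (n : ℝ) ^ (-α)) := by
    rw [map_sub, Elem.coe_sub]
    refine (discreteNrm_sub_le _ _ _ _).trans (add_le_add ?_ d1)
    rw [← hC.oneSubPow_steklov]
    have h0 : 0 ≤ X.nrm (oneSubPow (steklovDot (γ / n)) s f) := by
      rw [hC.oneSubPow_steklovDot hh (half_step_mem hh)]
      exact norm_nonneg (_ : X.Elem)
    linarith [H n (le_of_max_le_left hn)]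
  -- With `g = f - T n`, the samples of `g - F^r g` are controlled by `‖g‖`; those of `F^r g` by the
  -- hypothesis on `F^r f` and the smoothness of `T n`.
  have d4 : X.discreteNrm (m n) (x n) (⇑(f - T n)) ≤ (M + Q * M₂ + R * M₁) * (n : ℝ) ^ (-α) := by
    have hR0 : 0 ≤ R := by positivity
    have := mul_le_mul_of_nonneg_left hfT hR0
    have h1 := discreteNrm_le_sub_add (X := X) (m n) (x n) (⇑(f - T n)) ((F ^ r) (f - T n))
    linarith
  have hsub : X.nrm (f - G n f) ≤ X.nrm (⇑(f - T n)) + X.nrm (T n - G n (T n)) +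
      X.nrm (G n (⇑(f - T n))) := by
    refine nrm_le_of_eq_add_sub (Elem.mem _)
      (X.carrier.sub_mem (Elem.mem _) (hGmem n hn1 _)) (hGmem n hn1 _) ?_
    rw [Elem.coe_sub, hGsub]
    abel
  have a1 := hA1 _ (f - T n).mem n hn1
  have a3 := hA3 n hn1 (T n) hTn'
  rw [rpow_neg_natCast_eq, mul_assoc] at a3
  have a3' := a3.trans (mul_le_mul_of_nonneg_left hsmall hK₃.le)
  have a1' := a1.trans (mul_le_mul_of_nonneg_left d4 hK₁.le)
  have hfT' : X.nrm (⇑(f - T n)) ≤ M₁ * (n : ℝ) ^ (-α) := hfT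
  linarith

include hK₂ hA2

/-- A rate of approximation by sampling implies smoothness, measured by averages. -/
theorem smoothness_of_sampling_rate {Φ : ℕ → Submodule ℂ (ℝ → ℂ)} (hΦ : X.IsBernsteinFamily s Φ)
    (hGΦ : ∀ n ≥ 1, ∀ f, G n f ∈ Φ n) (f : X.Elem) {M : ℝ} {n₀ : ℕ} (hn₀ : 1 ≤ n₀)
    (H : ∀ n ≥ n₀, X.nrm (f - G n f) ≤ M * (n : ℝ) ^ (-α)) :
    ∃ M', ∃ n₁ ≥ 1, ∀ n ≥ n₁, X.discreteNrm (m n) (x n) (oneSubPow (steklov (γ / n)) r f) +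
      X.nrm (oneSubPow (steklovDot (γ / n)) s f) ≤ M' * (n : ℝ) ^ (-α) := by
  have hC0 := hC.pos
  obtain ⟨B, hB, hBern⟩ := hΦ.bernstein
  obtain ⟨M₂, hM₂, hD⟩ := exists_growth_of_bernstein
    (a := fun n => X.nrm (iteratedDeriv s (G n f)))
    (e := fun n => X.nrm (f - G n f)) (B := B) (α := α) (M := M) (s := s) (n₀ := n₀)
    hB.le hα hαs hn₀ H (fun p n hp hpn => by
      have hn1 : 1 ≤ n := hn₀.trans (hp.trans hpn)
      have hp' := hΦ.mono hpn (hGΦ p (hn₀.trans hp) f)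
      have hn' := hGΦ n hn1 f
      have hd := (Φ n).sub_mem hn' hp'
      have h1 := MemSobolev.nrm_iteratedDeriv_le hs (hBern n _ hn' s hs le_rfl).1
        (hBern n _ hp' s hs le_rfl).1 (hBern n _ hd s hs le_rfl).1
      have h2 := (hBern n _ hd s hs le_rfl).2
      have h3 : X.nrm (G n f - G p f) ≤ X.nrm (f - G n f) + X.nrm (f - G p f) := by
        have := norm_sub_le (f - toElem _ (hΦ.le_carrier n (hGΦ p (hn₀.trans hp) f |> hΦ.mono hpn)))
          (f - toElem _ (hΦ.le_carrier n hn'))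
        rw [sub_sub_sub_cancel_left] at this
        rw [add_comm]
        exact this
      calc X.nrm (iteratedDeriv s (G n f))
          ≤ X.nrm (iteratedDeriv s (G p f)) + (B * n) ^ s * X.nrm (G n f - G p f) := by linarith
        _ ≤ _ := by gcongr)
  obtain ⟨D, hD0, hJackson⟩ := hC.exists_trig_approx hs
  set Q := (1 + C) ^ r * (1 + C) ^ s * (γ ^ s + C * γ' * γ ^ (s - 1)) with hQ
  set R := r * (C * (1 + γ' / γ) * (1 + C) ^ r) with hR
  set P := D + K₃ * D + K₁ * (D + C * γ' * D) with hP
  refine ⟨(K₂⁻¹ * (P * M₂) + R * M + Q * M₂) + ((1 + C) ^ s * M + (C * γ) ^ s * M₂), n₀, hn₀,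
    fun n hn => ?_⟩
  have hn1 : 1 ≤ n := hn₀.trans hn
  have hn0 : (0 : ℝ) < n := by exact_mod_cast hn1
  have hh : 0 < γ / n := by positivity
  have hpart := hx n hn1
  have hφs := hD n hn
  obtain ⟨u, hu0, hup, hus⟩ := hΦ.exists_chain (hGΦ n hn1 f)
  rw [← hus] at hφs
  have hfφ : ‖f - u 0‖ ≤ M * (n : ℝ) ^ (-α) := by
    have := H n hn
    rw [← hu0] at this
    exact this
  have hsmall : ((n : ℝ)⁻¹) ^ s * ‖u s‖ ≤ M₂ * (n : ℝ) ^ (-α) := by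
    calc ((n : ℝ)⁻¹) ^ s * ‖u s‖
        ≤ ((n : ℝ)⁻¹) ^ s * (M₂ * (n : ℝ) ^ ((s : ℝ) - α)) := by gcongr
      _ = M₂ * (((n : ℝ)⁻¹) ^ s * (n : ℝ) ^ ((s : ℝ) - α)) := by ring
      _ = _ := by rw [inv_pow_mul_rpow hn1]
  have hpow : (n : ℝ)⁻¹ * ((n : ℝ)⁻¹) ^ (s - 1) = ((n : ℝ)⁻¹) ^ s := by
    rw [← pow_succ']; congr 1; omega
  obtain ⟨T, hT, hTc, hTs, hT0, hT1, hTsn⟩ := hJackson n hn1 u hup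
  -- Sampling `u 0 - T 0` costs one derivative; simultaneous approximation of `u 1` pays for it.
  have dT : X.discreteNrm (m n) (x n) (⇑(u 0 - T 0)) ≤
      (D + C * γ' * D) * (((n : ℝ)⁻¹) ^ s * ‖u s‖) := by
    calc X.discreteNrm (m n) (x n) (⇑(u 0 - T 0))
        ≤ ‖u 0 - T 0‖ + C * (γ' / n) * ‖u 1 - T 1‖ :=
          hC.discreteNrm_le hpart (Elem.isPrimitive_sub (hup 0 (by omega)) (hTc 0 (by omega)))
      _ ≤ D * ((n : ℝ)⁻¹) ^ s * ‖u s‖ +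
          C * (γ' / n) * (D * ((n : ℝ)⁻¹) ^ (s - 1) * ‖u s‖) := by gcongr
      _ = _ := by rw [← hpow, div_eq_mul_inv]; ring
  have hφG : X.nrm (u 0 - G n (u 0)) ≤ P * (((n : ℝ)⁻¹) ^ s * ‖u s‖) := by
    have hsub : X.nrm (u 0 - G n (u 0)) ≤ X.nrm (⇑(u 0 - T 0)) + X.nrm (T 0 - G n (T 0)) +
        X.nrm (G n (⇑(u 0 - T 0))) := by
      refine nrm_le_of_eq_add_sub (Elem.mem _)
        (X.carrier.sub_mem (Elem.mem _) (hGmem n hn1 _)) (hGmem n hn1 _) ?_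
      rw [Elem.coe_sub, hGsub]
      abel
    have a1 := (hA1 _ (u 0 - T 0).mem n hn1).trans (mul_le_mul_of_nonneg_left dT hK₁.le)
    have a3 := hA3 n hn1 (T 0) hT
    rw [rpow_neg_natCast_eq, hTs, mul_assoc] at a3
    have a3' : X.nrm (T 0 - G n (T 0)) ≤ K₃ * (((n : ℝ)⁻¹) ^ s * (D * ‖u s‖)) :=
      a3.trans (by gcongr; exact hTsn)
    have hT0' : X.nrm (⇑(u 0 - T 0)) ≤ D * ((n : ℝ)⁻¹) ^ s * ‖u s‖ := hT0
    calc X.nrm (u 0 - G n (u 0)) ≤ D * ((n : ℝ)⁻¹) ^ s * ‖u s‖ +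
          K₃ * (((n : ℝ)⁻¹) ^ s * (D * ‖u s‖)) +
          K₁ * ((D + C * γ' * D) * (((n : ℝ)⁻¹) ^ s * ‖u s‖)) := by linarith
      _ = _ := by rw [hP]; ring
  have dw : X.discreteNrm (m n) (x n) (⇑(f - u 0)) ≤
      K₂⁻¹ * (P * (M₂ * (n : ℝ) ^ (-α))) := by
    have a2 := hA2 _ (f - u 0).mem n hn1
    -- Here `u 0` is `G n f` itself, so (A2) bounds the samples of `f - u 0` by the error of `G n`
    -- on its own output.
    have e : G n (⇑(f - u 0)) = u 0 - G n (u 0) := by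
      rw [Elem.coe_sub, hGsub, hu0]
    rw [e] at a2
    rw [le_inv_mul_iff₀ hK₂]
    exact (a2.trans hφG).trans (mul_le_mul_of_nonneg_left hsmall (by positivity))
  have part1 : X.discreteNrm (m n) (x n) (oneSubPow (steklov (γ / n)) r f) ≤
      (K₂⁻¹ * (P * M₂) + R * M + Q * M₂) * (n : ℝ) ^ (-α) := by
    rw [hC.oneSubPow_steklov hh (zero_step_mem hh)]
    set F : X.Elem →L[ℂ] X.Elem := 1 - hC.average hh (zero_step_mem hh) with hF
    have d1 : X.discreteNrm (m n) (x n) ((F ^ r) (u 0)) ≤ Q * (M₂ * (n : ℝ) ^ (-α)) := by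
      have h1 := hC.discreteNrm_pow_le hpart hh (zero_step_mem hh) hs hrs u hup
      refine h1.trans (le_trans (le_of_eq ?_)
        (mul_le_mul_of_nonneg_left hsmall (show 0 ≤ Q by positivity)))
      rw [hQ, ← hpow]
      obtain ⟨k, rfl⟩ := Nat.exists_eq_add_of_le' hs
      rw [Nat.add_sub_cancel]
      simp only [div_eq_mul_inv, mul_pow]
      ring
    have d2 : X.discreteNrm (m n) (x n) (⇑(f - u 0) - (F ^ r) (f - u 0)) ≤ R * ‖f - u 0‖ := by
      have h1 := hC.discreteNrm_sub_pow_le hpart hh (zero_step_mem hh) r (f - u 0)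
      rwa [div_div_div_cancel_right₀ hn0.ne'] at h1
    have d3 : X.discreteNrm (m n) (x n) ((F ^ r) (f - u 0)) ≤
        X.discreteNrm (m n) (x n) (⇑(f - u 0)) +
          X.discreteNrm (m n) (x n) (⇑(f - u 0) - (F ^ r) (f - u 0)) := by
      have := discreteNrm_sub_le (X := X) (m n) (x n) (⇑(f - u 0))
        (⇑(f - u 0) - (F ^ r) (f - u 0))
      rwa [sub_sub_cancel] at this
    have d4 := discreteNrm_le_sub_add (X := X) (m n) (x n) ((F ^ r) f) ((F ^ r) (u 0))
    -- The comparison now runs backwards: samples of `f - u 0` are known, and they control those of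
    -- `F^r (f - u 0)` up to `‖f - u 0‖`.
    have e : (⇑((F ^ r) f) - (F ^ r) (u 0) : ℝ → ℂ) = (F ^ r) (f - u 0) := by
      rw [map_sub, Elem.coe_sub]
    rw [e] at d4
    have hR0 : 0 ≤ R := by positivity
    have := mul_le_mul_of_nonneg_left hfφ hR0
    linarith
  have part2 : X.nrm (oneSubPow (steklovDot (γ / n)) s f) ≤
      ((1 + C) ^ s * M + (C * γ) ^ s * M₂) * (n : ℝ) ^ (-α) := by
    rw [hC.oneSubPow_steklovDot hh (half_step_mem hh), ← norm_def]
    set F : X.Elem →L[ℂ] X.Elem := 1 - hC.average hh (half_step_mem hh) with hF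
    have e : (F ^ s) f = (F ^ s) (f - u 0) + (F ^ s) (u 0) := by rw [← map_add, sub_add_cancel]
    have h1 : ‖(F ^ s) (f - u 0)‖ ≤ (1 + C) ^ s * ‖f - u 0‖ :=
      (ContinuousLinearMap.le_opNorm _ _).trans (mul_le_mul_of_nonneg_right
        (norm_one_sub_pow_le (hC.norm_average_le _ _) s) (norm_nonneg _))
    have h2 := hC.norm_pow_sub_average_le_chain hh (half_step_mem hh) s u hup
    rw [e]
    calc ‖(F ^ s) (f - u 0) + (F ^ s) (u 0)‖
        ≤ (1 + C) ^ s * (M * (n : ℝ) ^ (-α)) + (C * (γ / n)) ^ s * ‖u s‖ :=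
          (norm_add_le _ _).trans (add_le_add (h1.trans (by gcongr)) h2)
      _ = (1 + C) ^ s * (M * (n : ℝ) ^ (-α)) + (C * γ) ^ s * (((n : ℝ)⁻¹) ^ s * ‖u s‖) := by
          rw [div_eq_mul_inv, ← mul_assoc C, mul_pow (C * γ)]; ring
      _ ≤ (1 + C) ^ s * (M * (n : ℝ) ^ (-α)) + (C * γ) ^ s * (M₂ * (n : ℝ) ^ (-α)) := by gcongr
      _ = _ := by ring
  linarith

end

end BanachFunctionLattice

/-! ### The equivalence for the given sampling operators. -/

theorem corollary3p2
    (X : BanachFunctionLattice) (hX : X.SteklovBounded)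
    (r s : ℕ) (hr : 1 ≤ r) (hs : 1 ≤ s) (hrs : s ≤ 2 * r)
    (Φ : ℕ → Submodule ℂ (ℝ → ℂ)) (hΦ : X.IsBernsteinFamily s Φ)
    (γ γ' : ℝ) (hγ : 0 < γ) (hγ' : 0 < γ')
    (m : ℕ → ℕ) (x : ℕ → ℕ → ℝ) (hx : IsNodeSystem γ γ' m x)
    (φ : ℕ → ℕ → ℝ → ℂ) (hφ : ∀ n ≥ 1, ∀ k < m n, φ n k ∈ Φ n)
    (hA1 : ∃ K₁ > 0, ∀ f ∈ X.carrier, ∀ n ≥ 1,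
      X.nrm (samplingOp (m n) (x n) (φ n) f) ≤ K₁ * X.discreteNrm (m n) (x n) f)
    (hA2 : ∃ K₂ > 0, ∀ f ∈ X.carrier, ∀ n ≥ 1,
      K₂ * X.discreteNrm (m n) (x n) f ≤ X.nrm (samplingOp (m n) (x n) (φ n) f))
    (hA3 : ∃ K₃ > 0, ∀ n : ℕ, n ≥ 1 → ∀ T : ℝ → ℂ, IsTrigPoly n T →
      X.nrm (T - samplingOp (m n) (x n) (φ n) T) ≤
        K₃ * (n : ℝ) ^ (-(s : ℝ)) * X.nrm (iteratedDeriv s T))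
    (f : ℝ → ℂ) (hf : f ∈ X.carrier) (α : ℝ) (hα : 0 < α) (hαs : α < s) :
    (fun n : ℕ => X.nrm (f - samplingOp (m n) (x n) (φ n) f))
        =O[atTop] (fun n : ℕ => (n : ℝ) ^ (-α)) ↔
      (fun n : ℕ => X.discreteNrm (m n) (x n) (oneSubPow (steklov (γ / n)) r f) +
          X.nrm (oneSubPow (steklovDot (γ / n)) s f))
        =O[atTop] (fun n : ℕ => (n : ℝ) ^ (-α)) := by
  obtain ⟨C, hC⟩ := hX.exists_windowBound
  obtain ⟨K₁, hK₁, hA1⟩ := hA1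
  obtain ⟨K₂, hK₂, hA2⟩ := hA2
  obtain ⟨K₃, hK₃, hA3⟩ := hA3
  have hpart : ∀ n ≥ 1, BanachFunctionLattice.IsPartition (m n) (x n) (γ' / n) := fun n hn =>
    { wrap := hx.wrap n hn
      lt := fun k hk => by
        have hn0 : (0 : ℝ) < n := by exact_mod_cast hn
        have : 0 < γ / n := by positivity
        linarith [hx.gap_ge n hn k hk]
      le := fun k hk => by linarith [hx.gap_le n hn k hk] }
  have hGsub : ∀ n f g, samplingOp (m n) (x n) (φ n) (f - g) =
      samplingOp (m n) (x n) (φ n) f - samplingOp (m n) (x n) (φ n) g := by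
    intro n f g
    ext y
    simp [samplingOp, sub_mul, Finset.sum_sub_distrib]
  have hGΦ : ∀ n ≥ 1, ∀ f, samplingOp (m n) (x n) (φ n) f ∈ Φ n := by
    intro n hn f
    have e : samplingOp (m n) (x n) (φ n) f = ∑ k ∈ Finset.range (m n), f (x n k) • φ n k := by
      ext y
      simp [samplingOp]
    rw [e]
    exact (Φ n).sum_mem fun k hk => (Φ n).smul_mem _ (hφ n hn k (Finset.mem_range.1 hk))
  have hGmem : ∀ n ≥ 1, ∀ f, samplingOp (m n) (x n) (φ n) f ∈ X.carrier := fun n hn f =>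
    hΦ.le_carrier n (hGΦ n hn f)
  rw [isBigO_rpow_iff (fun n hn => X.nrm_nonneg (X.carrier.sub_mem hf (hGmem n hn f))),
    isBigO_rpow_iff (fun n hn => by
      have hn0 : (0 : ℝ) < n := by exact_mod_cast hn
      have hh : 0 < γ / n := by positivity
      refine add_nonneg (BanachFunctionLattice.discreteNrm_nonneg _ _ _) ?_
      rw [show f = BanachFunctionLattice.toElem f hf from rfl,
        hC.oneSubPow_steklovDot hh (BanachFunctionLattice.half_step_mem hh)]
      exact norm_nonneg (_ : X.Elem))]
  constructor
  · rintro ⟨M, n₀, hn₀, H⟩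
    exact BanachFunctionLattice.smoothness_of_sampling_rate hC hs hrs hγ hγ' hpart
      (G := fun n => samplingOp (m n) (x n) (φ n)) hGsub hGmem hK₁ hK₂ hK₃ hA1 hA2 hA3 hα hαs hΦ
      hGΦ (BanachFunctionLattice.toElem f hf) hn₀ H
  · rintro ⟨M, n₀, hn₀, H⟩
    exact BanachFunctionLattice.sampling_rate_of_smoothness hC hs hrs hγ hγ' hpart
      (G := fun n => samplingOp (m n) (x n) (φ n)) hGsub hGmem hK₁ hK₃ hA1 hA3 hα hαs
      (BanachFunctionLattice.toElem f hf) hn₀ H
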